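/- Let $A_0<-1$, $0<\varepsilon<1$, and let $v=\nabla\psi$ on $\mathbb R^2\setminus\{O\}$, $O=0$, with $\psi=A_0\log r+\varepsilon r\sin\theta$. Consider the acoustic metric $dx_0^2-|dx-v\,dx_0|^2$ (constant density and sound speed, normalised to $1$), with inverse $g^{00}=1$, $g^{0j}=g^{j0}=v_j$, $g^{jk}=v_jv_k-\delta_{jk}$. Put $\Delta=g^{11}g^{22}-(g^{12})^2=1-|v|^2$. The ergoregion $\Omega$ is $\{\Delta<0\}$ together with $O$, and the ergosphere is $\partial\Omega$. A point of $\partial\Omega$ is tangential if its normal $\nu=\nabla\Delta\neq0$ satisfies $\sum_{j,k=1}^2 g^{jk}\nu_j\nu_k=0$. In $\Omega\setminus\{O\}$ the equation $\sum_{j,k=1}^2g^{jk}\xi_j\xi_k=0$ has two independent solutions, $\xi^\pm=|v|^{-2}\bigl(v\mp\sqrt{|v|^2-1}\,v^\perp\bigr)$ with $v^\perp=(-v_2,v_1)$; the $(\pm)$ trajectories are the solutions in $\Omega\setminus\{O\}$ of $$\frac{dx_j}{dx_0}=\frac{\sum_{k=1}^2 g^{jk}\xi^\pm_k}{\sum_{k=1}^2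 g^{0k}\xi_k^\pm},\qquad j=1,2 .$$ Let $\Omega^\pm$ be the union of the $(\pm)$ trajectories that end at $O$ as $x_0$ increases, and let $\Omega_0=(\Omega^+\cap\Omega^-)\cup\{O\}$. Near the ergosphere use the coordinates $(t,\theta)$, $t=\sqrt{r^2(|v|^2-1)}\ge 0$, in which the $(\pm)$ fields extend as $C^1$ fields to a full neighbourhood of $(0,\pm\pi/2)$. A zero of such a field is a saddle, an unstable node or an unstable spiral if the eigenvalues of its linearization are, respectively, real of opposite signs, distinct and positive, or non-real with positive real part. 1. On the ergosphere $\Delta=0$ and $\nabla\Delta\ne0$, and it has exactly two tangential points: $\alpha_1$ ($\theta=\pi/2$, $r=\frac{-A_0}{1+\varepsilon}$) and $\alpha_2$ ($\theta=-\pi/2$, $r=\frac{-A_0}{1-\varepsilon}$). 2. For both families, $(t,\theta)=(0,\pi/2)$ is a saddle, and $(0,-\pi/2)$ is an unstable node if $\varepsilon<\frac19$ and an unstable spiral if $\varepsilon>\frac19$. 3. Let $\varepsilon>\frac19$. Then $\Omega_0$ is a black hole: it is a bounded connected open set whose boundary is a Jordan curve that is piecewise characteristic (off finitely many points it is locally a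 regular $C^1$ curve with characteristic normal), and no forward null geodesic (projection to $\mathbb R^2\setminus\{O\}$ of a null-bicharacteristic with $dx_0/ds>0$) passes from $\Omega_0$ to the exterior of this curve. Moreover there are a $(+)$ trajectory $\gamma^+$ and a $(-)$ trajectory $\gamma^-$, defined for $x_0\in(0,\infty)$, such that: * as $x_0\to0^+$, $\gamma^+$ tends to a point of the ergosphere with angle $\theta^+\in(-\pi/2,\pi/2)$ and $\gamma^-$ to one with angle $\theta^-\in(\pi/2,3\pi/2)$; as $x_0\to+\infty$ both tend to $\alpha_1$; * the boundary of $\Omega^+\cup\{O\}$ is the union of $\gamma^+$ and the arc $\theta^+\le\theta\le\pi/2$ of the ergosphere, and the boundary of $\Omega^-\cup\{O\}$ is the union of $\gamma^-$ and the arc $\pi/2\le\theta\le\theta^-$; * there are $s_\pm>0$ with $\gamma^+(s_+)=\gamma^-(s_-)=:P$ such that $\partial\Omega_0=\gamma^+([s_+,\infty))\cup\gamma^-([s_-,\infty))\cup\{\alpha_1\}$, the two arcs meet only at $P$, and their tangent vectors at $P$ are linearly independent, so that $P$ is a corner of $\partial\Omega_0$; the unit tangents of $\gamma^+$ and $\gamma^-$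 tend at $\alpha_1$ to $(1,0)$ and $(-1,0)$, so there the boundary has a tangent (that of the ergosphere) and no corner. -/

import Mathlib

open Set Filter Topology

noncomputable section

namespace Acoustic

/-- The plane `ℝ²` with its Euclidean norm; `x 0` is `x₁`, `x 1` is `x₂`. -/
abbrev Plane : Type := EuclideanSpace ℝ (Fin 2)

/-- The point with polar coordinates `(r, θ)`. -/
def polar (r θ : ℝ) : Plane := !₂[r * Real.cos θ, r * Real.sin θ]

/-- Rotation by a right angle, `(x₁, x₂) ↦ (-x₂, x₁)`. -/
def rot (w : Plane) : Plane := !₂[-(w 1), w 0]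

/-- The potential `ψ = A₀ log r + ε r sin θ`. -/
def potential (A₀ ε : ℝ) (x : Plane) : ℝ := A₀ * Real.log ‖x‖ + ε * x 1

/-- The flow velocity `v = ∇ψ` (meaningful off the singularity `O = 0`). -/
def velocity (A₀ ε : ℝ) (x : Plane) : Plane := gradient (potential A₀ ε) x

/-- The inverse metric `[g^{jk}]`, `0 ≤ j, k ≤ 2`, of the acoustic metric
`dx₀² - |dx - v dx₀|²` (constant density and sound speed, both normalised to `1`). -/
def gInv (A₀ ε : ℝ) (x : Plane) : Matrix (Fin 3) (Fin 3) ℝ :=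
  let v := velocity A₀ ε x
  !![1, v 0, v 1;
     v 0, v 0 * v 0 - 1, v 0 * v 1;
     v 1, v 1 * v 0, v 1 * v 1 - 1]

/-- The spatial form `∑_{j,k=1}^2 g^{jk}(x) η_j η_k`; a covector `η ≠ 0` is characteristic
when it vanishes. -/
def spatialForm (A₀ ε : ℝ) (x η : Plane) : ℝ :=
  ∑ j : Fin 2, ∑ k : Fin 2, gInv A₀ ε x j.succ k.succ * η j * η k

/-- `Δ = g^{11} g^{22} - (g^{12})²`. -/
def delta (A₀ ε : ℝ) (x : Plane) : ℝ :=
  gInv A₀ ε x 1 1 * gInv A₀ ε x 2 2 - (gInv A₀ ε x 1 2) ^ 2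

/-- The ergoregion `Ω = {Δ < 0}`, together with the singularity `O` that it surrounds. -/
def ergoregion (A₀ ε : ℝ) : Set Plane := insert 0 {x | x ≠ 0 ∧ delta A₀ ε x < 0}

/-- The ergosphere `∂Ω`. -/
def ergosphere (A₀ ε : ℝ) : Set Plane := frontier (ergoregion A₀ ε)

/-- The tangential points: points of the ergosphere at which its normal (the direction of `∇Δ`)
is characteristic. -/
def tangentialPoints (A₀ ε : ℝ) : Set Plane :=
  {x | x ∈ ergosphere A₀ ε ∧ gradient (delta A₀ ε) x ≠ 0 ∧
    spatialForm A₀ ε x (gradient (delta A₀ ε) x) = 0}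

/-! ### Zero-energy null geodesics -/

/-- The two characteristic covectors `ξ^±` at a point of the ergoregion (`σ = 1` for `(+)`,
`σ = -1` for `(-)`), with `f^± = (ξ₂, -ξ₁)` continuous up to the ergosphere and `f⁺ = f⁻` there. -/
def nullCovector (A₀ ε σ : ℝ) (x : Plane) : Plane :=
  let v := velocity A₀ ε x
  (‖v‖ ^ 2)⁻¹ • (v - (σ * √(‖v‖ ^ 2 - 1)) • rot v)

/-- The field `dx_j/dx₀ = (∑_k g^{jk} ξ_k) / (∑_k g^{0k} ξ_k)`, `ξ = ξ^±`, whose integral curves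
are the zero-energy null geodesics parametrised by `x₀`. -/
def familyField (A₀ ε σ : ℝ) (x : Plane) : Plane :=
  WithLp.toLp 2 fun j : Fin 2 =>
    (∑ k : Fin 2, gInv A₀ ε x j.succ k.succ * nullCovector A₀ ε σ x k) /
      (∑ k : Fin 2, gInv A₀ ε x 0 k.succ * nullCovector A₀ ε σ x k)

/-- `γ` is, on the open time interval `I`, a trajectory of the `(σ)` family in `Ω ∖ O`. -/
structure IsTrajectory (A₀ ε σ : ℝ) (γ : ℝ → Plane) (I : Set ℝ) : Prop where
  isOpen : IsOpen I
  ordConnected : I.OrdConnected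
  mem : ∀ s ∈ I, γ s ∈ ergoregion A₀ ε ∧ γ s ≠ 0
  hasDerivAt : ∀ s ∈ I, HasDerivAt γ (familyField A₀ ε σ (γ s)) s

/-- `Ω^±`: the union of the `(σ)` trajectories that end at the singularity `O` as `x₀` increases
to the right end of the time interval. -/
def basin (A₀ ε σ : ℝ) : Set Plane :=
  {x | ∃ (I : Set ℝ) (γ : ℝ → Plane), IsTrajectory A₀ ε σ γ I ∧
    Tendsto (fun s : I => γ s) atTop (𝓝 0) ∧ x ∈ γ '' I}

/-- `Ω₀ = Ω⁺ ∩ Ω⁻`, with the singularity filled in. -/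
def blackHole (A₀ ε : ℝ) : Set Plane := insert 0 (basin A₀ ε 1 ∩ basin A₀ ε (-1))

/-! ### Types of the critical points in `(t, θ)` coordinates -/

/-- The coordinate `t = √ρ`, where `ρ = r² (|v|² - 1) = - r² Δ`. -/
def tCoord (A₀ ε : ℝ) (x : Plane) : ℝ := √(-(‖x‖ ^ 2 * delta A₀ ε x))

/-- `(dt/dx₀, dθ/dx₀)` along the `(σ)` family at the point `x`. -/
def tThetaVelocity (A₀ ε σ : ℝ) (x : Plane) : Fin 2 → ℝ :=
  let w := familyField A₀ ε σ x
  ![fderiv ℝ (tCoord A₀ ε) x w, (x 0 * w 1 - x 1 * w 0) / ‖x‖ ^ 2]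

/-- In `(t, θ)` coordinates the `(σ)` family, given for `t > 0`, is the restriction of a `C¹`
field `Z` defined near `(0, θ₀)`; this field vanishes at `(0, θ₀)` and its derivative there
is `M`. (The values for `t > 0` determine `M`.) -/
def HasLinearization (A₀ ε σ θ₀ : ℝ) (M : Matrix (Fin 2) (Fin 2) ℝ) : Prop :=
  ∃ Z : (Fin 2 → ℝ) → (Fin 2 → ℝ),
    ContDiffAt ℝ 1 Z ![0, θ₀] ∧
    (∀ᶠ q in 𝓝 (![0, θ₀] : Fin 2 → ℝ), 0 < q 0 →
      ∃ r : ℝ, 0 < r ∧ (∀ r' : ℝ, 0 < r' → (tCoord A₀ ε (polar r' (q 1)) = q 0 ↔ r' = r)) ∧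
        Z q = tThetaVelocity A₀ ε σ (polar r (q 1))) ∧
    Z ![0, θ₀] = 0 ∧
    HasFDerivAt Z (LinearMap.toContinuousLinearMap (Matrix.toLin' M)) ![0, θ₀]

/-- Saddle: real eigenvalues of opposite signs. -/
def IsSaddleAt (A₀ ε σ θ₀ : ℝ) : Prop :=
  ∃ M, HasLinearization A₀ ε σ θ₀ M ∧ ∃ a b : ℝ, a < 0 ∧ 0 < b ∧
    Module.End.HasEigenvalue (Matrix.toLin' M) a ∧ Module.End.HasEigenvalue (Matrix.toLin' M) b

/-- Unstable (non-degenerate) node: two distinct positive eigenvalues. -/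
def IsUnstableNodeAt (A₀ ε σ θ₀ : ℝ) : Prop :=
  ∃ M, HasLinearization A₀ ε σ θ₀ M ∧ ∃ a b : ℝ, 0 < a ∧ a < b ∧
    Module.End.HasEigenvalue (Matrix.toLin' M) a ∧ Module.End.HasEigenvalue (Matrix.toLin' M) b

/-- Unstable spiral: non-real (hence conjugate) eigenvalues with positive real part. -/
def IsUnstableSpiralAt (A₀ ε σ θ₀ : ℝ) : Prop :=
  ∃ M, HasLinearization A₀ ε σ θ₀ M ∧ ∃ z : ℂ, 0 < z.re ∧ z.im ≠ 0 ∧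
    Module.End.HasEigenvalue (Matrix.toLin' (M.map ((↑) : ℝ → ℂ))) z

/-! ### Black holes -/

/-- `(x₀, x, ξ)` is a forward (`dx₀/ds > 0`) null-bicharacteristic on the open interval `I`; its
projection `x` to the plane is a forward null geodesic. -/
structure IsForwardNullBichar (A₀ ε : ℝ) (x₀ : ℝ → ℝ) (x : ℝ → Plane) (ξ : ℝ → Fin 3 → ℝ)
    (I : Set ℝ) : Prop where
  isOpen : IsOpen I
  ordConnected : I.OrdConnected
  ne_zero : ∀ s ∈ I, x s ≠ 0
  deriv_time : ∀ s ∈ I, HasDerivAt x₀ (2 * ∑ k, gInv A₀ ε (x s) 0 k * ξ s k) s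
  deriv_space : ∀ s ∈ I, ∀ p : Fin 2,
    HasDerivAt (fun s => x s p) (2 * ∑ k, gInv A₀ ε (x s) p.succ k * ξ s k) s
  deriv_energy : ∀ s ∈ I, HasDerivAt (fun s => ξ s 0) 0 s
  deriv_covector : ∀ s ∈ I, ∀ p : Fin 2,
    HasDerivAt (fun s => ξ s p.succ)
      (-∑ j, ∑ k, fderiv ℝ (fun y => gInv A₀ ε y j k) (x s) (EuclideanSpace.single p 1) *
        ξ s j * ξ s k) s
  null : ∀ s ∈ I, ∑ j, ∑ k, gInv A₀ ε (x s) j k * ξ s j * ξ s k = 0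
  forward : ∀ s ∈ I, 0 < 2 * ∑ k, gInv A₀ ε (x s) 0 k * ξ s k

/-- A Jordan curve: a homeomorphic image of the circle. -/
def IsJordanCurve (S : Set Plane) : Prop :=
  ∃ c : Circle → Plane, Continuous c ∧ Function.Injective c ∧ range c = S

/-- `ℝ × S` is piecewise characteristic: off finitely many points, `S` is locally a regular `C¹`
level set whose normal is characteristic. -/
def IsPiecewiseCharacteristic (A₀ ε : ℝ) (S : Set Plane) : Prop :=
  ∃ T : Set Plane, T.Finite ∧ ∀ x ∈ S, x ∉ T → ∃ φ : Plane → ℝ,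
    ContDiffAt ℝ 1 φ x ∧ gradient φ x ≠ 0 ∧ (∀ᶠ y in 𝓝 x, y ∈ S ↔ φ y = 0) ∧
    spatialForm A₀ ε x (gradient φ x) = 0

/-- `ℝ × D` is a black hole: `D` is the region enclosed by a Jordan curve (its frontier), this
curve is piecewise characteristic, and no forward null geodesic passes from `D` to the exterior
of the curve. -/
structure IsBlackHole (A₀ ε : ℝ) (D : Set Plane) : Prop where
  isOpen : IsOpen D
  isConnected : IsConnected D
  isBounded : Bornology.IsBounded D
  isJordanCurve : IsJordanCurve (frontier D)
  characteristic : IsPiecewiseCharacteristic A₀ ε (frontier D)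
  noEscape : ∀ (x₀ : ℝ → ℝ) (x : ℝ → Plane) (ξ : ℝ → Fin 3 → ℝ) (I : Set ℝ),
    IsForwardNullBichar A₀ ε x₀ x ξ I →
    ∀ s₁ ∈ I, ∀ s₂ ∈ I, s₁ ≤ s₂ → x s₁ ∈ D → x s₂ ∈ closure D

end Acoustic

end

open Set Filter Topology

noncomputable section

namespace Acoustic

/-! ### Scalar differential equations -/

/-! Put `a = -A₀` and `ρ = r² (|v|² - 1)`. This is a quadratic polynomial, so the ergoregion is a
disc. On its boundary `|v| = 1`, a covector is characteristic exactly when it is parallel to `v`,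
and `∇Δ × v` is a nonzero multiple of `x₁`; this gives the two tangential points. In the coordinates
`(t, θ)`, `t = √ρ`, the radial and angular components of the field carry a factor `t` that cancels
the singularity of `dt` (`fieldTT_eq`). The linearization at the lower tangential point has
discriminant proportional to `1 - 9ε`.

The global part reduces to one scalar equation. With the angle `u` measured from the positive
`x₂`-axis and oriented by the family, both families satisfy the same equation `dr/du = slopeField`,
and `u` decreases in time. The slope contains `√ρ`, so it is not Lipschitz at the ergosphere. It is
therefore extended to a bounded continuous function, solved by Peano's theorem
(`exists_global_solution`), and uniqueness is used only where `ρ > 0`. Two monotonicity facts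
replace it elsewhere: where `ρ ≤ 0`, the derivative of `ρ` along a solution has the sign of `sin u`
(`IsSol.exists_hasDerivAt_polRho`); where `ρ > 0`, `exp(-ψ/a)` increases with `u`
(`IsSol.lyap_strictMonoOn`).

The separatrix `R` is the solution leaving the saddle `u = 0`. It stays inside for `0 < u < π`; it
cannot end at the lower tangential point, because a spiral has no limiting direction
(`IsSol.polRho_pi_ne_zero`); and it must exit at some `up` in `(π, 2π)`, since otherwise `exp(-ψ/a)`
would return larger to the saddle direction. A point below `R` inside the ergoregion stays below on
every turn, and the monotone quantity forces it to `r = 0` (`IsSeparatrix.exists_solution_to_zero`);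
a trajectory outside cannot cross `R` inwards, by uniqueness. Hence each basin, with `O` added, is
the star-shaped domain below `min R ergRadius` (`IsSeparatrix.insert_basin_eq`). The two basins are
mirror images, and `R w < R (2π - w)` for `0 < w < π`, so `Ω₀` is the domain below `R (min u (2π -
u))`, with its corner at `u = π`.

No null geodesic leaves because `F = r - R(u)` satisfies the eikonal equation `v · ∇F + |∇F| = 0` on
the boundary (`IsSeparatrix.eikonal`): the fastest admissible motion is at best tangent to it, and a
one-sided Grönwall inequality turns this into confinement. At the corner the barriers of both
families are used together. -/

/-- The sliding average of `f u` over `[y, y + 1/(n+1)]`. -/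
def slidingAverage (f : ℝ → ℝ → ℝ) (n : ℕ) (u y : ℝ) : ℝ :=
  (n + 1 : ℝ) * ∫ z in y..(y + 1 / (n + 1 : ℝ)), f u z

/-- Averaging preserves closeness to a constant. With `c = 0` this bounds the averaged fields
uniformly in `n`; with `c` a value of `f` it gives their convergence. -/
lemma abs_slidingAverage_sub_le {f : ℝ → ℝ → ℝ} (hf : Continuous (Function.uncurry f)) (n : ℕ)
    {u y c δ : ℝ} (h : ∀ z ∈ Icc y (y + 1 / (n + 1 : ℝ)), |f u z - c| ≤ δ) :
    |slidingAverage f n u y - c| ≤ δ := by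
  have hn : (0 : ℝ) < n + 1 := by positivity
  have hy : y ≤ y + 1 / (n + 1 : ℝ) := by
    have : 0 < 1 / (n + 1 : ℝ) := by positivity
    linarith
  have hfu : Continuous (f u) := hf.comp (by fun_prop : Continuous fun z => (u, z))
  have h1 : ∫ z in y..(y + 1 / (n + 1 : ℝ)), (f u z - c) =
      (∫ z in y..(y + 1 / (n + 1 : ℝ)), f u z) - 1 / (n + 1 : ℝ) * c := by
    rw [intervalIntegral.integral_sub (hfu.intervalIntegrable _ _)
      (continuous_const.intervalIntegrable _ _)]
    simp
  have h2 := intervalIntegral.norm_integral_le_of_norm_le_const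
    (f := fun z => f u z - c) (a := y) (b := y + 1 / (n + 1 : ℝ)) (C := δ) (by
      intro z hz
      rw [uIoc_of_le hy] at hz
      exact h z (Ioc_subset_Icc_self hz))
  have h3 : slidingAverage f n u y - c =
      (n + 1) * ∫ z in y..(y + 1 / (n + 1 : ℝ)), (f u z - c) := by
    rw [h1, slidingAverage]; field_simp
  rw [h3, abs_mul, abs_of_pos hn]
  rw [Real.norm_eq_abs] at h2
  calc (n + 1 : ℝ) * _ ≤ (n + 1) * (δ * |y + 1 / (n + 1 : ℝ) - y|) := by gcongr
    _ = δ := by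
      rw [add_sub_cancel_left, abs_of_pos (by positivity)]; field_simp

/-- The derivative in `y` is a difference quotient of `f u`, hence bounded by a constant depending
on `n`. This makes the averaged equation accessible to Picard–Lindelöf. -/
lemma slidingAverage_lipschitzWith {f : ℝ → ℝ → ℝ} (hf : Continuous (Function.uncurry f)) {M : ℝ}
    (hM : ∀ u y, |f u y| ≤ M) (n : ℕ) (u : ℝ) :
    LipschitzWith (Real.toNNReal ((n + 1) * (2 * M))) (slidingAverage f n u) := by
  have hfu : Continuous (f u) := hf.comp (by fun_prop : Continuous fun z => (u, z))
  have hM0 : 0 ≤ M := (abs_nonneg _).trans (hM 0 0)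
  have key : ∀ y, HasDerivAt (slidingAverage f n u)
      ((n + 1 : ℝ) * (f u (y + 1 / (n + 1 : ℝ)) - f u y)) y := by
    intro y
    have e : slidingAverage f n u = fun y => (n + 1 : ℝ) *
        ((∫ z in (0 : ℝ)..(y + 1 / (n + 1 : ℝ)), f u z) - ∫ z in (0 : ℝ)..y, f u z) := by
      funext y
      rw [slidingAverage, intervalIntegral.integral_interval_sub_left
        (hfu.intervalIntegrable _ _) (hfu.intervalIntegrable _ _)]
    rw [e]
    refine HasDerivAt.const_mul _ (HasDerivAt.sub ?_ ?_)
    · exact HasDerivAt.comp_add_const (f := fun w => ∫ z in (0 : ℝ)..w, f u z) y _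
        (intervalIntegral.integral_hasDerivAt_right (hfu.intervalIntegrable _ _)
          hfu.stronglyMeasurable.stronglyMeasurableAtFilter hfu.continuousAt)
    · exact intervalIntegral.integral_hasDerivAt_right (hfu.intervalIntegrable _ _)
          hfu.stronglyMeasurable.stronglyMeasurableAtFilter hfu.continuousAt
  refine lipschitzWith_of_nnnorm_deriv_le (fun y => (key y).differentiableAt) fun y => ?_
  rw [(key y).deriv, ← NNReal.coe_le_coe, coe_nnnorm, Real.coe_toNNReal _ (by positivity),
    Real.norm_eq_abs, abs_mul, abs_of_pos (by positivity : (0 : ℝ) < n + 1)]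
  gcongr
  have h1 := hM u (y + 1 / (n + 1 : ℝ))
  have h2 := hM u y
  rw [abs_le] at h1 h2 ⊢
  constructor <;> linarith

lemma exists_solution_slidingAverage {f : ℝ → ℝ → ℝ} (hf : Continuous (Function.uncurry f)) {M : ℝ}
    (hM : ∀ u y, |f u y| ≤ M) (u₀ y₀ : ℝ) (n : ℕ) :
    ∃ x : ℝ → ℝ, x u₀ = y₀ ∧ ∀ u ∈ Ioo (u₀ - n - 1) (u₀ + n + 1),
      HasDerivAt x (slidingAverage f n u (x u)) u := by
  have hM0 : 0 ≤ M := (abs_nonneg _).trans (hM 0 0)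
  have hbd : ∀ u y, |slidingAverage f n u y| ≤ M := fun u y => by
    simpa using abs_slidingAverage_sub_le hf n (u := u) (y := y) (c := 0) (δ := M)
      (fun z _ => by simpa using hM u z)
  have hn : (0 : ℝ) ≤ n := Nat.cast_nonneg n
  have hPL : IsPicardLindelof (slidingAverage f n) (tmin := u₀ - n - 1) (tmax := u₀ + n + 1)
      ⟨u₀, by constructor <;> linarith⟩ y₀ (Real.toNNReal (M * (n + 1))) 0 (Real.toNNReal M)
      (Real.toNNReal ((n + 1) * (2 * M))) := by
    refine ⟨fun u _ => (slidingAverage_lipschitzWith hf hM n u).lipschitzOnWith, ?_, ?_, ?_⟩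
    · intro y _
      refine Continuous.continuousOn ?_
      unfold slidingAverage
      exact continuous_const.mul
        (intervalIntegral.continuous_parametric_intervalIntegral_of_continuous' hf _ _)
    · intro u _ y _
      rw [Real.coe_toNNReal _ hM0]
      exact hbd u y
    · rw [Real.coe_toNNReal _ hM0, Real.coe_toNNReal _ (by positivity)]
      simp only [NNReal.coe_zero, sub_zero]
      gcongr
      apply max_le <;> linarith
  obtain ⟨x, hx0, hx⟩ := hPL.exists_eq_forall_mem_Icc_hasDerivWithinAt₀
  exact ⟨x, hx0, fun u hu => (hx u (Ioo_subset_Icc_self hu)).hasDerivAt (Icc_mem_nhds hu.1 hu.2)⟩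

/-- **Peano's theorem** for a bounded continuous scalar equation: a solution exists for all times. -/
theorem exists_global_solution {f : ℝ → ℝ → ℝ} (hf : Continuous (Function.uncurry f)) {M : ℝ}
    (hM : ∀ u y, |f u y| ≤ M) (u₀ y₀ : ℝ) :
    ∃ x : ℝ → ℝ, x u₀ = y₀ ∧ ∀ u, HasDerivAt x (f u (x u)) u := by
  have hM0 : 0 ≤ M := (abs_nonneg _).trans (hM 0 0)
  have hbd : ∀ n u y, |slidingAverage f n u y| ≤ M := fun n u y => by
    simpa using abs_slidingAverage_sub_le hf n (u := u) (y := y) (c := 0) (δ := M)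
      (fun z _ => by simpa using hM u z)
  choose x hx0 hx using fun n => exists_solution_slidingAverage hf hM u₀ y₀ n
  have hlip : ∀ n : ℕ, ∀ u ∈ Ioo (u₀ - n - 1) (u₀ + n + 1), ∀ w ∈ Ioo (u₀ - n - 1) (u₀ + n + 1),
      |x n w - x n u| ≤ M * |w - u| := by
    intro n u hu w hw
    exact (convex_Ioo _ _).norm_image_sub_le_of_norm_hasDerivWithin_le
      (f := x n) (fun z hz => (hx n z hz).hasDerivWithinAt) (fun z _ => hbd n z _) hu hw
  have hmem : ∀ u, ∀ᶠ n : ℕ in atTop, u ∈ Ioo (u₀ - n - 1) (u₀ + n + 1) := by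
    intro u
    filter_upwards [eventually_ge_atTop ⌈|u - u₀|⌉₊] with n hn
    have h1 : |u - u₀| ≤ n := (Nat.le_ceil _).trans (by exact_mod_cast hn)
    rw [abs_le] at h1
    constructor <;> linarith
  have hmem0 : ∀ n : ℕ, u₀ ∈ Ioo (u₀ - n - 1) (u₀ + n + 1) := fun n => by
    have hn : (0 : ℝ) ≤ n := Nat.cast_nonneg n
    constructor <;> linarith
  -- A limit along one fixed ultrafilter exists for every `u` at once, since the values lie in a
  -- compact interval; this takes the place of an Arzelà–Ascoli subsequence.
  set U : Ultrafilter ℕ := hyperfilter ℕ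
  have hU : (U : Filter ℕ) ≤ atTop := Nat.hyperfilter_le_atTop
  have hlim : ∀ u, ∃ l, Tendsto (fun n => x n u) U (𝓝 l) := by
    intro u
    have hev : ∀ᶠ n in (U : Filter ℕ), x n u ∈ Icc (y₀ - M * |u - u₀|) (y₀ + M * |u - u₀|) := by
      filter_upwards [hU (hmem u)] with n hn
      have := hlip n u₀ (hmem0 n) u hn
      rw [hx0, abs_le] at this
      constructor <;> linarith
    obtain ⟨l, -, hl⟩ := isCompact_Icc.ultrafilter_le_nhds (U.map fun n => x n u)
      (le_principal_iff.2 hev)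
    exact ⟨l, hl⟩
  choose y hy using hlim
  refine ⟨y, tendsto_nhds_unique (hy u₀) (by simp [hx0]), ?_⟩
  have hylip : ∀ u w, |y w - y u| ≤ M * |w - u| := by
    intro u w
    refine le_of_tendsto ((hy w).sub (hy u)).abs ?_
    filter_upwards [hU (hmem u), hU (hmem w)] with n h1 h2 using hlip n u h1 w h2
  have hycont : Continuous y :=
    (LipschitzWith.of_dist_le_mul (K := M.toNNReal) fun w u => by
      rw [Real.coe_toNNReal _ hM0]; exact hylip u w).continuous
  intro u
  -- The common Lipschitz bound `M` makes `x n w` close to `y u` for all `w` near `u`, so the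
  -- derivatives converge uniformly near `u`, which is enough to differentiate the limit.
  refine hasDerivAt_of_tendstoUniformlyOnFilter (l := (U : Filter ℕ)) (f := x)
    (f' := fun n u => slidingAverage f n u (x n u)) (g' := fun u => f u (y u)) ?_ ?_
    (Eventually.of_forall hy)
  · rw [Metric.tendstoUniformlyOnFilter_iff]
    intro δ hδ
    obtain ⟨η, hη, hfη⟩ := Metric.continuous_iff.1 hf (u, y u) (δ / 3) (by positivity)
    have hg : Continuous fun u => f u (y u) :=
      hf.comp (by fun_prop : Continuous fun u => (u, y u))
    have e1 : ∀ᶠ w in 𝓝 u, dist (f w (y w)) (f u (y u)) < δ / 3 :=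
      Metric.tendsto_nhds.1 hg.continuousAt _ (by positivity)
    have e2 : ∀ᶠ w in 𝓝 u, M * |w - u| < η / 4 := by
      have : Tendsto (fun w => M * |w - u|) (𝓝 u) (𝓝 (M * |u - u|)) := by
        apply Continuous.tendsto; fun_prop
      rw [sub_self, abs_zero, mul_zero] at this
      exact this.eventually (gt_mem_nhds (by positivity))
    have e3 : ∀ᶠ w in 𝓝 u, |w - u| < η := 
      Metric.ball_mem_nhds u hη
    have e3' : ∀ᶠ w in 𝓝 u, |w - u| < 1 := 
      Metric.ball_mem_nhds u one_pos
    have e4 : ∀ᶠ n in (U : Filter ℕ), |x n u - y u| < η / 4 := by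
      have := Metric.tendsto_nhds.1 (hy u) (η / 4) (by positivity)
      simpa [Real.dist_eq] using this
    have e5 : ∀ᶠ n : ℕ in (U : Filter ℕ), 1 / (n + 1 : ℝ) < η / 4 :=
      hU (tendsto_one_div_add_atTop_nhds_zero_nat.eventually (gt_mem_nhds (by positivity)))
    have e6 : ∀ᶠ n : ℕ in (U : Filter ℕ), u - 1 ∈ Ioo (u₀ - n - 1) (u₀ + n + 1) ∧
        u + 1 ∈ Ioo (u₀ - n - 1) (u₀ + n + 1) := hU ((hmem _).and (hmem _))
    filter_upwards [(e4.and (e5.and e6)).prod_mk (e1.and (e2.and (e3.and e3')))]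
    rintro ⟨n, w⟩ ⟨⟨h4, h5, h6⟩, h1, h2, h3, h3'⟩
    simp only at h1 h2 h3 h3' h4 h5 h6 ⊢
    rw [abs_lt] at h3'
    have hxw : |x n w - x n u| ≤ M * |w - u| := by
      apply hlip n u ⟨by linarith [h6.1.1], by linarith [h6.2.2]⟩ w
        ⟨by linarith [h6.1.1], by linarith [h6.2.2]⟩
    have hav := abs_slidingAverage_sub_le hf n (u := w) (y := x n w) (c := f u (y u))
      (δ := δ / 3) (by
        intro z hz
        have := hfη (w, z) (by
          rw [Prod.dist_eq]
          refine max_lt (by simpa [Real.dist_eq] using h3) ?_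
          rw [Real.dist_eq]
          have hz' : |z - x n w| ≤ η / 4 := by
            rw [abs_le]; constructor <;> linarith [hz.1, hz.2]
          calc |z - y u| = |(z - x n w) + (x n w - x n u) + (x n u - y u)| := by ring_nf
            _ ≤ |z - x n w| + |x n w - x n u| + |x n u - y u| := abs_add_three _ _ _
            _ < η := by linarith)
        exact this.le)
    rw [Real.dist_eq] at h1 ⊢
    calc |f w (y w) - slidingAverage f n w (x n w)|
        = |(f w (y w) - f u (y u)) - (slidingAverage f n w (x n w) - f u (y u))| := by ring_nf
      _ ≤ |f w (y w) - f u (y u)| + |slidingAverage f n w (x n w) - f u (y u)| := abs_sub _ _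
      _ < δ := by linarith
  · have e6 : ∀ᶠ n : ℕ in (U : Filter ℕ), u - 1 ∈ Ioo (u₀ - n - 1) (u₀ + n + 1) ∧
        u + 1 ∈ Ioo (u₀ - n - 1) (u₀ + n + 1) := hU ((hmem _).and (hmem _))
    have e3 : ∀ᶠ w in 𝓝 u, |w - u| < 1 := 
      Metric.ball_mem_nhds u one_pos
    filter_upwards [e6.prod_mk e3]
    rintro ⟨n, w⟩ ⟨h6, h3⟩
    simp only at h3 h6 ⊢
    rw [abs_lt] at h3
    exact hx n w ⟨by linarith [h6.1.1], by linarith [h6.2.2]⟩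

/-- A function that starts nonnegative and increases wherever it is nonpositive is positive. -/
lemma pos_of_deriv_pos_of_nonpos {f : ℝ → ℝ} {a b : ℝ} (hc : ContinuousOn f (Icc a b))
    (ha : 0 ≤ f a) (hd : ∀ u ∈ Ioc a b, f u ≤ 0 → ∃ f' > 0, HasDerivAt f f' u) :
    ∀ u ∈ Ioc a b, 0 < f u := by
  intro u hu
  by_contra! hneg
  obtain ⟨m, hm, hmin⟩ := isCompact_Icc.exists_isMinOn (nonempty_Icc.2 hu.1.le)
    (hc.mono (Icc_subset_Icc_right hu.2))
  -- A positive derivative at a point where `f ≤ 0` produces a smaller value to its left. So a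
  -- negative minimum can only sit at `a`, where `f ≥ 0`.
  have hleft : ∀ w ∈ Ioc a u, f w ≤ 0 → ∃ z ∈ Ico a w, f z < f w := by
    intro w hw hfw
    obtain ⟨f', hf', hder⟩ := hd w ⟨hw.1, hw.2.trans hu.2⟩ hfw
    have h1 : ∀ᶠ z in 𝓝[<] w, 0 < slope f w z :=
      ((hasDerivAt_iff_tendsto_slope_left_right.1 hder).1).eventually (lt_mem_nhds hf')
    have h2 : ∀ᶠ z in 𝓝[<] w, z ∈ Ioo a w := Ioo_mem_nhdsLT hw.1
    obtain ⟨z, hz1, hz2⟩ := (h1.and h2).exists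
    refine ⟨z, ⟨hz2.1.le, hz2.2⟩, ?_⟩
    rw [slope_def_field, div_pos_iff] at hz1
    rcases hz1 with h | h <;> linarith [h.1, h.2, hz2.2]
  obtain ⟨z, hz, hzu⟩ := hleft u ⟨hu.1, le_rfl⟩ hneg
  have hm0 : f m < 0 := (isMinOn_iff.1 hmin z ⟨hz.1, hz.2.le⟩).trans_lt (hzu.trans_le hneg)
  have hma : a < m := lt_of_le_of_ne hm.1 (fun h => by rw [← h] at hm0; linarith)
  obtain ⟨z', hz', hz'm⟩ := hleft m ⟨hma, hm.2⟩ hm0.le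
  exact absurd (isMinOn_iff.1 hmin z' ⟨hz'.1, hz'.2.le.trans hm.2⟩) (not_le.2 hz'm)

lemma pos_of_deriv_neg_of_nonpos {f : ℝ → ℝ} {a b : ℝ} (hc : ContinuousOn f (Icc a b))
    (hb : 0 ≤ f b) (hd : ∀ u ∈ Ico a b, f u ≤ 0 → ∃ f' < 0, HasDerivAt f f' u) :
    ∀ u ∈ Ico a b, 0 < f u := by
  intro u hu
  have := pos_of_deriv_pos_of_nonpos (f := fun u => f (-u)) (a := -b) (b := -a)
    (hc.comp (by fun_prop) (fun w hw => ⟨by linarith [hw.2], by linarith [hw.1]⟩)) (by simpa)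
    (by
      intro w hw hfw
      obtain ⟨f', hf', hder⟩ := hd (-w) ⟨by linarith [hw.2], by linarith [hw.1]⟩ hfw
      refine ⟨-f', by linarith, ?_⟩
      simpa using! hder.scomp w (hasDerivAt_neg w)) (-u) ⟨by linarith [hu.2], by linarith [hu.1]⟩
  simpa using this

/-- One-sided Grönwall inequality, needed only where the function is positive. -/
lemma nonpos_of_deriv_le_mul {h : ℝ → ℝ} {a b C : ℝ} (hc : ContinuousOn h (Icc a b))
    (ha : h a ≤ 0)
    (hd : ∀ s ∈ Ioo a b, 0 < h s → ∃ h', HasDerivAt h h' s ∧ h' ≤ C * h s) :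
    ∀ s ∈ Icc a b, h s ≤ 0 := by
  intro s hs
  by_contra! hpos
  -- Beyond the last point `c` of this set `h` is positive, so the differential inequality is
  -- available there and `h · exp(-C z)` decreases from a nonpositive value.
  set Z := Icc a s ∩ h ⁻¹' Iic 0 with hZ
  have hcs : ContinuousOn h (Icc a s) := hc.mono (Icc_subset_Icc_right hs.2)
  have hZc : IsCompact Z :=
    isCompact_Icc.of_isClosed_subset (hcs.preimage_isClosed_of_isClosed isClosed_Icc isClosed_Iic)
      inter_subset_left
  obtain ⟨c, hc1, hc2⟩ := hZc.exists_isGreatest ⟨a, ⟨le_rfl, hs.1⟩, ha⟩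
  have hcs' : c < s := lt_of_le_of_ne hc1.1.2 (fun h' => by
    have := hc1.2; rw [h'] at this; exact absurd this (not_le.2 hpos))
  have hpos' : ∀ z ∈ Ioc c s, 0 < h z := by
    intro z hz
    by_contra! hz0
    exact absurd (hc2 ⟨⟨hc1.1.1.trans hz.1.le, hz.2⟩, hz0⟩) (not_le.2 hz.1)
  have hanti : AntitoneOn (fun z => h z * Real.exp (-C * z)) (Icc c s) := by
    have hder : ∀ z ∈ Ioo c s, ∃ h', HasDerivAt h h' z ∧ h' ≤ C * h z := fun z hz =>
      hd z ⟨hc1.1.1.trans_lt hz.1, hz.2.trans_le hs.2⟩ (hpos' z ⟨hz.1, hz.2.le⟩)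
    have hexp : ∀ z, HasDerivAt (fun z => Real.exp (-C * z)) (Real.exp (-C * z) * (-C)) z :=
      fun z => by simpa using ((hasDerivAt_id z).const_mul (-C)).exp
    refine antitoneOn_of_deriv_nonpos (convex_Icc _ _)
      ((hcs.mono (Icc_subset_Icc_left hc1.1.1)).mul (by fun_prop)) ?_ ?_
    · rw [interior_Icc]
      intro z hz
      obtain ⟨h', hh, -⟩ := hder z hz
      exact (hh.mul (hexp z)).differentiableAt.differentiableWithinAt
    · rw [interior_Icc]
      intro z hz
      obtain ⟨h', hh, hle⟩ := hder z hz
      rw [show deriv (fun z => h z * Real.exp (-C * z)) z = _ from (hh.mul (hexp z)).deriv]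
      have : h' * Real.exp (-C * z) + h z * (Real.exp (-C * z) * -C)
          = (h' - C * h z) * Real.exp (-C * z) := by ring
      rw [this]
      exact mul_nonpos_of_nonpos_of_nonneg (by linarith) (Real.exp_pos _).le
  have h1 := hanti (left_mem_Icc.2 hcs'.le) (right_mem_Icc.2 hcs'.le) hcs'.le
  have h2 : h c * Real.exp (-C * c) ≤ 0 :=
    mul_nonpos_of_nonpos_of_nonneg hc1.2 (Real.exp_pos _).le
  have h3 : 0 < h s * Real.exp (-C * s) := by positivity
  simp only at h1
  linarith

/-- Local uniqueness at an end of the interval. -/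
lemma eqOn_zero_of_abs_deriv_le {h h' : ℝ → ℝ} {a b C : ℝ}
    (hd : ∀ s ∈ Icc a b, HasDerivAt h (h' s) s ∧ |h' s| ≤ C * |h s|) {c : ℝ} (hcm : c ∈ Icc a b)
    (hz : h c = 0) : ∀ s ∈ Icc a b, h s = 0 := by
  intro s hs
  rcases le_total c s with hcs | hsc
  · exact eq_zero_of_abs_deriv_le_mul_abs_self_of_eq_zero_right (f := h) (f' := h') (K := C)
      (a := c) (b := b)
      (fun z hz => (hd z ⟨hcm.1.trans hz.1, hz.2⟩).1.continuousAt.continuousWithinAt)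
      (fun z hz => (hd z ⟨hcm.1.trans hz.1, hz.2.le⟩).1.hasDerivWithinAt) hz
      (fun z hz => (hd z ⟨hcm.1.trans hz.1, hz.2.le⟩).2) s ⟨hcs, hs.2⟩
  · have key : ∀ z ∈ Icc (-c) (-a), HasDerivAt (fun z => h (-z)) (-h' (-z)) z ∧
        |-h' (-z)| ≤ C * |h (-z)| := by
      intro z hz
      obtain ⟨h1, h2⟩ := hd (-z) ⟨by linarith [hz.2], by linarith [hz.1, hcm.2]⟩
      refine ⟨?_, by rwa [abs_neg]⟩
      simpa using! h1.scomp z (hasDerivAt_neg z)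
    have := eq_zero_of_abs_deriv_le_mul_abs_self_of_eq_zero_right (f := fun z => h (-z))
      (f' := fun z => -h' (-z)) (K := C) (a := -c) (b := -a)
      (fun z hz => (key z hz).1.continuousAt.continuousWithinAt)
      (fun z hz => (key z (Ico_subset_Icc_self hz)).1.hasDerivWithinAt) (by simpa)
      (fun z hz => (key z (Ico_subset_Icc_self hz)).2) (-s)
      ⟨by linarith, by linarith [hs.1]⟩
    simpa using this

/-- An autonomous scalar equation `U' = φ(U)` with `φ > 0` has a solution sweeping the interval. -/
lemma exists_reparametrization_of_pos {α β : ℝ} (hαβ : α < β) {φ : ℝ → ℝ}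
    (hφ : ContinuousOn φ (Ioo α β)) (hpos : ∀ u ∈ Ioo α β, 0 < φ u) :
    ∃ (I : Set ℝ) (U : ℝ → ℝ), IsOpen I ∧ I.OrdConnected ∧ (∀ s ∈ I, U s ∈ Ioo α β) ∧
      (∀ s ∈ I, HasDerivAt U (φ (U s)) s) ∧ U '' I = Ioo α β ∧ StrictMonoOn U I := by
  set m := (α + β) / 2
  have hm : m ∈ Ioo α β := ⟨by simp only [m]; linarith, by simp only [m]; linarith⟩
  have hinv : ContinuousOn (fun u => (φ u)⁻¹) (Ioo α β) := hφ.inv₀ fun u hu => (hpos u hu).ne'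
  -- Separation of variables: `Φ` is time as a function of position, and the solution is its
  -- inverse.
  set Φ : ℝ → ℝ := fun u => ∫ z in m..u, (φ z)⁻¹ with hΦ
  have hder : ∀ u ∈ Ioo α β, HasDerivAt Φ (φ u)⁻¹ u := by
    intro u hu
    have hsub : uIcc m u ⊆ Ioo α β := (convex_Ioo α β).ordConnected.uIcc_subset hm hu
    exact intervalIntegral.integral_hasDerivAt_right (hinv.mono hsub).intervalIntegrable
      (hinv.stronglyMeasurableAtFilter isOpen_Ioo u hu) (hinv.continuousAt (isOpen_Ioo.mem_nhds hu))
  have hcont : ContinuousOn Φ (Ioo α β) := fun u hu => (hder u hu).continuousAt.continuousWithinAt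
  have hmono : StrictMonoOn Φ (Ioo α β) := by
    refine strictMonoOn_of_deriv_pos (convex_Ioo _ _) hcont fun u hu => ?_
    rw [interior_Ioo] at hu
    rw [(hder u hu).deriv]
    exact inv_pos.2 (hpos u hu)
  set I := Φ '' Ioo α β with hI
  have hIconn : I.OrdConnected := (isPreconnected_Ioo.image Φ hcont).ordConnected
  have hIopen : IsOpen I := by
    rw [isOpen_iff_mem_nhds]
    rintro _ ⟨u, hu, rfl⟩
    obtain ⟨u₁, h1⟩ := exists_between hu.1
    obtain ⟨u₂, h2⟩ := exists_between hu.2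
    have m1 : u₁ ∈ Ioo α β := ⟨h1.1, h1.2.trans hu.2⟩
    have m2 : u₂ ∈ Ioo α β := ⟨hu.1.trans h2.1, h2.2⟩
    exact mem_of_superset (Icc_mem_nhds (hmono m1 hu h1.2) (hmono hu m2 h2.1))
      (hIconn.out ⟨u₁, m1, rfl⟩ ⟨u₂, m2, rfl⟩)
  set U : ℝ → ℝ := Function.invFunOn Φ (Ioo α β)
  have hU1 : ∀ s ∈ I, U s ∈ Ioo α β := fun s hs => Function.invFunOn_mem hs
  have hU2 : ∀ s ∈ I, Φ (U s) = s := fun s hs => Function.invFunOn_eq hs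
  have hU3 : ∀ u ∈ Ioo α β, U (Φ u) = u := fun u hu =>
    hmono.injOn (hU1 _ ⟨u, hu, rfl⟩) hu (hU2 _ ⟨u, hu, rfl⟩)
  have himg : U '' I = Ioo α β := by
    ext u
    constructor
    · rintro ⟨s, hs, rfl⟩; exact hU1 s hs
    · intro hu; exact ⟨Φ u, ⟨u, hu, rfl⟩, hU3 u hu⟩
  have hUmono : StrictMonoOn U I := by
    intro s hs s' hs' hss
    by_contra! hle
    have := hmono.monotoneOn (hU1 _ hs') (hU1 _ hs) hle
    rw [hU2 _ hs, hU2 _ hs'] at this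
    linarith
  refine ⟨I, U, hIopen, hIconn, hU1, ?_, himg, hUmono⟩
  intro s hs
  have hcU : ContinuousAt U s := hUmono.continuousAt_of_image_mem_nhds (hIopen.mem_nhds hs)
    (by rw [himg]; exact isOpen_Ioo.mem_nhds (hU1 s hs))
  have := HasDerivAt.of_local_left_inverse hcU (hder _ (hU1 s hs))
    (inv_pos.2 (hpos _ (hU1 s hs))).ne' (by
      filter_upwards [hIopen.mem_nhds hs] with z hz using hU2 z hz)
  simpa using this

lemma exists_reparametrization_of_neg {α β : ℝ} (hαβ : α < β) {φ : ℝ → ℝ}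
    (hφ : ContinuousOn φ (Ioo α β)) (hneg : ∀ u ∈ Ioo α β, φ u < 0) :
    ∃ (I : Set ℝ) (U : ℝ → ℝ), IsOpen I ∧ I.OrdConnected ∧ (∀ s ∈ I, U s ∈ Ioo α β) ∧
      (∀ s ∈ I, HasDerivAt U (φ (U s)) s) ∧ U '' I = Ioo α β ∧ StrictAntiOn U I := by
  have hm : ∀ u ∈ Ioo (-β) (-α), -u ∈ Ioo α β := fun u hu =>
    ⟨by linarith [hu.2], by linarith [hu.1]⟩
  obtain ⟨I, V, h1, h2, h3, h4, h5, h6⟩ := exists_reparametrization_of_pos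
    (α := -β) (β := -α) (by linarith) (φ := fun u => -φ (-u))
    ((hφ.comp (by fun_prop) hm).neg) (fun u hu => by linarith [hneg _ (hm u hu)])
  refine ⟨I, fun s => -V s, h1, h2, fun s hs => hm _ (h3 s hs), fun s hs => ?_, ?_, ?_⟩
  · simpa using! (h4 s hs).neg
  · have : (fun s => -V s) '' I = Neg.neg '' (V '' I) := by rw [image_image]
    rw [this, h5]
    simp
  · intro s hs s' hs' h
    exact neg_lt_neg (h6 hs hs' h)

/-! ### Explicit formulas -/

/-- The polynomial `ρ = r² (|v|² - 1) = -r² Δ`, for `A₀ = -a`. -/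
def rho (a ε : ℝ) (x : Plane) : ℝ :=
  a ^ 2 - 2 * a * ε * x 1 - (1 - ε ^ 2) * (x 0 ^ 2 + x 1 ^ 2)

lemma normSq_eq (x : Plane) : ‖x‖ ^ 2 = x 0 ^ 2 + x 1 ^ 2 := by
  simp [EuclideanSpace.norm_sq_eq, Fin.sum_univ_two]

lemma inner_eq (x y : Plane) : inner ℝ x y = x 0 * y 0 + x 1 * y 1 := by
  simp [PiLp.inner_apply, Fin.sum_univ_two, mul_comm]

lemma plane_ext {x y : Plane} (h0 : x 0 = y 0) (h1 : x 1 = y 1) : x = y := by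
  ext i; fin_cases i <;> assumption

lemma normSq_pos {x : Plane} (hx : x ≠ 0) : 0 < x 0 ^ 2 + x 1 ^ 2 := by
  rw [← normSq_eq]; exact pow_pos (norm_pos_iff.2 hx) 2

lemma hasGradientAt_of_hasFDerivAt {f : Plane → ℝ} {L : Plane →L[ℝ] ℝ} {x g : Plane}
    (h : HasFDerivAt f L x) (hL : ∀ y, g 0 * y 0 + g 1 * y 1 = L y) : HasGradientAt f g x := by
  rw [hasGradientAt_iff_hasFDerivAt]
  refine h.congr_fderiv ?_
  ext y
  rw [InnerProductSpace.toDual_apply_apply, inner_eq, hL]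

lemma hasFDerivAt_inner_of_hasGradientAt {f : Plane → ℝ} {x g : Plane} (h : HasGradientAt f g x) :
    HasFDerivAt f (innerSL ℝ g) x := (hasGradientAt_iff_hasFDerivAt.1 h).congr_fderiv (by ext; simp)

lemma hasGradientAt_potential (a ε : ℝ) {x : Plane} (hx : x ≠ 0) :
    HasGradientAt (potential (-a) ε)
      !₂[-a * x 0 / (x 0 ^ 2 + x 1 ^ 2), -a * x 1 / (x 0 ^ 2 + x 1 ^ 2) + ε] x := by
  have hn := normSq_pos hx
  have h1 : HasFDerivAt (fun y : Plane => ‖y‖ ^ 2) (2 • innerSL ℝ x) x :=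
    (hasStrictFDerivAt_norm_sq x).hasFDerivAt
  have h2 := h1.log (by rw [normSq_eq]; exact hn.ne')
  have h3 := (h2.const_mul (-a / 2)).add
    (((EuclideanSpace.proj (𝕜 := ℝ) 1 : Plane →L[ℝ] ℝ).hasFDerivAt (x := x)).const_mul ε)
  have e : potential (-a) ε = (fun y => -a / 2 * Real.log (‖y‖ ^ 2)) +
      fun y => ε * (EuclideanSpace.proj 1 : Plane →L[ℝ] ℝ) y := by
    funext y
    simp [potential, Real.log_pow]
    ring
  rw [e]
  refine hasGradientAt_of_hasFDerivAt h3 fun y => ?_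
  simp [inner_eq, normSq_eq]
  field_simp
  ring

lemma velocity_eq (a ε : ℝ) {x : Plane} (hx : x ≠ 0) :
    velocity (-a) ε x =
      !₂[-a * x 0 / (x 0 ^ 2 + x 1 ^ 2), -a * x 1 / (x 0 ^ 2 + x 1 ^ 2) + ε] :=
  (hasGradientAt_potential a ε hx).gradient

lemma delta_eq_velocity (A ε : ℝ) (x : Plane) :
    delta A ε x = 1 - ((velocity A ε x 0) ^ 2 + (velocity A ε x 1) ^ 2) := by
  simp [delta, gInv]; ring

lemma spatialForm_eq (A ε : ℝ) (x η : Plane) :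
    spatialForm A ε x η =
      (velocity A ε x 0 * η 0 + velocity A ε x 1 * η 1) ^ 2 - (η 0 ^ 2 + η 1 ^ 2) := by
  simp [spatialForm, gInv, Fin.sum_univ_two]; ring

lemma delta_eq (a ε : ℝ) {x : Plane} (hx : x ≠ 0) :
    delta (-a) ε x = -(rho a ε x / (x 0 ^ 2 + x 1 ^ 2)) := by
  have hn := normSq_pos hx
  rw [delta_eq_velocity, velocity_eq a ε hx]
  simp [rho]
  field_simp
  ring

lemma velocity_normSq (a ε : ℝ) {x : Plane} (hx : x ≠ 0) :
    (velocity (-a) ε x 0) ^ 2 + (velocity (-a) ε x 1) ^ 2 =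
      1 + rho a ε x / (x 0 ^ 2 + x 1 ^ 2) := by
  have h1 := delta_eq_velocity (-a) ε x
  rw [delta_eq a ε hx] at h1
  linarith

lemma rho_zero (a ε : ℝ) : rho a ε 0 = a ^ 2 := by simp [rho]

lemma ergoregion_eq {a : ℝ} (ha : 0 < a) (ε : ℝ) : ergoregion (-a) ε = {x | 0 < rho a ε x} := by
  ext x
  simp only [ergoregion, mem_insert_iff, mem_ofPred_eq]
  by_cases hx : x = 0
  · simp [hx, rho_zero, ha]
  · have hn := normSq_pos hx
    simp only [hx, false_or, ne_eq, not_false_eq_true, true_and]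
    rw [delta_eq a ε hx, neg_lt_zero]
    exact div_pos_iff_of_pos_right hn

/-- Completing the square shows that the ergoregion is a disc, so its frontier is the full zero set
of `ρ`. -/
lemma rho_eq_ball (a : ℝ) {ε : ℝ} (hε0 : 0 < ε) (hε1 : ε < 1) (x : Plane) :
    rho a ε x = (1 - ε ^ 2) * ((a / (1 - ε ^ 2)) ^ 2 -
      dist x !₂[0, -(ε * a / (1 - ε ^ 2))] ^ 2) := by
  have h : 0 < 1 - ε ^ 2 := by nlinarith
  rw [EuclideanSpace.dist_eq, Real.sq_sqrt (by positivity)]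
  simp [Fin.sum_univ_two, Real.dist_eq, rho]
  field_simp
  ring

lemma setOf_rho_pos {a ε : ℝ} (ha : 0 < a) (hε0 : 0 < ε) (hε1 : ε < 1) :
    {x | 0 < rho a ε x} =
      Metric.ball (!₂[0, -(ε * a / (1 - ε ^ 2))] : Plane) (a / (1 - ε ^ 2)) := by
  have h : 0 < 1 - ε ^ 2 := by nlinarith
  ext x
  rw [mem_ofPred_eq, rho_eq_ball a hε0 hε1, Metric.mem_ball, mul_pos_iff_of_pos_left h, sub_pos]
  exact pow_lt_pow_iff_left₀ dist_nonneg (by positivity) two_ne_zero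

lemma ergosphere_eq {a ε : ℝ} (ha : 0 < a) (hε0 : 0 < ε) (hε1 : ε < 1) :
    ergosphere (-a) ε = {x | rho a ε x = 0} := by
  have h : 0 < 1 - ε ^ 2 := by nlinarith
  rw [ergosphere, ergoregion_eq ha, setOf_rho_pos ha hε0 hε1, frontier_ball _ (by positivity)]
  ext x
  rw [mem_ofPred_eq, rho_eq_ball a hε0 hε1, Metric.mem_sphere, mul_eq_zero_iff_left h.ne', sub_eq_zero]
  rw [eq_comm, pow_left_inj₀ (by positivity) dist_nonneg two_ne_zero]

lemma ne_zero_of_rho_eq_zero {a ε : ℝ} (ha : 0 < a) {x : Plane} (h : rho a ε x = 0) : x ≠ 0 := by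
  rintro rfl
  rw [rho_zero] at h
  exact ha.ne' (by simpa using h)

lemma hasGradientAt_rho (a ε : ℝ) (x : Plane) :
    HasGradientAt (rho a ε)
      !₂[-2 * (1 - ε ^ 2) * x 0, -2 * (a * ε + (1 - ε ^ 2) * x 1)] x := by
  have h0 := (EuclideanSpace.proj (𝕜 := ℝ) 0 : Plane →L[ℝ] ℝ).hasFDerivAt (x := x)
  have h1 := (EuclideanSpace.proj (𝕜 := ℝ) 1 : Plane →L[ℝ] ℝ).hasFDerivAt (x := x)
  have h2 := ((h1.const_mul (2 * a * ε)).const_sub (a ^ 2)).sub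
    (((h0.pow 2).add (h1.pow 2)).const_mul (1 - ε ^ 2))
  refine hasGradientAt_of_hasFDerivAt h2 fun y => ?_
  simp
  ring

/-- Since `Δ = -ρ / r²`, the term differentiating `1 / r²` drops out where `ρ = 0`. -/
lemma gradient_delta {a ε : ℝ} {x : Plane} (hx : x ≠ 0) (hρ : rho a ε x = 0) :
    gradient (delta (-a) ε) x = (2 / (x 0 ^ 2 + x 1 ^ 2)) •
      (!₂[(1 - ε ^ 2) * x 0, a * ε + (1 - ε ^ 2) * x 1] : Plane) := by
  have hn := normSq_pos hx
  have h1 : HasFDerivAt (fun y : Plane => ‖y‖ ^ 2) (2 • innerSL ℝ x) x :=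
    (hasStrictFDerivAt_norm_sq x).hasFDerivAt
  have h2 := (hasDerivAt_inv (x := ‖x‖ ^ 2) (by rw [normSq_eq]; exact hn.ne')).comp_hasFDerivAt x h1
  have h3 := ((hasFDerivAt_inner_of_hasGradientAt (hasGradientAt_rho a ε x)).mul h2).neg
  refine HasGradientAt.gradient ?_
  have hev : delta (-a) ε =ᶠ[𝓝 x] (-(rho a ε * ((fun y => y⁻¹) ∘ fun y : Plane => ‖y‖ ^ 2))) := by
    filter_upwards [isOpen_ne.mem_nhds hx] with y hy
    rw [delta_eq a ε hy]
    simp [normSq_eq, div_eq_mul_inv]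
  refine hasGradientAt_of_hasFDerivAt (h3.congr_of_eventuallyEq hev) fun y => ?_
  simp [inner_eq, normSq_eq, hρ]
  field_simp
  ring

lemma gradient_delta_ne_zero {a ε : ℝ} (ha : 0 < a) (hε0 : 0 < ε) (hε1 : ε < 1) {x : Plane}
    (hρ : rho a ε x = 0) : gradient (delta (-a) ε) x ≠ 0 := by
  have hx := ne_zero_of_rho_eq_zero ha hρ
  have hn := normSq_pos hx
  have h : 0 < 1 - ε ^ 2 := by nlinarith
  rw [gradient_delta hx hρ]
  refine smul_ne_zero (by positivity) fun h0 => ?_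
  have e0 : (1 - ε ^ 2) * x 0 = 0 := by simpa using congrArg (fun z : Plane => z 0) h0
  have e1 : a * ε + (1 - ε ^ 2) * x 1 = 0 := by simpa using congrArg (fun z : Plane => z 1) h0
  have e2 : x 0 = 0 := (mul_eq_zero_iff_left h.ne').1 e0
  rw [rho, e2] at hρ
  have e3 : (1 - ε ^ 2) * a ^ 2 + (a * ε) ^ 2 = 0 := by
    have : (1 - ε ^ 2) * x 1 = - (a * ε) := by linarith
    have h4 : (1 - ε ^ 2) * (a ^ 2 - 2 * a * ε * x 1 - (1 - ε ^ 2) * (0 ^ 2 + x 1 ^ 2)) =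
      (1 - ε ^ 2) * a ^ 2 - 2 * a * ε * ((1 - ε ^ 2) * x 1) - ((1 - ε ^ 2) * x 1) ^ 2 := by ring
    rw [hρ, this] at h4
    linarith
  have : 0 < (1 - ε ^ 2) * a ^ 2 + (a * ε) ^ 2 := by positivity
  linarith

lemma polar_pi_div_two (r : ℝ) : polar r (Real.pi / 2) = !₂[0, r] := by simp [polar]

lemma polar_neg_pi_div_two (r : ℝ) : polar r (-(Real.pi / 2)) = !₂[0, -r] := by simp [polar]

lemma rho_of_fst_eq_zero (a ε : ℝ) {x : Plane} (h0 : x 0 = 0) :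
    rho a ε x = (a - (1 + ε) * x 1) * (a + (1 - ε) * x 1) := by
  rw [rho, h0]; ring

lemma tangentialPoints_eq {a ε : ℝ} (ha : 0 < a) (hε0 : 0 < ε) (hε1 : ε < 1) :
    tangentialPoints (-a) ε =
      {polar (a / (1 + ε)) (Real.pi / 2), polar (a / (1 - ε)) (-(Real.pi / 2))} := by
  have h : 0 < 1 - ε ^ 2 := by nlinarith
  have hm : 0 < 1 - ε := by linarith
  rw [polar_pi_div_two, polar_neg_pi_div_two]
  have key : ∀ x : Plane, rho a ε x = 0 →
      (spatialForm (-a) ε x (gradient (delta (-a) ε) x) = 0 ↔ x 0 = 0) := by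
    intro x hρ
    have hx := ne_zero_of_rho_eq_zero ha hρ
    have hn := normSq_pos hx
    set n := x 0 ^ 2 + x 1 ^ 2 with hndef
    have hv := velocity_normSq a ε hx
    rw [hρ, zero_div, add_zero] at hv
    have : spatialForm (-a) ε x (gradient (delta (-a) ε) x) =
        -((2 / n) * (ε * x 0 * (a ^ 2 / n + (1 - ε ^ 2)))) ^ 2 := by
      rw [spatialForm_eq, gradient_delta hx hρ]
      -- For a unit vector `v` the form is minus the square of the cross product of `v` with the
      -- covector, so being characteristic means being parallel to `v`.
      have hid : ∀ p q e f : ℝ, p ^ 2 + q ^ 2 = 1 →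
          (p * e + q * f) ^ 2 - (e ^ 2 + f ^ 2) = -(q * e - p * f) ^ 2 := by
        intro p q e f hpq
        linear_combination (e ^ 2 + f ^ 2) * hpq
      rw [hid _ _ _ _ hv, velocity_eq a ε hx]
      simp only [PiLp.smul_apply, smul_eq_mul, Matrix.cons_val_zero,
        Matrix.cons_val_one]
      rw [← hndef]
      field_simp
      ring
    rw [this, neg_eq_zero, sq_eq_zero_iff]
    constructor
    · intro h0
      have h1 : 0 < a ^ 2 / n + (1 - ε ^ 2) := by positivity
      have h2 : (2 / n) ≠ 0 := by positivity
      simpa [h2, h1.ne', hε0.ne'] using h0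
    · intro h0; simp [h0]
  ext x
  simp only [tangentialPoints, ergosphere_eq ha hε0 hε1, mem_ofPred_eq, mem_insert_iff,
    mem_singleton_iff]
  constructor
  · rintro ⟨hρ, -, hs⟩
    have h0 := (key x hρ).1 hs
    rw [rho_of_fst_eq_zero a ε h0, mul_eq_zero] at hρ
    rcases hρ with hρ | hρ
    · left
      refine plane_ext (by simpa using h0) ?_
      simp; field_simp; linarith
    · right
      refine plane_ext (by simpa using h0) ?_
      simp; field_simp; linarith
  · intro hx
    have h0 : x 0 = 0 := by rcases hx with rfl | rfl <;> simp
    have hρ : rho a ε x = 0 := by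
      rw [rho_of_fst_eq_zero a ε h0]
      rcases hx with rfl | rfl <;> simp <;> field_simp <;> simp
    exact ⟨hρ, gradient_delta_ne_zero ha hε0 hε1 hρ, (key x hρ).2 h0⟩

/-! ### The two families of trajectories -/

/-- The covector is normalised so that `v · ξ = 1`; the denominator is then `1` and `g^{jk} ξ_k =
v_j (v · ξ) - ξ_j` becomes `v - ξ`. -/
lemma familyField_eq (A ε σ : ℝ) (x : Plane)
    (hv : (velocity A ε x 0) ^ 2 + (velocity A ε x 1) ^ 2 ≠ 0) :
    familyField A ε σ x = velocity A ε x - nullCovector A ε σ x := by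
  have h1 : velocity A ε x 0 * nullCovector A ε σ x 0 +
      velocity A ε x 1 * nullCovector A ε σ x 1 = 1 := by
    simp [nullCovector, rot, normSq_eq]
    field_simp
    ring
  refine plane_ext ?_ ?_ <;> simp [familyField, gInv, Fin.sum_univ_two, h1] <;>
    linear_combination (velocity A ε x _) * h1

lemma familyField_apply {a ε : ℝ} (σ : ℝ) {x : Plane} (hx : x ≠ 0) (hρ : 0 ≤ rho a ε x) :
    familyField (-a) ε σ x = ((x 0 ^ 2 + x 1 ^ 2) + rho a ε x)⁻¹ •
      (rho a ε x • velocity (-a) ε x + (σ * √(rho a ε x) * ‖x‖) • rot (velocity (-a) ε x)) := by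
  have hn := normSq_pos hx
  have hr : 0 < ‖x‖ := norm_pos_iff.2 hx
  have hv := velocity_normSq a ε hx
  have hq : √(‖velocity (-a) ε x‖ ^ 2 - 1) = √(rho a ε x) / ‖x‖ := by
    rw [normSq_eq, hv, add_sub_cancel_left, Real.sqrt_div hρ, ← normSq_eq, Real.sqrt_sq hr.le]
  have hpos : 0 < (x 0 ^ 2 + x 1 ^ 2) + rho a ε x := by positivity
  have hne : (velocity (-a) ε x 0) ^ 2 + (velocity (-a) ε x 1) ^ 2 ≠ 0 := by
    rw [hv]; positivity
  rw [familyField_eq _ _ _ _ hne, nullCovector]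
  simp only [hq]
  rw [normSq_eq, hv]
  have hr2 : ‖x‖ ^ 2 = x 0 ^ 2 + x 1 ^ 2 := normSq_eq x
  have e1 : (1 + rho a ε x / (x 0 ^ 2 + x 1 ^ 2))⁻¹ =
      ‖x‖ ^ 2 * ((x 0 ^ 2 + x 1 ^ 2) + rho a ε x)⁻¹ := by
    rw [hr2]; field_simp
  rw [e1]
  have e2 : velocity (-a) ε x = ((x 0 ^ 2 + x 1 ^ 2) + rho a ε x)⁻¹ •
      (((x 0 ^ 2 + x 1 ^ 2) + rho a ε x) • velocity (-a) ε x) := by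
    rw [smul_smul, inv_mul_cancel₀ hpos.ne', one_smul]
  conv_lhs => rw [e2]
  refine plane_ext ?_ ?_ <;> simp [rot, hr2] <;> field_simp
  · linear_combination (σ * √(rho a ε x) * velocity (-a) ε x 1) * hr2
  · linear_combination -(σ * √(rho a ε x) * velocity (-a) ε x 0) * hr2

lemma inner_velocity (a ε : ℝ) {x : Plane} (hx : x ≠ 0) :
    x 0 * velocity (-a) ε x 0 + x 1 * velocity (-a) ε x 1 = -(a - ε * x 1) := by
  have hn := normSq_pos hx
  rw [velocity_eq a ε hx]; simp; field_simp; ring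

lemma inner_rot_velocity (a ε : ℝ) {x : Plane} (hx : x ≠ 0) :
    x 0 * velocity (-a) ε x 1 - x 1 * velocity (-a) ε x 0 = ε * x 0 := by
  have hn := normSq_pos hx
  rw [velocity_eq a ε hx]; simp; field_simp; ring

/-- The radial component carries a factor `√ρ`, as does the angular one in `inner_rot_familyField`.
This factor makes the field vanish on the ergosphere and keeps the `(t, θ)` field regular. -/
lemma inner_familyField {a ε : ℝ} (σ : ℝ) {x : Plane} (hx : x ≠ 0) (hρ : 0 ≤ rho a ε x) :
    x 0 * familyField (-a) ε σ x 0 + x 1 * familyField (-a) ε σ x 1 =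
      √(rho a ε x) * (-√(rho a ε x) * (a - ε * x 1) - ε * ‖x‖ * (σ * x 0)) /
        ((x 0 ^ 2 + x 1 ^ 2) + rho a ε x) := by
  have hn := normSq_pos hx
  rw [familyField_apply σ hx hρ]
  have h1 := inner_velocity a ε hx
  have h2 := inner_rot_velocity a ε hx
  have h3 : √(rho a ε x) * √(rho a ε x) = rho a ε x := Real.mul_self_sqrt hρ
  simp [rot]
  field_simp
  linear_combination (rho a ε x) * h1 - (σ * √(rho a ε x) * ‖x‖) * h2 + (a - ε * x 1) * h3

lemma inner_rot_familyField {a ε : ℝ} (σ : ℝ) {x : Plane} (hx : x ≠ 0) (hρ : 0 ≤ rho a ε x) :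
    x 0 * familyField (-a) ε σ x 1 - x 1 * familyField (-a) ε σ x 0 =
      √(rho a ε x) * (√(rho a ε x) * (ε * x 0) - σ * ‖x‖ * (a - ε * x 1)) /
        ((x 0 ^ 2 + x 1 ^ 2) + rho a ε x) := by
  have hn := normSq_pos hx
  rw [familyField_apply σ hx hρ]
  have h1 := inner_velocity a ε hx
  have h2 := inner_rot_velocity a ε hx
  have h3 : √(rho a ε x) * √(rho a ε x) = rho a ε x := Real.mul_self_sqrt hρ
  simp [rot]
  field_simp
  linear_combination (rho a ε x) * h2 + (σ * √(rho a ε x) * ‖x‖) * h1 - (ε * x 0) * h3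

/-! ### The field in the coordinates `(t, θ)` -/

/-- The radius as a function of `(t, θ)`. -/
def radiusTT (a ε : ℝ) (q : Fin 2 → ℝ) : ℝ :=
  (-(a * ε * Real.sin (q 1)) +
    √((a * ε * Real.sin (q 1)) ^ 2 + (1 - ε ^ 2) * (a ^ 2 - q 0 ^ 2))) / (1 - ε ^ 2)

/-- The coefficient of `t` in `dt/dx₀`. -/
def coeffTT₁ (a ε : ℝ) (q : Fin 2 → ℝ) : ℝ :=
  (a ^ 2 * ε * Real.sin (q 1) + a * (1 - 2 * ε ^ 2) * radiusTT a ε q -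
    ε * (1 - ε ^ 2) * radiusTT a ε q ^ 2 * Real.sin (q 1)) /
      (radiusTT a ε q * (radiusTT a ε q ^ 2 + q 0 ^ 2))

/-- The coefficient of `cos θ` in `dt/dx₀`. -/
def coeffTT₂ (a ε σ : ℝ) (q : Fin 2 → ℝ) : ℝ :=
  σ * ε * ((1 - ε ^ 2) * radiusTT a ε q ^ 2 + a ^ 2) / (radiusTT a ε q ^ 2 + q 0 ^ 2)

/-- The coefficient of `t` in `dθ/dx₀`. -/
def coeffTT₃ (a ε σ : ℝ) (q : Fin 2 → ℝ) : ℝ :=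
  (q 0 * ε * Real.cos (q 1) - σ * (a - ε * radiusTT a ε q * Real.sin (q 1))) /
    (radiusTT a ε q * (radiusTT a ε q ^ 2 + q 0 ^ 2))

/-- The `C¹` extension of the `(σ)` field in the coordinates `(t, θ)`. -/
def fieldTT (a ε σ : ℝ) (q : Fin 2 → ℝ) : Fin 2 → ℝ :=
  ![q 0 * coeffTT₁ a ε q + Real.cos (q 1) * coeffTT₂ a ε σ q, q 0 * coeffTT₃ a ε σ q]

lemma rho_polar (a ε r θ : ℝ) : rho a ε (polar r θ) =
    a ^ 2 - 2 * a * ε * r * Real.sin θ - (1 - ε ^ 2) * r ^ 2 := by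
  have := Real.sin_sq_add_cos_sq θ
  simp only [rho, polar, Matrix.cons_val_zero, Matrix.cons_val_one, Matrix.cons_val_fin_one]
  linear_combination (-(1 - ε ^ 2) * r ^ 2) * this

lemma norm_polar {r : ℝ} (hr : 0 ≤ r) (θ : ℝ) : ‖polar r θ‖ = r := by
  rw [← sq_eq_sq₀ (norm_nonneg _) hr, normSq_eq]
  simp only [polar, Matrix.cons_val_zero, Matrix.cons_val_one, Matrix.cons_val_fin_one]
  linear_combination r ^ 2 * Real.sin_sq_add_cos_sq θ

lemma polar_ne_zero {r : ℝ} (hr : 0 < r) (θ : ℝ) : polar r θ ≠ 0 := by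
  rw [← norm_pos_iff, norm_polar hr.le]; exact hr

lemma tCoord_eq (a ε : ℝ) {x : Plane} (hx : x ≠ 0) : tCoord (-a) ε x = √(rho a ε x) := by
  have hn := normSq_pos hx
  rw [tCoord, delta_eq a ε hx, normSq_eq]
  congr 1
  field_simp

/-- At fixed `θ` the relation `ρ = t²` is a quadratic in `r` whose roots have a negative product
when `|t| < a`; `radiusTT` is the positive root. -/
lemma radiusTT_pos {a ε : ℝ} (hε0 : 0 < ε) (hε1 : ε < 1) {q : Fin 2 → ℝ}
    (hq : |q 0| < a) : 0 < radiusTT a ε q := by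
  have h : 0 < 1 - ε ^ 2 := by nlinarith
  refine div_pos ?_ h
  have h1 : a * ε * Real.sin (q 1) <
      √((a * ε * Real.sin (q 1)) ^ 2 + (1 - ε ^ 2) * (a ^ 2 - q 0 ^ 2)) := by
    refine Real.lt_sqrt_of_sq_lt ?_
    have : q 0 ^ 2 < a ^ 2 := by
      rw [← sq_abs]; exact pow_lt_pow_left₀ hq (abs_nonneg _) two_ne_zero
    nlinarith
  linarith

lemma rho_radiusTT {a ε : ℝ} (hε0 : 0 < ε) (hε1 : ε < 1) {q : Fin 2 → ℝ} (hq : |q 0| < a) :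
    rho a ε (polar (radiusTT a ε q) (q 1)) = q 0 ^ 2 := by
  have h : 0 < 1 - ε ^ 2 := by nlinarith
  have h1 : q 0 ^ 2 < a ^ 2 := by
    rw [← sq_abs]; exact pow_lt_pow_left₀ hq (abs_nonneg _) two_ne_zero
  have h2 : 0 ≤ (a * ε * Real.sin (q 1)) ^ 2 + (1 - ε ^ 2) * (a ^ 2 - q 0 ^ 2) :=
    add_nonneg (sq_nonneg _) (mul_nonneg h.le (by linarith))
  have h3 := Real.sq_sqrt h2
  rw [rho_polar, radiusTT]
  set S := √((a * ε * Real.sin (q 1)) ^ 2 + (1 - ε ^ 2) * (a ^ 2 - q 0 ^ 2))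
  field_simp
  linear_combination -h3

lemma tCoord_polar_iff {a ε : ℝ} (hε0 : 0 < ε) (hε1 : ε < 1) {q : Fin 2 → ℝ} (hq0 : 0 < q 0)
    (hq : q 0 < a) {r : ℝ} (hr : 0 < r) :
    tCoord (-a) ε (polar r (q 1)) = q 0 ↔ r = radiusTT a ε q := by
  have h : 0 < 1 - ε ^ 2 := by nlinarith
  have hq' : |q 0| < a := by rwa [abs_of_pos hq0]
  have hR := radiusTT_pos hε0 hε1 hq'
  have hρ := rho_radiusTT hε0 hε1 hq'
  rw [tCoord_eq a ε (polar_ne_zero hr _)]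
  constructor
  · intro he
    have h1 : rho a ε (polar r (q 1)) = q 0 ^ 2 := by
      rw [← he, Real.sq_sqrt (Real.sqrt_pos.1 (by rw [he]; exact hq0)).le]
    rw [← hρ, rho_polar, rho_polar] at h1
    rw [rho_polar] at hρ
    set R := radiusTT a ε q
    have h2 : (r - R) * (2 * a * ε * Real.sin (q 1) + (1 - ε ^ 2) * (r + R)) = 0 := by
      linear_combination -h1
    rcases mul_eq_zero.1 h2 with h3 | h3
    · linarith
    -- The vanishing of this factor would make `r` the second, negative root: multiplied by `R`, it
    -- equals `a² - t²` plus a positive term.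
    · have h4 : 0 < R * (2 * a * ε * Real.sin (q 1) + (1 - ε ^ 2) * (r + R)) := by
        have : R * (2 * a * ε * Real.sin (q 1) + (1 - ε ^ 2) * (r + R)) =
            (a - q 0) * (a + q 0) + (1 - ε ^ 2) * (R * r) := by linear_combination -hρ
        rw [this]
        have := mul_pos h (mul_pos hR hr)
        have := mul_pos (sub_pos.2 hq) (by linarith : 0 < a + q 0)
        linarith
      rw [h3, mul_zero] at h4
      exact absurd h4 (lt_irrefl _)
  · rintro rfl
    rw [hρ, Real.sqrt_sq hq0.le]

/-- Here `dt = dρ / (2t)`, and the factor `t` common to both polar components of the velocity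
cancels the `1/t`. The resulting expression also makes sense for `t ≤ 0`. -/
lemma fieldTT_eq {a ε σ : ℝ} (hε0 : 0 < ε) (hε1 : ε < 1) {q : Fin 2 → ℝ}
    (hq0 : 0 < q 0) (hq : q 0 < a) :
    fieldTT a ε σ q = tThetaVelocity (-a) ε σ (polar (radiusTT a ε q) (q 1)) := by
  have hq' : |q 0| < a := by rwa [abs_of_pos hq0]
  have hR := radiusTT_pos hε0 hε1 hq'
  have hρ := rho_radiusTT hε0 hε1 hq'
  set x := polar (radiusTT a ε q) (q 1) with hx
  have hx0 : x ≠ 0 := polar_ne_zero hR _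
  have hρpos : 0 < rho a ε x := by rw [hρ]; positivity
  have hst : √(rho a ε x) = q 0 := by rw [hρ, Real.sqrt_sq hq0.le]
  have hA := inner_familyField σ hx0 hρpos.le
  have hB := inner_rot_familyField σ hx0 hρpos.le
  have hn : x 0 ^ 2 + x 1 ^ 2 = radiusTT a ε q ^ 2 := by rw [← normSq_eq, norm_polar hR.le]
  have hsc := Real.sin_sq_add_cos_sq (q 1)
  have hf : fderiv ℝ (tCoord (-a) ε) x (familyField (-a) ε σ x) =
      (-(1 - ε ^ 2) * x 0 * familyField (-a) ε σ x 0 -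
        (a * ε + (1 - ε ^ 2) * x 1) * familyField (-a) ε σ x 1) / q 0 := by
    have h1 := (hasFDerivAt_inner_of_hasGradientAt (hasGradientAt_rho a ε x)).sqrt hρpos.ne'
    have h2 : HasFDerivAt (tCoord (-a) ε) _ x := h1.congr_of_eventuallyEq (by
      filter_upwards [isOpen_ne.mem_nhds hx0] with y hy using tCoord_eq a ε hy)
    rw [h2.fderiv]
    simp [inner_eq, hst]
    field_simp
    ring
  have c0 : x 0 = radiusTT a ε q * Real.cos (q 1) := by simp [hx, polar]
  have c1 : x 1 = radiusTT a ε q * Real.sin (q 1) := by simp [hx, polar]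
  rw [hn, hst, hρ, norm_polar hR.le, c0, c1] at hA hB
  rw [tThetaVelocity, fieldTT]
  simp only
  rw [hf, norm_polar hR.le, c0, c1, hB, coeffTT₁, coeffTT₂, coeffTT₃]
  set w := familyField (-a) ε σ x
  set R := radiusTT a ε q
  set t := q 0
  set S := Real.sin (q 1)
  set C := Real.cos (q 1)
  have hN : 0 < R ^ 2 + t ^ 2 := by positivity
  rw [eq_div_iff hN.ne'] at hA hB
  have e1 : R * ((R ^ 2 + t ^ 2) * w 1) = S * (t * (-t * (a - ε * (R * S)) - ε * R * (σ * (R * C)))) +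
      C * (t * (t * (ε * (R * C)) - σ * R * (a - ε * (R * S)))) := by
    rw [← hA, ← hB]
    linear_combination (-(R * (R ^ 2 + t ^ 2) * w 1)) * hsc
  congr 1
  · have e2 : -(1 - ε ^ 2) * (R * C) * w 0 - (a * ε + (1 - ε ^ 2) * (R * S)) * w 1 =
        -(1 - ε ^ 2) * (R * C * w 0 + R * S * w 1) - a * ε * w 1 := by ring
    rw [e2, eq_div_iff hq0.ne']
    have hA' : R * C * w 0 + R * S * w 1 =
      t * (-t * (a - ε * (R * S)) - ε * R * (σ * (R * C))) / (R ^ 2 + t ^ 2) := by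
      rw [eq_div_iff hN.ne', hA]
    have e1' : w 1 = (S * (t * (-t * (a - ε * (R * S)) - ε * R * (σ * (R * C)))) +
      C * (t * (t * (ε * (R * C)) - σ * R * (a - ε * (R * S))))) / (R * (R ^ 2 + t ^ 2)) := by
      rw [eq_div_iff (by positivity), ← e1]; ring
    rw [hA', e1']
    field_simp
    linear_combination (t * a * ε ^ 2 * R) * hsc
  · congr 1
    field_simp

/-! ### The linearization at the tangential points -/

/-- The matrix of the linearization at `(0, s π/2)`, `s = ±1`. -/
def linTT (a ε σ s : ℝ) : Matrix (Fin 2) (Fin 2) ℝ :=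
  !![(1 + s * ε) ^ 2 / a, -(2 * σ * s * ε * (1 + s * ε));
     -(σ * (1 + s * ε) ^ 2 / a ^ 2), 0]

/-- At a tangential point both `t` and `cos θ` vanish and every term of `fieldTT` contains one of
them. Only the values of the three coefficients there enter the derivative, never their derivatives.
-/
lemma hasLinearization {a ε σ s θ₀ : ℝ} (ha : 0 < a) (hε0 : 0 < ε) (hε1 : ε < 1)
    (hs : s = 1 ∨ s = -1) (hsin : Real.sin θ₀ = s) (hcos : Real.cos θ₀ = 0) :
    HasLinearization (-a) ε σ θ₀ (linTT a ε σ s) := by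
  have h : 0 < 1 - ε ^ 2 := by nlinarith
  have hs2 : s ^ 2 = 1 := by rcases hs with rfl | rfl <;> norm_num
  have hk : 0 < 1 + s * ε := by rcases hs with rfl | rfl <;> linarith
  have hk2 : 0 < 1 - s * ε := by rcases hs with rfl | rfl <;> linarith
  have hk3 : 1 - ε ^ 2 = (1 + s * ε) * (1 - s * ε) := by linear_combination ε ^ 2 * hs2
  set q₀ : Fin 2 → ℝ := ![0, θ₀] with hq₀
  have q00 : q₀ 0 = 0 := rfl
  have q01 : q₀ 1 = θ₀ := rfl
  have hrad : (a * ε * Real.sin (q₀ 1)) ^ 2 + (1 - ε ^ 2) * (a ^ 2 - q₀ 0 ^ 2) = a ^ 2 := by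
    rw [q00, q01, hsin]; linear_combination (a ^ 2 * ε ^ 2) * hs2
  have hr : radiusTT a ε q₀ = a / (1 + s * ε) := by
    rw [radiusTT, hrad, Real.sqrt_sq ha.le, q01, hsin, hk3,
      div_eq_div_iff (mul_pos hk hk2).ne' hk.ne']
    ring
  have hrc : ContDiffAt ℝ 1 (radiusTT a ε) q₀ := by
    unfold radiusTT
    refine ContDiffAt.div_const (ContDiffAt.add (by fun_prop) (ContDiffAt.sqrt (by fun_prop) ?_)) _
    rw [hrad]; positivity
  have hN : radiusTT a ε q₀ ^ 2 + q₀ 0 ^ 2 ≠ 0 := by rw [hr, q00]; positivity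
  have hR : radiusTT a ε q₀ ≠ 0 := by rw [hr]; positivity
  have c1 : ContDiffAt ℝ 1 (coeffTT₁ a ε) q₀ := by
    unfold coeffTT₁
    exact ContDiffAt.div (by fun_prop) (by fun_prop) (mul_ne_zero hR hN)
  have c2 : ContDiffAt ℝ 1 (coeffTT₂ a ε σ) q₀ := by
    unfold coeffTT₂
    exact ContDiffAt.div (by fun_prop) (by fun_prop) hN
  have c3 : ContDiffAt ℝ 1 (coeffTT₃ a ε σ) q₀ := by
    unfold coeffTT₃
    exact ContDiffAt.div (by fun_prop) (by fun_prop) (mul_ne_zero hR hN)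
  have har : a = radiusTT a ε q₀ * (1 + s * ε) := by rw [hr, div_mul_cancel₀ _ hk.ne']
  have v1 : coeffTT₁ a ε q₀ = (1 + s * ε) ^ 2 / a := by
    rw [coeffTT₁, div_eq_div_iff (mul_ne_zero hR hN) ha.ne', q00, q01, hsin]
    set r := radiusTT a ε q₀
    rw [har]
    rcases hs with rfl | rfl <;> ring
  have v2 : coeffTT₂ a ε σ q₀ = 2 * σ * ε * (1 + s * ε) := by
    rw [coeffTT₂, div_eq_iff hN, q00]
    set r := radiusTT a ε q₀
    rw [har]
    rcases hs with rfl | rfl <;> ring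
  have v3 : coeffTT₃ a ε σ q₀ = -(σ * (1 + s * ε) ^ 2 / a ^ 2) := by
    rw [coeffTT₃, ← neg_div, div_eq_div_iff (mul_ne_zero hR hN) (by positivity), q00, q01, hsin,
      hcos]
    set r := radiusTT a ε q₀
    rw [har]
    ring
  have p0 : HasFDerivAt (fun q : Fin 2 → ℝ => q 0)
    (ContinuousLinearMap.proj (R := ℝ) (φ := fun _ : Fin 2 => ℝ) 0) q₀ := hasFDerivAt_apply 0 q₀
  have p1 : HasFDerivAt (fun q : Fin 2 → ℝ => q 1)
    (ContinuousLinearMap.proj (R := ℝ) (φ := fun _ : Fin 2 => ℝ) 1) q₀ := hasFDerivAt_apply 1 q₀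
  refine ⟨fieldTT a ε σ, ?_, ?_, ?_, ?_⟩
  · refine contDiffAt_pi.2 fun i => ?_
    fin_cases i
    · show ContDiffAt ℝ 1 (fun q => q 0 * coeffTT₁ a ε q + Real.cos (q 1) * coeffTT₂ a ε σ q) q₀
      fun_prop
    · show ContDiffAt ℝ 1 (fun q => q 0 * coeffTT₃ a ε σ q) q₀
      fun_prop
  · have hev : ∀ᶠ q : Fin 2 → ℝ in 𝓝 q₀, q 0 < a :=
      (continuous_apply 0).continuousAt.eventually (gt_mem_nhds ha)
    filter_upwards [hev] with q hq hq0
    exact ⟨radiusTT a ε q, radiusTT_pos hε0 hε1 (by rwa [abs_of_pos hq0]),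
      fun r' hr' => tCoord_polar_iff hε0 hε1 hq0 hq hr', fieldTT_eq hε0 hε1 hq0 hq⟩
  · funext i
    fin_cases i <;> simp [fieldTT, hcos]
  · refine hasFDerivAt_pi'.2 fun i => ?_
    have d1 := p0.mul (c1.differentiableAt one_ne_zero).hasFDerivAt
    have d2 := p1.cos.mul (c2.differentiableAt one_ne_zero).hasFDerivAt
    have d3 := p0.mul (c3.differentiableAt one_ne_zero).hasFDerivAt
    fin_cases i
    · refine (d1.add d2).congr_fderiv ?_
      ext y
      simp [q00, q01, hsin, hcos, v1, v2, linTT, dotProduct, Fin.sum_univ_two]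
      ring
    · refine d3.congr_fderiv ?_
      ext y
      simp [q00, v3, linTT, dotProduct, Fin.sum_univ_two]

/-- The hypothesis on `l` is the characteristic equation: trace `(1 + sε)² / a` and, by `σ² = 1`,
determinant `-2sε(1 + sε)³ / a²`. The sign of the determinant separates the saddle `s = 1` from the
other point. -/
lemma hasEigenvalue_linTT {a ε σ s l : ℝ} (ha : 0 < a) (hσ : σ ^ 2 = 1) (hk : 1 + s * ε ≠ 0)
    (hl : l ^ 2 = (1 + s * ε) ^ 2 / a * l + 2 * s * ε * (1 + s * ε) ^ 3 / a ^ 2) :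
    Module.End.HasEigenvalue (Matrix.toLin' (linTT a ε σ s)) l := by
  have hσ0 : σ ≠ 0 := by rintro rfl; norm_num at hσ
  refine Module.End.hasEigenvalue_of_hasEigenvector
    (x := ![l, -(σ * (1 + s * ε) ^ 2 / a ^ 2)]) ⟨?_, fun h0 => ?_⟩
  · rw [Module.End.mem_eigenspace_iff]
    funext i
    fin_cases i
    · simp [linTT, Matrix.mulVec, dotProduct, Fin.sum_univ_two]
      field_simp
      field_simp at hl
      linear_combination (2 * s * ε * (1 + s * ε) ^ 3) * hσ - hl
    · simp [linTT, Matrix.mulVec, dotProduct, Fin.sum_univ_two]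
      ring
  · have := congrFun h0 1
    simp [hσ0, ha.ne', hk] at this

lemma hasEigenvalue_linTT_complex {a ε σ s : ℝ} {l : ℂ} (ha : 0 < a) (hσ : σ ^ 2 = 1)
    (hk : 1 + s * ε ≠ 0)
    (hl : l ^ 2 = (1 + s * ε) ^ 2 / a * l + 2 * s * ε * (1 + s * ε) ^ 3 / a ^ 2) :
    Module.End.HasEigenvalue (Matrix.toLin' ((linTT a ε σ s).map ((↑) : ℝ → ℂ))) l := by
  have hσ0 : σ ≠ 0 := by rintro rfl; norm_num at hσ
  have hσ' : (σ : ℂ) ^ 2 = 1 := by exact_mod_cast hσ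
  have ha' : (a : ℂ) ≠ 0 := by exact_mod_cast ha.ne'
  have hk' : (1 : ℂ) + s * ε ≠ 0 := by exact_mod_cast hk
  refine Module.End.hasEigenvalue_of_hasEigenvector
    (x := ![l, -((σ : ℂ) * (1 + s * ε) ^ 2 / a ^ 2)]) ⟨?_, fun h0 => ?_⟩
  · rw [Module.End.mem_eigenspace_iff]
    funext i
    fin_cases i
    · simp [linTT, Matrix.mulVec, dotProduct, Fin.sum_univ_two]
      field_simp
      field_simp at hl
      linear_combination (2 * s * ε * (1 + s * ε) ^ 3 : ℂ) * hσ' - hl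
    · simp [linTT, Matrix.mulVec, dotProduct, Fin.sum_univ_two]
      ring
  · have := congrFun h0 1
    simp [hσ0, ha', hk'] at this

lemma isSaddleAt {a ε σ : ℝ} (ha : 0 < a) (hε0 : 0 < ε) (hε1 : ε < 1) (hσ : σ ^ 2 = 1) :
    IsSaddleAt (-a) ε σ (Real.pi / 2) := by
  refine ⟨_, hasLinearization ha hε0 hε1 (Or.inl rfl) (by simp) (by simp), ?_⟩
  set b := (1 + 1 * ε) ^ 2 / a with hb
  set c := 2 * 1 * ε * (1 + 1 * ε) ^ 3 / a ^ 2 with hc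
  have hb0 : 0 < b := by positivity
  have hc0 : 0 < c := by positivity
  have hd := Real.sq_sqrt (by positivity : 0 ≤ b ^ 2 + 4 * c)
  have hlt : b < √(b ^ 2 + 4 * c) := Real.lt_sqrt_of_sq_lt (by linarith)
  set d := √(b ^ 2 + 4 * c)
  refine ⟨(b - d) / 2, (b + d) / 2, by linarith, by linarith, ?_, ?_⟩ <;>
    refine hasEigenvalue_linTT ha hσ (by positivity) ?_ <;> rw [← hb, ← hc] <;>
    linear_combination hd / 4

lemma isUnstableNodeAt {a ε σ : ℝ} (ha : 0 < a) (hε0 : 0 < ε) (hε : ε < 1 / 9) (hσ : σ ^ 2 = 1) :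
    IsUnstableNodeAt (-a) ε σ (-(Real.pi / 2)) := by
  refine ⟨_, hasLinearization ha hε0 (by linarith) (Or.inr rfl) (by simp) (by simp), ?_⟩
  have hk : 0 < 1 + -1 * ε := by linarith
  set b := (1 + -1 * ε) ^ 2 / a with hb
  set c := 2 * -1 * ε * (1 + -1 * ε) ^ 3 / a ^ 2 with hc
  have hb0 : 0 < b := by positivity
  have hc0 : c < 0 := by
    have : 0 < 2 * ε * (1 + -1 * ε) ^ 3 / a ^ 2 := by positivity
    have e : c = -(2 * ε * (1 + -1 * ε) ^ 3 / a ^ 2) := by rw [hc]; ring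
    linarith
  -- The discriminant of the characteristic polynomial factors as `(1 - ε)³ (1 - 9ε) / a²`; this is
  -- where the threshold `1/9` appears.
  have hdisc : 0 < b ^ 2 + 4 * c := by
    have : b ^ 2 + 4 * c = (1 + -1 * ε) ^ 3 * (1 - 9 * ε) / a ^ 2 := by
      rw [hb, hc]; field_simp; ring
    rw [this]
    have : 0 < 1 - 9 * ε := by linarith
    positivity
  have hd := Real.sq_sqrt hdisc.le
  have hd0 := Real.sqrt_pos.2 hdisc
  have hlt : √(b ^ 2 + 4 * c) < b := by
    rw [Real.sqrt_lt' hb0]; linarith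
  set d := √(b ^ 2 + 4 * c)
  refine ⟨(b - d) / 2, (b + d) / 2, by linarith, by linarith, ?_, ?_⟩ <;>
    refine hasEigenvalue_linTT ha hσ hk.ne' ?_ <;> rw [← hb, ← hc] <;>
    linear_combination hd / 4

lemma isUnstableSpiralAt {a ε σ : ℝ} (ha : 0 < a) (hε : 1 / 9 < ε) (hε1 : ε < 1)
    (hσ : σ ^ 2 = 1) : IsUnstableSpiralAt (-a) ε σ (-(Real.pi / 2)) := by
  refine ⟨_, hasLinearization ha (by linarith) hε1 (Or.inr rfl) (by simp) (by simp), ?_⟩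
  have hk : 0 < 1 + -1 * ε := by linarith
  set b := (1 + -1 * ε) ^ 2 / a with hb
  set c := 2 * -1 * ε * (1 + -1 * ε) ^ 3 / a ^ 2 with hc
  have hb0 : 0 < b := by positivity
  have hdisc : 0 < -(b ^ 2 + 4 * c) := by
    have : -(b ^ 2 + 4 * c) = (1 + -1 * ε) ^ 3 * (9 * ε - 1) / a ^ 2 := by
      rw [hb, hc]; field_simp; ring
    rw [this]
    have : 0 < 9 * ε - 1 := by linarith
    positivity
  have hd := Real.sq_sqrt hdisc.le
  have hd0 := Real.sqrt_pos.2 hdisc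
  set d := √(-(b ^ 2 + 4 * c))
  refine ⟨⟨b / 2, d / 2⟩, by simpa using hb0, by simpa using hd0.ne', ?_⟩
  refine hasEigenvalue_linTT_complex ha hσ hk.ne' ?_
  have e1 : ((1 : ℂ) + ((-1 : ℝ) : ℂ) * ε) ^ 2 / a = (b : ℂ) := by rw [hb]; push_cast; ring
  have e2 : 2 * ((-1 : ℝ) : ℂ) * ε * ((1 : ℂ) + ((-1 : ℝ) : ℂ) * ε) ^ 3 / a ^ 2 = (c : ℂ) := by
    rw [hc]; push_cast; ring
  rw [e1, e2]
  apply Complex.ext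
  · simp [sq]
    linear_combination (-1 / 4) * hd
  · simp [sq]
    ring

/-! ### The scalar equation of a family in polar coordinates -/

/-- The standing assumptions on the parameters. -/
structure Params (a ε : ℝ) : Prop where
  a_pos : 0 < a
  eps_pos : 0 < ε
  eps_lt : ε < 1

/-- `ρ` in polar coordinates, the angle `u` being measured from the positive `x₂`-axis. -/
def polRho (a ε u r : ℝ) : ℝ :=
  a ^ 2 - 2 * a * ε * r * Real.cos u - (1 - ε ^ 2) * r ^ 2

/-- The slope `dr/du` of the trajectories. -/
def slopeField (a ε u r : ℝ) : ℝ :=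
  (√(polRho a ε u r) - ε * Real.sin u * (a - ε * r * Real.cos u)) / (1 - ε ^ 2 * Real.sin u ^ 2)

/-- A bounded continuous extension of the slope beyond the ergoregion. -/
def extSlope (a ε u r : ℝ) : ℝ :=
  (√(polRho a ε u r) -
    ε * Real.sin u * max (a / 2) (min (a / (1 - ε)) (a - ε * r * Real.cos u))) /
    (1 - ε ^ 2 * Real.sin u ^ 2)

lemma polRho_eq (a ε u r : ℝ) :
    polRho a ε u r = (a - ε * r * Real.cos u) ^ 2 - r ^ 2 * (1 - ε ^ 2 * Real.sin u ^ 2) := by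
  rw [polRho]
  linear_combination -(ε ^ 2 * r ^ 2) * (Real.sin_sq_add_cos_sq u)

lemma polRho_zero_right (a ε u : ℝ) : polRho a ε u 0 = a ^ 2 := by simp [polRho]

lemma Params.one_sub_sq_pos {a ε : ℝ} (h : Params a ε) : 0 < 1 - ε ^ 2 := by
  nlinarith [h.eps_pos, h.eps_lt]

lemma Params.den_pos {a ε : ℝ} (h : Params a ε) (u : ℝ) : 0 < 1 - ε ^ 2 * Real.sin u ^ 2 := by
  nlinarith [h.one_sub_sq_pos, Real.sin_sq_le_one u, sq_nonneg ε]

lemma Params.abs_eps_sin_lt {a ε : ℝ} (h : Params a ε) (u : ℝ) : |ε * Real.sin u| ≤ ε := by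
  rw [abs_mul, abs_of_pos h.eps_pos]
  exact mul_le_of_le_one_right h.eps_pos.le (Real.abs_sin_le_one u)

/-- From `ρ ≥ 0` one gets `2aεr cos u ≤ a²`. Thus the lower clamp in `extSlope` is inactive in the
ergoregion; its positivity fixes the direction of crossing outside. -/
lemma half_le_kappa {a ε u r : ℝ} (h : Params a ε) (hρ : 0 ≤ polRho a ε u r) :
    a / 2 ≤ a - ε * r * Real.cos u := by
  have h1 := h.one_sub_sq_pos
  have ha := h.a_pos
  rw [polRho] at hρ
  have h2 : a * (2 * (ε * r * Real.cos u)) ≤ a * a := by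
    nlinarith [mul_nonneg h1.le (sq_nonneg r)]
  have := le_of_mul_le_mul_left h2 ha
  linarith

lemma radius_le {a ε u r : ℝ} (h : Params a ε) (hr : 0 ≤ r) (hρ : 0 ≤ polRho a ε u r) :
    (1 - ε) * r ≤ a := by
  have ha := h.a_pos
  have h0 := h.eps_pos
  have h1 := h.eps_lt
  have h2 : polRho a ε u r ≤ (a + (1 + ε) * r) * (a - (1 - ε) * r) := by
    have : 0 ≤ 2 * a * ε * r * (1 + Real.cos u) :=
      mul_nonneg (by positivity) (by linarith [Real.neg_one_le_cos u])
    rw [polRho]; nlinarith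
  have h3 : 0 < a + (1 + ε) * r := by positivity
  have := nonneg_of_mul_nonneg_right (hρ.trans h2) h3
  linarith

/-- The worst direction is `u = π`, where the ergosphere is farthest from `O`. This makes the upper
clamp in `extSlope` inactive as well. -/
lemma kappa_le {a ε u r : ℝ} (h : Params a ε) (hr : 0 ≤ r) (hρ : 0 ≤ polRho a ε u r) :
    a - ε * r * Real.cos u ≤ a / (1 - ε) := by
  have h1 := radius_le h hr hρ
  have h2 : 0 < 1 - ε := by linarith [h.eps_lt]
  rw [le_div_iff₀ h2]
  have h3 : 0 ≤ ε * r * (1 + Real.cos u) :=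
    mul_nonneg (mul_nonneg h.eps_pos.le hr) (by linarith [Real.neg_one_le_cos u])
  nlinarith [h.eps_pos]

lemma sqrt_polRho_le_kappa {a ε u r : ℝ} (h : Params a ε) (hρ : 0 ≤ polRho a ε u r) :
    √(polRho a ε u r) ≤ a - ε * r * Real.cos u := by
  have h1 := half_le_kappa h hρ
  rw [Real.sqrt_le_left (by linarith [h.a_pos]), polRho_eq]
  nlinarith [mul_nonneg (sq_nonneg r) (h.den_pos u).le]

lemma extSlope_eq {a ε u r : ℝ} (h : Params a ε) (hr : 0 ≤ r) (hρ : 0 ≤ polRho a ε u r) :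
    extSlope a ε u r = slopeField a ε u r := by
  rw [extSlope, slopeField, min_eq_right (kappa_le h hr hρ), max_eq_right (half_le_kappa h hρ)]

lemma continuous_extSlope {a ε : ℝ} (h : Params a ε) :
    Continuous (Function.uncurry (extSlope a ε)) := by
  unfold Function.uncurry extSlope polRho
  refine Continuous.div (by fun_prop) (by fun_prop) fun p => (h.den_pos p.1).ne'

/-- Completing the square in `r` bounds `ρ` at every radius, inside the ergoregion or not, so `√ρ`
and the extended slope are bounded on the whole plane. -/
lemma polRho_le {a ε : ℝ} (h : Params a ε) (u r : ℝ) : polRho a ε u r ≤ (a / (1 - ε)) ^ 2 := by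
  have h0 := h.eps_pos
  have h1 := h.one_sub_sq_pos
  have h2 : 0 < 1 - ε := by linarith [h.eps_lt]
  have key : (1 - ε ^ 2) * polRho a ε u r ≤ a ^ 2 := by
    have : (1 - ε ^ 2) * polRho a ε u r = a ^ 2 - (a * ε) ^ 2 * Real.sin u ^ 2 -
        ((1 - ε ^ 2) * r + a * ε * Real.cos u) ^ 2 := by
      rw [polRho]; linear_combination (a * ε) ^ 2 * Real.sin_sq_add_cos_sq u
    rw [this]
    nlinarith [sq_nonneg (a * ε * Real.sin u), sq_nonneg ((1 - ε ^ 2) * r + a * ε * Real.cos u)]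
  rw [div_pow, le_div_iff₀ (by positivity)]
  rcases le_total (polRho a ε u r) 0 with h3 | h3
  · nlinarith [sq_nonneg a, sq_nonneg (1 - ε)]
  · refine le_trans ?_ key
    rw [mul_comm]
    gcongr
    nlinarith

lemma abs_extSlope_le {a ε : ℝ} (h : Params a ε) (u r : ℝ) :
    |extSlope a ε u r| ≤ 2 * (a / (1 - ε)) / (1 - ε ^ 2) := by
  have ha := h.a_pos
  have h0 := h.eps_pos
  have h1 := h.one_sub_sq_pos
  have h2 : 0 < 1 - ε := by linarith [h.eps_lt]
  have ha2 : a / 2 ≤ a / (1 - ε) := by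
    rw [div_le_div_iff₀ two_pos h2]; nlinarith
  rw [extSlope, abs_div, abs_of_pos (h.den_pos u)]
  have hden : 1 - ε ^ 2 ≤ 1 - ε ^ 2 * Real.sin u ^ 2 := by
    nlinarith [Real.sin_sq_le_one u, sq_nonneg ε]
  have hs : √(polRho a ε u r) ≤ a / (1 - ε) := by
    rw [Real.sqrt_le_left (by positivity)]; exact polRho_le h u r
  set M := max (a / 2) (min (a / (1 - ε)) (a - ε * r * Real.cos u))
  have hM1 : M ≤ a / (1 - ε) := max_le ha2 (min_le_left _ _)
  have hM0 : 0 ≤ M := le_trans (by positivity) (le_max_left _ _)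
  have h3 : |ε * Real.sin u * M| ≤ 1 * (a / (1 - ε)) := by
    rw [abs_mul, abs_of_nonneg hM0]
    exact mul_le_mul ((h.abs_eps_sin_lt u).trans h.eps_lt.le) hM1 hM0 zero_le_one
  have h4 : |√(polRho a ε u r) - ε * Real.sin u * M| ≤ 2 * (a / (1 - ε)) := by
    refine (abs_sub _ _).trans ?_
    rw [abs_of_nonneg (Real.sqrt_nonneg _)]
    linarith
  exact div_le_div₀ (by positivity) h4 h1 hden

/-! ### Solutions of the extended equation and their monotone quantities -/

/-- Global solutions of the extended scalar equation. -/
def IsSol (a ε : ℝ) (x : ℝ → ℝ) : Prop := ∀ u, HasDerivAt x (extSlope a ε u (x u)) u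

lemma exists_isSol {a ε : ℝ} (h : Params a ε) (u₀ r₀ : ℝ) : ∃ x, x u₀ = r₀ ∧ IsSol a ε x :=
  exists_global_solution (continuous_extSlope h) (abs_extSlope_le h) u₀ r₀

lemma IsSol.continuous {a ε : ℝ} {x : ℝ → ℝ} (hx : IsSol a ε x) : Continuous x :=
  continuous_iff_continuousAt.2 fun u => (hx u).continuousAt

lemma IsSol.contDiff {a ε : ℝ} (h : Params a ε) {x : ℝ → ℝ} (hx : IsSol a ε x) :
    ContDiff ℝ 1 x := by
  rw [contDiff_one_iff_deriv]
  refine ⟨fun u => (hx u).differentiableAt, ?_⟩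
  have : deriv x = fun u => extSlope a ε u (x u) := funext fun u => (hx u).deriv
  rw [this]
  exact (continuous_extSlope h).comp (continuous_id.prodMk hx.continuous)

/-- The coefficients are `2π`-periodic in `u`; this is how statements about one turn are carried
over to all turns. -/
lemma IsSol.shift {a ε : ℝ} {x : ℝ → ℝ} (hx : IsSol a ε x) (k : ℤ) :
    IsSol a ε fun u => x (u + k * (2 * Real.pi)) := by
  intro u
  have := (hx (u + k * (2 * Real.pi))).comp_add_const u (k * (2 * Real.pi))
  simpa [extSlope, polRho, Real.sin_add_int_mul_two_pi, Real.cos_add_int_mul_two_pi] using this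

lemma polRho_add_int (a ε u r : ℝ) (k : ℤ) :
    polRho a ε (u + k * (2 * Real.pi)) r = polRho a ε u r := by
  simp [polRho, Real.cos_add_int_mul_two_pi]

lemma IsSol.continuous_polRho {a ε : ℝ} {x : ℝ → ℝ} (hx : IsSol a ε x) :
    Continuous fun u => polRho a ε u (x u) := by
  have := hx.continuous
  unfold polRho; fun_prop

lemma IsSol.hasDerivAt_polRho {a ε : ℝ} {x : ℝ → ℝ} (hx : IsSol a ε x) (u : ℝ) :
    HasDerivAt (fun u => polRho a ε u (x u))
      (-2 * (a * ε * Real.cos u + (1 - ε ^ 2) * x u) * extSlope a ε u (x u) +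
        2 * a * ε * x u * Real.sin u) u := by
  have h1 := hx u
  have h2 := (((h1.const_mul (2 * a * ε)).mul (Real.hasDerivAt_cos u)).const_sub (a ^ 2)).sub
    ((h1.pow 2).const_mul (1 - ε ^ 2))
  refine h2.congr_deriv ?_
  simp
  ring

/-- Outside the ergoregion the solutions cross the level sets of `ρ` in a definite direction. -/
lemma IsSol.exists_hasDerivAt_polRho {a ε : ℝ} (h : Params a ε) {x : ℝ → ℝ} (hx : IsSol a ε x)
    {u : ℝ} (hpos : 0 < x u) (hρ : polRho a ε u (x u) ≤ 0) :
    ∃ d > 0, HasDerivAt (fun u => polRho a ε u (x u)) (Real.sin u * d) u := by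
  have ha := h.a_pos
  have h0 := h.eps_pos
  have h1 := h.one_sub_sq_pos
  set M := max (a / 2) (min (a / (1 - ε)) (a - ε * x u * Real.cos u)) with hM
  have hM0 : 0 < M := lt_of_lt_of_le (by positivity) (le_max_left _ _)
  have hd := h.den_pos u
  -- This is `-½ ∂ρ/∂r`, which is positive from the ergosphere outwards.
  have hP : 0 < a * ε * Real.cos u + (1 - ε ^ 2) * x u := by
    rw [polRho] at hρ
    have : 0 < x u * (2 * (a * ε * Real.cos u + (1 - ε ^ 2) * x u)) := by
      nlinarith [mul_nonneg h1.le (sq_nonneg (x u))]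
    have := pos_of_mul_pos_right this hpos.le
    linarith
  refine ⟨2 * (a * ε * Real.cos u + (1 - ε ^ 2) * x u) * (ε * M / (1 - ε ^ 2 * Real.sin u ^ 2)) +
    2 * a * ε * x u, by positivity, (hx.hasDerivAt_polRho u).congr_deriv ?_⟩
  -- With `√ρ = 0` the slope is a positive multiple of `-sin u`, so the whole derivative has the
  -- factor `sin u`.
  rw [extSlope, Real.sqrt_eq_zero_of_nonpos hρ, ← hM]
  field_simp
  ring

/-- A function that starts positive and increases through zeros stays positive. -/
lemma pos_of_deriv_pos_of_eq_zero {f : ℝ → ℝ} {a b : ℝ} (hc : ContinuousOn f (Icc a b))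
    (ha : 0 < f a) (hd : ∀ u ∈ Ioc a b, f u = 0 → ∃ f' > 0, HasDerivAt f f' u) :
    ∀ u ∈ Icc a b, 0 < f u := by
  intro u hu
  by_contra! hneg
  set Z := Icc a u ∩ f ⁻¹' Iic 0
  have hcs : ContinuousOn f (Icc a u) := hc.mono (Icc_subset_Icc_right hu.2)
  have hZc : IsCompact Z :=
    isCompact_Icc.of_isClosed_subset (hcs.preimage_isClosed_of_isClosed isClosed_Icc isClosed_Iic)
      inter_subset_left
  obtain ⟨c, hc1, hc2⟩ := hZc.exists_isLeast ⟨u, ⟨hu.1, le_rfl⟩, hneg⟩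
  have hac : a < c := lt_of_le_of_ne hc1.1.1 (fun h' => by
    have := hc1.2; rw [← h'] at this; exact absurd this (not_le.2 ha))
  have hpos' : ∀ z ∈ Ico a c, 0 < f z := by
    intro z hz
    by_contra! hz0
    exact absurd (hc2 ⟨⟨hz.1, hz.2.le.trans hc1.1.2⟩, hz0⟩) (not_le.2 hz.2)
  have hfc : f c = 0 := by
    refine le_antisymm hc1.2 ?_
    have hcw : Tendsto f (𝓝[<] c) (𝓝 (f c)) :=
      ((hcs c hc1.1).mono (fun z hz => ⟨hz.1.le, hz.2.le.trans hc1.1.2⟩ :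
        Ioo a c ⊆ Icc a u)).tendsto.mono_left
        (by rw [nhdsWithin_Ioo_eq_nhdsLT hac])
    refine ge_of_tendsto hcw ?_
    filter_upwards [Ioo_mem_nhdsLT hac] with z hz using (hpos' z ⟨hz.1.le, hz.2⟩).le
  obtain ⟨f', hf', hder⟩ := hd c ⟨hac, hc1.1.2.trans hu.2⟩ hfc
  have h1 : ∀ᶠ z in 𝓝[<] c, 0 < slope f c z :=
    ((hasDerivAt_iff_tendsto_slope_left_right.1 hder).1).eventually (lt_mem_nhds hf')
  obtain ⟨z, hz1, hz2⟩ := (h1.and (Ioo_mem_nhdsLT hac)).exists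
  have hz3 := hpos' z ⟨hz2.1.le, hz2.2⟩
  rw [slope_def_field, div_pos_iff, hfc] at hz1
  rcases hz1 with h | h <;> linarith [h.1, h.2, hz2.2]

/-- At `r = 0` the slope is a positive multiple of `a (1 - ε sin u)`. Solutions therefore cross `r =
0` only upwards as `u` grows, which yields `IsSol.pos`. -/
lemma extSlope_zero {a ε : ℝ} (h : Params a ε) (u : ℝ) : 0 < extSlope a ε u 0 := by
  have ha := h.a_pos
  rw [extSlope_eq h le_rfl (by rw [polRho_zero_right]; positivity), slopeField, polRho_zero_right,
    Real.sqrt_sq ha.le]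
  refine div_pos ?_ (h.den_pos u)
  have h1 := (abs_le.1 (h.abs_eps_sin_lt u)).2
  have h2 : ε * Real.sin u < 1 := h1.trans_lt h.eps_lt
  nlinarith

lemma IsSol.pos {a ε : ℝ} (h : Params a ε) {x : ℝ → ℝ} (hx : IsSol a ε x) {b c : ℝ}
    (hb : 0 < x b) : ∀ u ∈ Icc b c, 0 < x u :=
  pos_of_deriv_pos_of_eq_zero hx.continuous.continuousOn hb fun u _ hu =>
    ⟨extSlope a ε u (x u), by rw [hu]; exact extSlope_zero h u, hx u⟩

/-- The Lyapunov function `r exp(-ε r cos u / a) = exp(-ψ/a)`. -/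
def lyap (a ε u r : ℝ) : ℝ := r * Real.exp (-(ε * r * Real.cos u) / a)

/-- Along a trajectory `dψ/dx₀ = v · (v - ξ) = |v|² - 1`, which is positive inside the ergoregion.
Hence `exp(-ψ/a)` decreases in time, that is, increases with `u`; the formula expresses this through
`u`. -/
lemma IsSol.hasDerivAt_lyap {a ε : ℝ} (h : Params a ε) {x : ℝ → ℝ} (hx : IsSol a ε x) {u : ℝ}
    (hpos : 0 < x u) (hρ : 0 ≤ polRho a ε u (x u)) :
    HasDerivAt (fun u => lyap a ε u (x u))
      (Real.exp (-(ε * x u * Real.cos u) / a) * (√(polRho a ε u (x u)) *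
        ((a - ε * x u * Real.cos u) - ε * Real.sin u * √(polRho a ε u (x u))) /
          (a * (1 - ε ^ 2 * Real.sin u ^ 2)))) u := by
  have ha := h.a_pos
  have hd := h.den_pos u
  have h1 := hx u
  have h2 := h1.mul ((((h1.const_mul ε).mul (Real.hasDerivAt_cos u)).neg.div_const a).exp)
  refine h2.congr_deriv ?_
  rw [extSlope_eq h hpos.le hρ, slopeField]
  have h3 : √(polRho a ε u (x u)) ^ 2 = _ := (Real.sq_sqrt hρ).trans (polRho_eq a ε u (x u))
  simp only [Pi.neg_apply, Pi.mul_apply]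
  set t := √(polRho a ε u (x u))
  set E := Real.exp (-(ε * x u * Real.cos u) / a)
  field_simp
  linear_combination (E * ε * Real.sin u) * h3

lemma kappa_sub_pos {a ε u r : ℝ} (h : Params a ε) (hρ : 0 ≤ polRho a ε u r) :
    (1 - ε) * (a / 2) ≤ (a - ε * r * Real.cos u) - ε * Real.sin u * √(polRho a ε u r) ∧
    (1 - ε) * (a / 2) ≤ (a - ε * r * Real.cos u) + ε * Real.sin u * √(polRho a ε u r) := by
  have h1 := half_le_kappa h hρ
  have h2 := sqrt_polRho_le_kappa h hρ
  have h3 := abs_le.1 (h.abs_eps_sin_lt u)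
  have h4 := Real.sqrt_nonneg (polRho a ε u r)
  have h5 := h.eps_pos
  have h6 : 0 < 1 - ε := by linarith [h.eps_lt]
  have h7 : (1 - ε) * (a / 2) ≤ (1 - ε) * (a - ε * r * Real.cos u) := by gcongr
  constructor <;> nlinarith

lemma IsSol.lyap_strictMonoOn {a ε : ℝ} (h : Params a ε) {x : ℝ → ℝ} (hx : IsSol a ε x) {b c : ℝ}
    (hpos : ∀ u ∈ Ioo b c, 0 < x u) (hρ : ∀ u ∈ Ioo b c, 0 < polRho a ε u (x u)) :
    StrictMonoOn (fun u => lyap a ε u (x u)) (Icc b c) := by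
  have hcx := hx.continuous
  refine strictMonoOn_of_deriv_pos (convex_Icc _ _) ?_ fun u hu => ?_
  · unfold lyap; fun_prop
  · rw [interior_Icc] at hu
    rw [(hx.hasDerivAt_lyap h (hpos u hu) (hρ u hu).le).deriv]
    have ha := h.a_pos
    have h1 := (kappa_sub_pos h (hρ u hu).le).1
    have h2 : 0 < (1 - ε) * (a / 2) := mul_pos (by linarith [h.eps_lt]) (by positivity)
    have h3 : 0 < √(polRho a ε u (x u)) := Real.sqrt_pos.2 (hρ u hu)
    exact mul_pos (Real.exp_pos _)
      (div_pos (mul_pos h3 (h2.trans_le h1)) (mul_pos ha (h.den_pos u)))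

/-- At a fixed angle the Lyapunov function orders the radii. -/
lemma lt_of_lyap_lt {a ε : ℝ} (h : Params a ε) {u r₁ r₂ : ℝ} (h1 : 0 ≤ r₁)
    (hρ : 0 ≤ polRho a ε u r₁) (hl : lyap a ε u r₁ < lyap a ε u r₂) : r₁ < r₂ := by
  by_contra! hle
  have ha := h.a_pos
  refine absurd hl (not_lt.2 ?_)
  rcases le_or_gt r₂ 0 with h2 | h2
  · exact (mul_nonpos_of_nonpos_of_nonneg h2 (Real.exp_pos _).le).trans
      (mul_nonneg h1 (Real.exp_pos _).le)
  have hκ : ε * r₁ * Real.cos u ≤ a / 2 := by linarith [half_le_kappa h hρ]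
  have hanti : MonotoneOn (fun r => lyap a ε u r) (Icc 0 r₁) := by
    have hder : ∀ r, HasDerivAt (fun r => lyap a ε u r)
        (Real.exp (-(ε * r * Real.cos u) / a) * (1 - ε * r * Real.cos u / a)) r := by
      intro r
      have e1 := (((hasDerivAt_id r).const_mul ε).mul_const (Real.cos u)).neg.div_const a
      refine ((hasDerivAt_id r).mul e1.exp).congr_deriv ?_
      simp
      ring
    refine monotoneOn_of_deriv_nonneg (convex_Icc _ _)
      (fun r _ => (hder r).continuousAt.continuousWithinAt)
      (fun r _ => (hder r).differentiableAt.differentiableWithinAt) fun r hr => ?_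
    rw [interior_Icc] at hr
    rw [(hder r).deriv]
    refine mul_nonneg (Real.exp_pos _).le ?_
    rw [sub_nonneg, div_le_one ha]
    rcases le_total (Real.cos u) 0 with hc | hc
    · exact (mul_nonpos_of_nonneg_of_nonpos (mul_nonneg h.eps_pos.le hr.1.le) hc).trans ha.le
    · have : ε * r * Real.cos u ≤ ε * r₁ * Real.cos u := by
        have := h.eps_pos
        gcongr
        exact hr.2.le
      linarith
  exact hanti ⟨h2.le, hle⟩ ⟨h1, le_rfl⟩ hle

/-- Local Lipschitz continuity of the slope inside the ergoregion. -/
lemma exists_lipschitz_slopeField {a ε : ℝ} (h : Params a ε) {u r : ℝ}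
    (hρ : 0 < polRho a ε u r) :
    ∃ K : ℝ, ∀ᶠ p : ℝ × ℝ × ℝ in 𝓝 (u, r, r),
      |slopeField a ε p.1 p.2.1 - slopeField a ε p.1 p.2.2| ≤ K * |p.2.1 - p.2.2| := by
  have hcd : ContDiffAt ℝ 1 (Function.uncurry (slopeField a ε)) (u, r) := by
    unfold Function.uncurry slopeField
    refine ContDiffAt.div ?_ ?_ (h.den_pos _).ne'
    · refine ContDiffAt.sub (ContDiffAt.sqrt ?_ hρ.ne') (by fun_prop)
      unfold polRho; fun_prop
    · fun_prop
  obtain ⟨K, t, ht, hK⟩ := hcd.exists_lipschitzOnWith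
  refine ⟨K, ?_⟩
  have h1 : Tendsto (fun p : ℝ × ℝ × ℝ => (p.1, p.2.1)) (𝓝 (u, r, r)) (𝓝 (u, r)) :=
    Continuous.tendsto' (by fun_prop) _ _ rfl
  have h2 : Tendsto (fun p : ℝ × ℝ × ℝ => (p.1, p.2.2)) (𝓝 (u, r, r)) (𝓝 (u, r)) :=
    Continuous.tendsto' (by fun_prop) _ _ rfl
  filter_upwards [h1 ht, h2 ht] with p hp1 hp2
  have := hK.dist_le_mul _ hp1 _ hp2
  simpa [Real.dist_eq, Prod.dist_eq, Function.uncurry] using this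

/-- Two solutions through an interior point agree nearby. -/
lemma IsSol.eventually_eq {a ε : ℝ} (h : Params a ε) {x y : ℝ → ℝ} (hx : IsSol a ε x)
    (hy : IsSol a ε y) {c : ℝ} (hc : x c = y c) (hpos : 0 < x c) (hρ : 0 < polRho a ε c (x c)) :
    ∀ᶠ u in 𝓝 c, x u = y u := by
  obtain ⟨K, hK⟩ := exists_lipschitz_slopeField h hρ
  have ht : Tendsto (fun u => (u, x u, y u)) (𝓝 c) (𝓝 (c, x c, x c)) := by
    have h1 := hx.continuous
    have h2 := hy.continuous
    exact Continuous.tendsto' (by fun_prop) _ _ (by rw [hc])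
  have e1 := hx.continuous.continuousAt.eventually (lt_mem_nhds hpos)
  have e2 := hy.continuous.continuousAt.eventually (lt_mem_nhds (hc ▸ hpos))
  have e3 := hx.continuous_polRho.continuousAt.eventually (lt_mem_nhds hρ)
  have e4 := hy.continuous_polRho.continuousAt.eventually (lt_mem_nhds (hc ▸ hρ))
  obtain ⟨l, w, hlw, hsub⟩ := mem_nhds_iff_exists_Ioo_subset.1
    ((ht.eventually hK).and (e1.and (e2.and (e3.and e4))))
  obtain ⟨l', hl'⟩ := exists_between hlw.1
  obtain ⟨w', hw'⟩ := exists_between hlw.2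
  have hz := eqOn_zero_of_abs_deriv_le (h := fun u => x u - y u)
    (h' := fun u => extSlope a ε u (x u) - extSlope a ε u (y u)) (a := l') (b := w') (C := K)
    (fun s hs => by
      obtain ⟨q1, q2, q3, q4, q5⟩ := hsub ⟨hl'.1.trans_le hs.1, hs.2.trans_lt hw'.2⟩
      refine ⟨(hx s).sub (hy s), ?_⟩
      rw [extSlope_eq h q2.le q4.le, extSlope_eq h q3.le q5.le]
      exact q1) ⟨hl'.2.le, hw'.1.le⟩ (by simp [hc])
  filter_upwards [Icc_mem_nhds hl'.2 hw'.1] with u hu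
  linarith [hz u hu]

/-! ### The separatrix -/

/-- At a fixed angle `ρ` is a concave quadratic in `r` with value `a²` at `0`. The identity is the
exact form of concavity on `[0, R]`, and it shows that the ergoregion is star-shaped. -/
lemma polRho_concave (a ε u r R : ℝ) : R * polRho a ε u r =
    (R - r) * a ^ 2 + r * polRho a ε u R + (1 - ε ^ 2) * (r * R * (R - r)) := by
  unfold polRho; ring

lemma polRho_pos_of_lt {a ε u r R : ℝ} (h : Params a ε) (hr : 0 ≤ r) (hrR : r < R)
    (hR : 0 ≤ polRho a ε u R) : 0 < polRho a ε u r := by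
  have h1 := h.one_sub_sq_pos
  have ha := h.a_pos
  have hR0 : 0 < R := hr.trans_lt hrR
  have hsub : 0 < R - r := by linarith
  refine pos_of_mul_pos_right (?_ : 0 < R * polRho a ε u r) hR0.le
  rw [polRho_concave]
  positivity

lemma polRho_saddle (a ε r : ℝ) :
    polRho a ε 0 r = (a - (1 + ε) * r) * (a + (1 - ε) * r) := by
  rw [polRho, Real.cos_zero]; ring

lemma polRho_two_pi (a ε r : ℝ) : polRho a ε (2 * Real.pi) r = polRho a ε 0 r := by
  simp [polRho]

lemma polRho_pi (a ε r : ℝ) :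
    polRho a ε Real.pi r = (a + (1 + ε) * r) * (a - (1 - ε) * r) := by
  rw [polRho, Real.cos_pi]; ring

lemma polRho_saddle_pos_iff {a ε r : ℝ} (h : Params a ε) (hr : 0 ≤ r) :
    0 < polRho a ε 0 r ↔ r < a / (1 + ε) := by
  have h1 : 0 < 1 + ε := by linarith [h.eps_pos]
  have h2 : 0 < 1 - ε := by linarith [h.eps_lt]
  have h3 : 0 < a + (1 - ε) * r := by have := h.a_pos; positivity
  rw [polRho_saddle, mul_pos_iff_of_pos_right h3, sub_pos, lt_div_iff₀ h1, mul_comm]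

lemma polRho_saddle_neg_iff {a ε r : ℝ} (h : Params a ε) (hr : 0 ≤ r) :
    polRho a ε 0 r < 0 ↔ a / (1 + ε) < r := by
  have h1 : 0 < 1 + ε := by linarith [h.eps_pos]
  have h2 : 0 < 1 - ε := by linarith [h.eps_lt]
  have h3 : 0 < a + (1 - ε) * r := by have := h.a_pos; positivity
  rw [polRho_saddle, div_lt_iff₀ h1, mul_comm r]
  constructor
  · intro h4
    by_contra! h5
    exact absurd h4 (not_lt.2 (mul_nonneg (by linarith) h3.le))
  · intro h4
    exact mul_neg_of_neg_of_pos (by linarith) h3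

lemma polRho_saddle_self {a ε : ℝ} (h : Params a ε) : polRho a ε 0 (a / (1 + ε)) = 0 := by
  have h1 : 0 < 1 + ε := by linarith [h.eps_pos]
  rw [polRho_saddle, mul_div_cancel₀ _ h1.ne']; ring

/-- In the spiral case a solution that is inside the ergoregion for `u < π` cannot tend to the
lower tangential point as `u → π`. -/
lemma IsSol.polRho_pi_ne_zero {a ε : ℝ} (h : Params a ε) (hsp : 1 / 9 < ε) {x : ℝ → ℝ}
    (hx : IsSol a ε x) (hpos : ∀ u ∈ Icc 0 Real.pi, 0 < x u)
    (hin : ∀ u ∈ Ioo 0 Real.pi, 0 < polRho a ε u (x u)) : polRho a ε Real.pi (x Real.pi) ≠ 0 := by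
  intro h0
  have ha := h.a_pos
  have he := h.eps_pos
  have he1 : 0 < 1 - ε := by linarith [h.eps_lt]
  have hπ := Real.pi_pos
  have hxc := hx.continuous
  have hxπ : x Real.pi = a / (1 - ε) := by
    have hp := hpos Real.pi ⟨hπ.le, le_rfl⟩
    rw [polRho_pi, mul_eq_zero] at h0
    rcases h0 with h0 | h0
    · have : 0 < a + (1 + ε) * x Real.pi := by positivity
      linarith
    · rw [eq_div_iff he1.ne']; linarith
  set T : ℝ → ℝ := fun w => √(polRho a ε (Real.pi - w) (x (Real.pi - w))) with hT
  set p : ℝ → ℝ := fun w => (a * ε * Real.cos (Real.pi - w) + (1 - ε ^ 2) * x (Real.pi - w)) /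
    (1 - ε ^ 2 * Real.sin (Real.pi - w) ^ 2) with hp
  set Q : ℝ → ℝ := fun w => ε * (a - ε * x (Real.pi - w) * Real.cos (Real.pi - w)) * p w +
    a * ε * x (Real.pi - w) with hQ
  have hTc : Continuous T :=
    Real.continuous_sqrt.comp (hx.continuous_polRho.comp (by fun_prop : Continuous fun w => Real.pi - w))
  have hpc : Continuous p :=
    Continuous.div (by fun_prop) (by fun_prop) fun w => (h.den_pos _).ne'
  have hQc : Continuous Q := by fun_prop
  have hp0 : p 0 = a := by
    simp only [hp, sub_zero, Real.cos_pi, Real.sin_pi, hxπ]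
    field_simp
    ring
  have hQ0 : Q 0 = 2 * ε * a ^ 2 / (1 - ε) := by
    simp only [hQ, sub_zero, hp0, Real.cos_pi, hxπ]
    field_simp
    ring
  have hTpos : ∀ w ∈ Ioo 0 Real.pi, 0 < T w := fun w hw =>
    Real.sqrt_pos.2 (hin _ ⟨by linarith [hw.2], by linarith [hw.1]⟩)
  -- In terms of the distance `w = π - u` to the lower tangential point, `T = √ρ` satisfies `T' = p
  -- - Q sin w / T` with `p` and `Q` continuous.
  have hT' : ∀ w ∈ Ioo 0 Real.pi, HasDerivAt T (p w - Real.sin w / T w * Q w) w := by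
    intro w hw
    have hw' : Real.pi - w ∈ Ioo 0 Real.pi := ⟨by linarith [hw.2], by linarith [hw.1]⟩
    have hr := hin _ hw'
    have h1 := ((hx.hasDerivAt_polRho (Real.pi - w)).comp_const_sub Real.pi w).sqrt hr.ne'
    refine h1.congr_deriv ?_
    have hTw : √(polRho a ε (Real.pi - w) (x (Real.pi - w))) = T w := rfl
    rw [extSlope_eq h (hpos _ (Ioo_subset_Icc_self hw')).le hr.le, slopeField, hTw]
    have hs : Real.sin w = Real.sin (Real.pi - w) := (Real.sin_pi_sub w).symm
    have hTw0 := (hTpos w hw).ne'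
    have hd := (h.den_pos (Real.pi - w)).ne'
    simp only [hQ, hp]
    rw [hs]
    field_simp
    ring
  -- A limit `m` of `T / w` at `0` would solve `m² - a m + Q 0 = 0`. The inequality `a² < 4 Q 0` is
  -- equivalent to `ε > 1/9`; `b` keeps some room in it.
  obtain ⟨b, hab, hbQ⟩ : ∃ b, a < b ∧ b ^ 2 / 4 < Q 0 := by
    have h1 : a ^ 2 < 4 * Q 0 := by
      rw [hQ0, mul_div_assoc', lt_div_iff₀ he1]
      nlinarith [pow_pos ha 2]
    have h2 : a < √(4 * Q 0) := Real.lt_sqrt_of_sq_lt h1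
    obtain ⟨b, hb1, hb2⟩ := exists_between h2
    refine ⟨b, hb1, ?_⟩
    have := (Real.lt_sqrt (by linarith)).1 hb2
    linarith
  set η := (b - a) / 2 with hη
  have hη0 : 0 < η := by simp only [hη]; linarith
  have hsinc : Tendsto (fun w => Real.sin w / w) (𝓝[>] 0) (𝓝 1) := by
    have := (hasDerivAt_iff_tendsto_slope.1 (Real.hasDerivAt_sin 0)).mono_left
      (nhdsWithin_mono 0 (fun w hw => (ne_of_gt hw : w ≠ 0) : Ioi (0 : ℝ) ⊆ {0}ᶜ))
    simpa [slope_fun_def_field] using this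
  have ev1 : ∀ᶠ w in 𝓝[>] (0 : ℝ), p w < (a + b) / 2 :=
    (hpc.continuousAt.eventually (gt_mem_nhds (by rw [hp0]; linarith))).filter_mono nhdsWithin_le_nhds
  have ev2 : ∀ᶠ w in 𝓝[>] (0 : ℝ), b ^ 2 / 4 < Real.sin w / w * Q w := by
    have : Tendsto (fun w => Real.sin w / w * Q w) (𝓝[>] 0) (𝓝 (1 * Q 0)) :=
      hsinc.mul (hQc.continuousAt.tendsto.mono_left nhdsWithin_le_nhds)
    exact this.eventually (lt_mem_nhds (by linarith))
  have ev3 : ∀ᶠ w in 𝓝[>] (0 : ℝ), w ∈ Ioo 0 Real.pi := Ioo_mem_nhdsGT hπ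
  obtain ⟨w₀, hw₀, hsub⟩ := mem_nhdsGT_iff_exists_Ioo_subset.1 (ev1.and (ev2.and ev3))
  have hw₀ : 0 < w₀ := hw₀
  have hm' : ∀ w ∈ Ioo 0 w₀, HasDerivAt (fun w => T w / w)
      (((p w - Real.sin w / T w * Q w) * w - T w * 1) / w ^ 2) w := fun w hw =>
    (hT' w (hsub hw).2.2).div (hasDerivAt_id w) hw.1.ne'
  have hmle : ∀ w ∈ Ioo 0 w₀,
      ((p w - Real.sin w / T w * Q w) * w - T w * 1) / w ^ 2 ≤ -η * w⁻¹ := by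
    intro w hw
    obtain ⟨h1, h2, h3⟩ := hsub hw
    have hTw := hTpos w h3
    have hw0 := hw.1
    set m := T w / w with hm
    have hm0 : 0 < m := by positivity
    have e1 : ((p w - Real.sin w / T w * Q w) * w - T w * 1) / w ^ 2 =
        (p w - (Real.sin w / w * Q w) / m - m) * w⁻¹ := by
      rw [hm]; field_simp
    rw [e1]
    refine mul_le_mul_of_nonneg_right ?_ (by positivity)
    -- The arithmetic–geometric inequality: `m + Q/m` exceeds `p` by at least `η` for every `m`, so
    -- the ratio `T / w` falls at least like `-η log w`.
    have h4 : b ≤ b ^ 2 / 4 / m + m := by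
      rw [← sub_nonneg]
      have : b ^ 2 / 4 / m + m - b = (b / 2 - m) ^ 2 / m := by field_simp; ring
      rw [this]; positivity
    have h5 : b ^ 2 / 4 / m ≤ (Real.sin w / w * Q w) / m := by gcongr
    simp only [hη]
    linarith
  have hanti : AntitoneOn (fun w => T w / w + η * Real.log w) (Ioo 0 w₀) := by
    have hd : ∀ w ∈ Ioo 0 w₀, HasDerivAt (fun w => T w / w + η * Real.log w)
        (((p w - Real.sin w / T w * Q w) * w - T w * 1) / w ^ 2 + η * w⁻¹) w := fun w hw =>
      (hm' w hw).add ((Real.hasDerivAt_log hw.1.ne').const_mul η)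
    refine antitoneOn_of_deriv_nonpos (convex_Ioo _ _)
      (fun w hw => (hd w hw).continuousAt.continuousWithinAt)
      (fun w hw => ?_) fun w hw => ?_
    · rw [interior_Ioo] at hw
      exact (hd w hw).differentiableAt.differentiableWithinAt
    · rw [interior_Ioo] at hw
      rw [(hd w hw).deriv]
      linarith [hmle w hw]
  set c := (a + b) / 2
  -- Dropping the `Q` term gives `T' ≤ c`, and `T 0 = 0`. So the ratio `T / w` stays bounded,
  -- against its logarithmic growth as `w → 0`.
  have hTle : ∀ w ∈ Ioo 0 w₀, T w ≤ c * w := by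
    have hd : ∀ w ∈ Ioo 0 w₀, HasDerivAt (fun w => T w - c * w)
        ((p w - Real.sin w / T w * Q w) - c * 1) w := fun w hw =>
      (hT' w (hsub hw).2.2).sub ((hasDerivAt_id w).const_mul c)
    have : AntitoneOn (fun w => T w - c * w) (Ico 0 w₀) := by
      refine antitoneOn_of_deriv_nonpos (convex_Ico _ _) (by fun_prop) (fun w hw => ?_) fun w hw => ?_
      · rw [interior_Ico] at hw
        exact (hd w hw).differentiableAt.differentiableWithinAt
      · rw [interior_Ico] at hw
        rw [(hd w hw).deriv]
        obtain ⟨h1, h2, h3⟩ := hsub hw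
        have hTw := hTpos w h3
        have : 0 < Real.sin w / T w * Q w := by
          have e : Real.sin w / T w * Q w = (Real.sin w / w * Q w) * (w / T w) := by
            have := hw.1.ne'
            field_simp
          rw [e]
          exact mul_pos (lt_of_le_of_lt (by positivity) h2) (div_pos hw.1 hTw)
        linarith
    intro w hw
    have h1 := this ⟨le_rfl, hw₀⟩ ⟨hw.1.le, hw.2⟩ hw.1.le
    have hT0 : T 0 = 0 := by simp only [hT, sub_zero, h0, Real.sqrt_zero]
    simp only [hT0, mul_zero, sub_zero] at h1
    linarith
  set w₁ := w₀ / 2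
  have hw₁ : w₁ ∈ Ioo 0 w₀ := ⟨by simp only [w₁]; linarith, by simp only [w₁]; linarith⟩
  have hc0 : 0 < c := by simp only [c]; linarith
  -- Chosen so that `η log w` drops by exactly `c + 1` from `w₁` to `w₂`, which makes the ratio at
  -- `w₂` larger than `c`.
  set w₂ := w₁ * Real.exp (-((c + 1) / η))
  have hexp : Real.exp (-((c + 1) / η)) < 1 := by
    rw [Real.exp_lt_one_iff, neg_lt_zero]; positivity
  have hw₂₀ : 0 < w₂ := mul_pos hw₁.1 (Real.exp_pos _)
  have hw₂₁ : w₂ ≤ w₁ := mul_le_of_le_one_right hw₁.1.le hexp.le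
  have hw₂ : w₂ ∈ Ioo 0 w₀ := ⟨hw₂₀, hw₂₁.trans_lt hw₁.2⟩
  have h1 := hanti hw₂ hw₁ hw₂₁
  have h2 : T w₂ / w₂ ≤ c := (div_le_iff₀ hw₂₀).2 (hTle w₂ hw₂)
  have h3 : Real.log w₂ = Real.log w₁ - (c + 1) / η := by
    rw [Real.log_mul hw₁.1.ne' (Real.exp_pos _).ne', Real.log_exp]; ring
  have h4 : 0 < T w₁ / w₁ := div_pos (hTpos _ (hsub hw₁).2.2) hw₁.1
  simp only [h3, mul_sub] at h1
  rw [mul_div_cancel₀ _ hη0.ne'] at h1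
  linarith

/-- `R` is the solution leaving the saddle `u = 0`; it stays in the ergoregion up to the angle
`up`, where it meets the ergosphere. -/
structure IsSeparatrix (a ε : ℝ) (R : ℝ → ℝ) (up : ℝ) : Prop where
  sol : IsSol a ε R
  zero : R 0 = a / (1 + ε)
  pos : ∀ u ∈ Icc 0 (2 * Real.pi), 0 < R u
  up_mem : up ∈ Ioo Real.pi (2 * Real.pi)
  inside : ∀ u ∈ Ioo 0 up, 0 < polRho a ε u (R u)
  exit : polRho a ε up (R up) = 0
  outside : ∀ u ∈ Ioc up (2 * Real.pi), polRho a ε u (R u) < 0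

/-- On `(0, π)` the solution cannot be outside because there `ρ` would be increasing from `0`; on
`(π, 2π)` an exit is irreversible because outside `ρ` decreases. The spiral condition excludes
touching the ergosphere at `π`, and the monotone quantity forces an exit before `2π`. -/
lemma exists_isSeparatrix {a ε : ℝ} (h : Params a ε) (hsp : 1 / 9 < ε) :
    ∃ R up, IsSeparatrix a ε R up := by
  have ha := h.a_pos
  have he := h.eps_pos
  have hπ := Real.pi_pos
  obtain ⟨R, hR0, hR⟩ := exists_isSol h 0 (a / (1 + ε))
  have hpos : ∀ u ∈ Icc 0 (2 * Real.pi), 0 < R u := hR.pos h (by rw [hR0]; positivity)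
  set g := fun u => polRho a ε u (R u) with hg
  have hgc : Continuous g := hR.continuous_polRho
  have hg0 : g 0 = 0 := by simp only [hg, hR0, polRho_saddle_self h]
  have hin : ∀ u ∈ Ioo 0 Real.pi, 0 < g u := by
    intro u hu
    refine pos_of_deriv_pos_of_nonpos hgc.continuousOn hg0.ge (fun w hw hgw => ?_) u ⟨hu.1, le_rfl⟩
    obtain ⟨d, hd, hder⟩ := hR.exists_hasDerivAt_polRho h
      (hpos w ⟨hw.1.le, by linarith [hw.2, hu.2]⟩) hgw
    exact ⟨_, mul_pos (Real.sin_pos_of_pos_of_lt_pi hw.1 (hw.2.trans_lt hu.2)) hd, hder⟩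
  have hgπ0 : 0 ≤ g Real.pi := by
    refine ge_of_tendsto (hgc.continuousAt.tendsto.mono_left nhdsWithin_le_nhds : Tendsto g
      (𝓝[<] Real.pi) _) ?_
    filter_upwards [Ioo_mem_nhdsLT hπ] with w hw using (hin w hw).le
  have hgπ : 0 < g Real.pi := lt_of_le_of_ne hgπ0 (Ne.symm (hR.polRho_pi_ne_zero h hsp
    (fun u hu => hpos u ⟨hu.1, by linarith [hu.2]⟩) hin))
  have hex : ∃ u ∈ Ioo Real.pi (2 * Real.pi), g u ≤ 0 := by
    by_contra! hcon
    have hall : ∀ u ∈ Ioo 0 (2 * Real.pi), 0 < g u := by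
      intro u hu
      rcases lt_trichotomy u Real.pi with h1 | h1 | h1
      · exact hin u ⟨hu.1, h1⟩
      · rw [h1]; exact hgπ
      · exact hcon u ⟨h1, hu.2⟩
    have hl := hR.lyap_strictMonoOn h (fun u hu => hpos u (Ioo_subset_Icc_self hu)) hall
      (left_mem_Icc.2 (by positivity)) (right_mem_Icc.2 (by positivity)) (by positivity)
    -- Without an exit the full turn ends at a larger radius in the saddle direction, which is
    -- outside the ergoregion; this contradicts `ρ ≥ 0` in the limit.
    have hl' : lyap a ε 0 (R 0) < lyap a ε 0 (R (2 * Real.pi)) := by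
      simpa [lyap] using hl
    have hlt := lt_of_lyap_lt h (by rw [hR0]; positivity) hg0.ge hl'
    rw [hR0] at hlt
    have hneg : g (2 * Real.pi) < 0 := by
      simp only [hg, polRho_two_pi]
      exact (polRho_saddle_neg_iff h (hpos _ ⟨by positivity, le_rfl⟩).le).2 hlt
    refine absurd hneg (not_lt.2 ?_)
    refine ge_of_tendsto (hgc.continuousAt.tendsto.mono_left nhdsWithin_le_nhds : Tendsto g
      (𝓝[<] (2 * Real.pi)) _) ?_
    filter_upwards [Ioo_mem_nhdsLT (by positivity : 0 < 2 * Real.pi)] with w hw using (hall w hw).le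
  obtain ⟨v, hv, hgv⟩ := hex
  have hZc : IsCompact (Icc Real.pi v ∩ g ⁻¹' Iic 0) :=
    isCompact_Icc.inter_right (isClosed_Iic.preimage hgc)
  obtain ⟨up, ⟨hup1, hup2⟩, hmin⟩ := hZc.exists_isLeast ⟨v, ⟨hv.1.le, le_rfl⟩, hgv⟩
  have hupπ : Real.pi < up := lt_of_le_of_ne hup1.1 fun heq => by
    rw [← heq] at hup2; exact absurd hgπ (not_lt.2 hup2)
  have hup2π : up < 2 * Real.pi := hup1.2.trans_lt hv.2
  have hmid : ∀ u ∈ Ico Real.pi up, 0 < g u := by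
    intro u hu
    by_contra! hle
    exact absurd (hmin ⟨⟨hu.1, hu.2.le.trans hup1.2⟩, hle⟩) (not_le.2 hu.2)
  have hinside : ∀ u ∈ Ioo 0 up, 0 < g u := fun u hu => by
    rcases lt_or_ge u Real.pi with h1 | h1
    · exact hin u ⟨hu.1, h1⟩
    · exact hmid u ⟨h1, hu.2⟩
  have hgup : g up = 0 := by
    refine le_antisymm hup2 (ge_of_tendsto (hgc.continuousAt.tendsto.mono_left
      nhdsWithin_le_nhds : Tendsto g (𝓝[<] up) _) ?_)
    filter_upwards [Ioo_mem_nhdsLT hupπ] with w hw using (hmid w ⟨hw.1.le, hw.2⟩).le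
  have hsin : ∀ w ∈ Ioo Real.pi (2 * Real.pi), Real.sin w < 0 := fun w hw => by
    have := Real.sin_pos_of_pos_of_lt_pi (x := w - Real.pi) (by linarith [hw.1]) (by linarith [hw.2])
    rw [Real.sin_sub_pi] at this
    linarith
  have hout : ∀ u ∈ Ioo up (2 * Real.pi), g u < 0 := by
    intro u hu
    obtain ⟨d, hd, hder⟩ := hR.exists_hasDerivAt_polRho h
      (hpos up ⟨by linarith, hup2π.le⟩) hup2
    have hd' : Real.sin up * d < 0 := mul_neg_of_neg_of_pos (hsin up ⟨hupπ, hup2π⟩) hd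
    have hev : ∀ᶠ z in 𝓝[>] up, slope g up z < 0 :=
      ((hasDerivAt_iff_tendsto_slope_left_right.1 hder).2).eventually (gt_mem_nhds hd')
    obtain ⟨z, hz1, hz2⟩ := (hev.and (Ioo_mem_nhdsGT hu.1)).exists
    have hgz : g z < 0 := by
      rw [slope_def_field, hgup, sub_zero, div_neg_iff] at hz1
      rcases hz1 with h1 | h1 <;> linarith [h1.1, h1.2, hz2.1]
    have := pos_of_deriv_pos_of_eq_zero (f := fun w => -g w) (a := z) (b := u)
      hgc.neg.continuousOn (by linarith) (fun w hw hgw => by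
        have hw1 : w ∈ Ioo Real.pi (2 * Real.pi) :=
          ⟨by linarith [hw.1, hz2.1], hw.2.trans_lt hu.2⟩
        obtain ⟨d, hd, hder⟩ := hR.exists_hasDerivAt_polRho h (u := w)
          (hpos w ⟨by linarith [hw1.1], hw1.2.le⟩) (by simp only [hg] at hgw; linarith)
        exact ⟨_, neg_pos.2 (mul_neg_of_neg_of_pos (hsin w hw1) hd), hder.neg⟩) u
      ⟨hz2.2.le, le_rfl⟩
    linarith
  refine ⟨R, up, hR, hR0, hpos, ⟨hupπ, hup2π⟩, hinside, hgup, fun u hu => ?_⟩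
  rcases lt_or_eq_of_le hu.2 with h1 | h1
  · exact hout u ⟨hu.1, h1⟩
  -- At `2π` itself `sin` vanishes, so negativity there is inherited from `m` by monotonicity of `ρ`
  -- on `[m, 2π]`.
  set m := (up + 2 * Real.pi) / 2
  have hm : m ∈ Ioo up (2 * Real.pi) := ⟨by simp only [m]; linarith, by simp only [m]; linarith⟩
  have hanti : AntitoneOn g (Icc m (2 * Real.pi)) := by
    refine antitoneOn_of_deriv_nonpos (convex_Icc _ _) hgc.continuousOn
      (fun w _ => (hR.hasDerivAt_polRho w).differentiableAt.differentiableWithinAt) fun w hw => ?_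
    rw [interior_Icc] at hw
    have hw1 : w ∈ Ioo up (2 * Real.pi) := ⟨hm.1.trans hw.1, hw.2⟩
    obtain ⟨d, hd, hder⟩ := hR.exists_hasDerivAt_polRho h (u := w)
      (hpos w ⟨by linarith [hw1.1], hw1.2.le⟩) (hout w hw1).le
    rw [hder.deriv]
    exact (mul_neg_of_neg_of_pos (hsin w ⟨hupπ.trans hw1.1, hw1.2⟩) hd).le
  have := hanti (left_mem_Icc.2 hm.2.le) (right_mem_Icc.2 hm.2.le) hm.2.le
  rw [h1]
  exact this.trans_lt (hout m hm)

lemma sin_neg_of_mem {u : ℝ} (hu : u ∈ Ioo Real.pi (2 * Real.pi)) : Real.sin u < 0 := by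
  have := Real.sin_pos_of_pos_of_lt_pi (x := u - Real.pi) (by linarith [hu.1]) (by linarith [hu.2])
  rw [Real.sin_sub_pi] at this
  linarith

/-- Near the saddle direction the slope decreases with the radius. -/
lemma slopeField_antitone {a ε u r₁ r₂ : ℝ} (h : Params a ε) (hu : u ∈ Ioo 0 (1 - ε))
    (hr₁ : 0 ≤ r₁) (hr : r₁ ≤ r₂) (hρ₁ : 0 ≤ polRho a ε u r₁) (hρ₂ : 0 ≤ polRho a ε u r₂) :
    slopeField a ε u r₂ ≤ slopeField a ε u r₁ := by
  have ha := h.a_pos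
  have he := h.eps_pos
  have he1 : 0 < 1 - ε := by linarith [h.eps_lt]
  have h1 := h.one_sub_sq_pos
  have hS : Real.sin u ≤ 1 - ε := (Real.sin_le hu.1.le).trans hu.2.le
  have hC : 0 ≤ Real.cos u := Real.cos_nonneg_of_neg_pi_div_two_le_of_le
    (by linarith [Real.pi_pos, hu.1]) (by linarith [Real.pi_gt_three, hu.2])
  set T₁ := √(polRho a ε u r₁) with hT₁
  set T₂ := √(polRho a ε u r₂) with hT₂
  have e1 : T₁ ^ 2 = polRho a ε u r₁ := Real.sq_sqrt hρ₁
  have e2 : T₂ ^ 2 = polRho a ε u r₂ := Real.sq_sqrt hρ₂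
  have b1 : T₁ ≤ a / (1 - ε) := (sqrt_polRho_le_kappa h hρ₁).trans (kappa_le h hr₁ hρ₁)
  have b2 : T₂ ≤ a / (1 - ε) := (sqrt_polRho_le_kappa h hρ₂).trans (kappa_le h (hr₁.trans hr) hρ₂)
  have hd : 0 ≤ r₂ - r₁ := by linarith
  have e3 : 2 * a * ε * Real.cos u * (r₂ - r₁) ≤ (T₁ - T₂) * (T₁ + T₂) := by
    have : (T₁ - T₂) * (T₁ + T₂) = (r₂ - r₁) * (2 * a * ε * Real.cos u + (1 - ε ^ 2) * (r₁ + r₂)) := by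
      have : (T₁ - T₂) * (T₁ + T₂) = T₁ ^ 2 - T₂ ^ 2 := by ring
      rw [this, e1, e2]; unfold polRho; ring
    rw [this]
    have : 0 ≤ (r₂ - r₁) * ((1 - ε ^ 2) * (r₁ + r₂)) :=
      mul_nonneg hd (mul_nonneg h1.le (by linarith))
    linarith
  have hT : T₂ ≤ T₁ := Real.sqrt_le_sqrt (by
    have := e3
    have h5 : 0 ≤ (T₁ - T₂) * (T₁ + T₂) := le_trans (by positivity) e3
    nlinarith)
  have e4 : (T₁ - T₂) * (T₁ + T₂) ≤ (T₁ - T₂) * (2 * (a / (1 - ε))) :=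
    mul_le_mul_of_nonneg_left (by linarith) (by linarith)
  -- The decrease of the square root, obtained by dividing the difference of the two values of `ρ`
  -- by the sum of the roots, which is at most `2a / (1 - ε)`.
  have e5 : ε * (1 - ε) * Real.cos u * (r₂ - r₁) ≤ T₁ - T₂ := by
    have h6 : 2 * a * ε * Real.cos u * (r₂ - r₁) ≤ (T₁ - T₂) * (2 * (a / (1 - ε))) := e3.trans e4
    rw [mul_div_assoc', mul_div_assoc', le_div_iff₀ he1] at h6
    have h7 : 2 * a * (ε * (1 - ε) * Real.cos u * (r₂ - r₁)) ≤ 2 * a * (T₁ - T₂) := by linarith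
    exact le_of_mul_le_mul_left h7 (by positivity)
  -- The other term of the slope increases with `r`, but at a rate proportional to `sin u`; the
  -- restriction `u < 1 - ε` makes it the smaller effect.
  have e6 : ε ^ 2 * Real.sin u * Real.cos u * (r₂ - r₁) ≤ ε * (1 - ε) * Real.cos u * (r₂ - r₁) := by
    have h8 : ε ^ 2 * Real.sin u ≤ ε * (1 - ε) := by
      have : ε * (ε * Real.sin u) ≤ ε * (1 - ε) := by
        refine mul_le_mul_of_nonneg_left ?_ he.le
        have h9 : 0 ≤ Real.sin u := Real.sin_nonneg_of_nonneg_of_le_pi hu.1.le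
          (by linarith [Real.pi_gt_three, hu.2])
        nlinarith [h.eps_lt]
      linarith
    gcongr
  unfold slopeField
  refine div_le_div_of_nonneg_right ?_ (h.den_pos u).le
  linarith

/-! ### Comparison of solutions with the separatrix -/

namespace IsSeparatrix

variable {a ε : ℝ} {R : ℝ → ℝ} {up : ℝ}

lemma polRho_nonneg_of_mem (hS : IsSeparatrix a ε R up) (h : Params a ε) {u : ℝ}
    (hu : u ∈ Icc 0 up) : 0 ≤ polRho a ε u (R u) := by
  rcases eq_or_lt_of_le hu.1 with h0 | h0
  · rw [← h0, hS.zero, polRho_saddle_self h]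
  rcases eq_or_lt_of_le hu.2 with h1 | h1
  · rw [h1, hS.exit]
  exact (hS.inside u ⟨h0, h1⟩).le

/-- On the two sides of the symmetry axis, the separatrix and its mirror image are ordered. -/
lemma lt_reflect (hS : IsSeparatrix a ε R up) (h : Params a ε) {w : ℝ} (hw : w ∈ Ioo 0 Real.pi) :
    R w < R (2 * Real.pi - w) := by
  have hπ := Real.pi_pos
  set f : ℝ → ℝ := fun v => R (Real.pi + v) - R (Real.pi - v) with hf
  have hder : ∀ v, HasDerivAt f (extSlope a ε (Real.pi + v) (R (Real.pi + v)) +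
      extSlope a ε (Real.pi - v) (R (Real.pi - v))) v := fun v =>
    (((hS.sol _).comp_const_add Real.pi v).sub ((hS.sol _).comp_const_sub Real.pi v)).congr_deriv
      (by ring)
  -- At a zero of `f` the two points are mirror images, the terms with `sin v` cancel, and the
  -- derivative is a positive multiple of `√ρ`. So `f` crosses zero only upwards, the first time at
  -- `v = 0`.
  have hz : ∀ v ∈ Ico 0 Real.pi, f v = 0 → ∃ f' > 0, HasDerivAt f f' v := by
    intro v hv hfv
    refine ⟨_, ?_, hder v⟩
    have heq : R (Real.pi + v) = R (Real.pi - v) := by simp only [hf] at hfv; linarith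
    have hm : Real.pi - v ∈ Ioo 0 up := ⟨by linarith [hv.2], by linarith [hv.1, hS.up_mem.1]⟩
    have hρ := hS.inside _ hm
    have hr := hS.pos (Real.pi - v) ⟨hm.1.le, by linarith [hv.1]⟩
    have hρ' : polRho a ε (Real.pi + v) (R (Real.pi - v)) =
        polRho a ε (Real.pi - v) (R (Real.pi - v)) := by
      simp [polRho, Real.cos_pi_sub, Real.cos_add]
    rw [heq, extSlope_eq h hr.le hρ.le, extSlope_eq h hr.le (by rw [hρ']; exact hρ.le), slopeField,
      slopeField, hρ']
    have hs : Real.sin (Real.pi + v) = -Real.sin v := by simp [Real.sin_add]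
    have hc : Real.cos (Real.pi + v) = -Real.cos v := by simp [Real.cos_add]
    rw [hs, hc, Real.sin_pi_sub, Real.cos_pi_sub, neg_sq, ← add_div]
    refine div_pos ?_ (h.den_pos v)
    have := Real.sqrt_pos.2 hρ
    linarith
  have hfc : Continuous f := continuous_iff_continuousAt.2 fun v => (hder v).continuousAt
  have hf0 : f 0 = 0 := by simp [hf]
  set v := Real.pi - w with hv
  have hvm : v ∈ Ioo 0 Real.pi := ⟨by linarith [hw.2], by linarith [hw.1]⟩
  obtain ⟨d, hd, hd0⟩ := hz 0 ⟨le_rfl, hπ⟩ hf0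
  have hev : ∀ᶠ z in 𝓝[>] (0 : ℝ), 0 < slope f 0 z :=
    ((hasDerivAt_iff_tendsto_slope_left_right.1 hd0).2).eventually (lt_mem_nhds hd)
  obtain ⟨z, hz1, hz2⟩ := (hev.and (Ioo_mem_nhdsGT hvm.1)).exists
  have hfz : 0 < f z := by
    rw [slope_def_field, hf0, sub_zero, sub_zero, div_pos_iff] at hz1
    rcases hz1 with h1 | h1 <;> linarith [h1.1, h1.2, hz2.1]
  have := pos_of_deriv_pos_of_eq_zero (f := f) (a := z) (b := v) hfc.continuousOn hfz
    (fun s hs => hz s ⟨by linarith [hs.1, hz2.1], by linarith [hs.2, hvm.2]⟩) v ⟨hz2.2.le, le_rfl⟩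
  simp only [hf, hv] at this
  rw [show Real.pi + (Real.pi - w) = 2 * Real.pi - w by ring,
    show Real.pi - (Real.pi - w) = w by ring] at this
  linarith

/-- Along the separatrix `t` vanishes linearly at the saddle. -/
lemma exists_sqrt_polRho_le (hS : IsSeparatrix a ε R up) (h : Params a ε) :
    ∃ C > 0, ∀ u ∈ Ioo 0 Real.pi, √(polRho a ε u (R u)) ≤ C * u := by
  have ha := h.a_pos
  have he := h.eps_pos
  have he1 : 0 < 1 - ε := by linarith [h.eps_lt]
  have hd := h.one_sub_sq_pos
  have hπ := Real.pi_pos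
  set K := ε * (a / (1 - ε)) / (1 - ε ^ 2) with hK
  have hK0 : 0 < K := by positivity
  have hmem : ∀ u ∈ Ioo 0 Real.pi, 0 < R u ∧ 0 < polRho a ε u (R u) := fun u hu =>
    ⟨hS.pos u ⟨hu.1.le, by linarith [hu.2]⟩, hS.inside u ⟨hu.1, hu.2.trans hS.up_mem.1⟩⟩
  have hsl : ∀ u ∈ Ioo 0 Real.pi, -(K * u) ≤ extSlope a ε u (R u) := by
    intro u hu
    obtain ⟨hr, hρ⟩ := hmem u hu
    have hs0 := Real.sin_pos_of_pos_of_lt_pi hu.1 hu.2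
    have hs1 := Real.sin_le hu.1.le
    have hκ := kappa_le h hr.le hρ.le
    have hκ0 : 0 < a - ε * R u * Real.cos u := lt_of_lt_of_le (by positivity) (half_le_kappa h hρ.le)
    rw [extSlope_eq h hr.le hρ.le, slopeField, sub_div]
    have h1 : 0 ≤ √(polRho a ε u (R u)) / (1 - ε ^ 2 * Real.sin u ^ 2) :=
      div_nonneg (Real.sqrt_nonneg _) (h.den_pos u).le
    have h2 : ε * Real.sin u * (a - ε * R u * Real.cos u) / (1 - ε ^ 2 * Real.sin u ^ 2) ≤ K * u := by
      have : K * u = (ε * u * (a / (1 - ε))) / (1 - ε ^ 2) := by rw [hK]; ring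
      rw [this]
      have hden : 1 - ε ^ 2 ≤ 1 - ε ^ 2 * Real.sin u ^ 2 := by
        nlinarith [Real.sin_sq_le_one u, sq_nonneg ε]
      have hu0 := hu.1
      gcongr
    linarith
  -- Integration of the slope bound `≥ -K u`: the separatrix drops at most quadratically. Together
  -- with `1 - cos u ≤ u² / 2` this gives `ρ = O(u²)`, and the constants are collected in `C2`.
  have hlow : ∀ u ∈ Ioo 0 Real.pi, a / (1 + ε) - K / 2 * u ^ 2 ≤ R u := by
    intro u hu
    have hder : ∀ w, HasDerivAt (fun w => R w + K / 2 * w ^ 2) (extSlope a ε w (R w) + K * w) w :=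
      fun w => ((hS.sol w).add (((hasDerivAt_id w).pow 2).const_mul (K / 2))).congr_deriv
        (by simp; ring)
    have hmono : MonotoneOn (fun w => R w + K / 2 * w ^ 2) (Icc 0 u) := by
      refine monotoneOn_of_deriv_nonneg (convex_Icc _ _)
        (fun w _ => (hder w).continuousAt.continuousWithinAt)
        (fun w _ => (hder w).differentiableAt.differentiableWithinAt) fun w hw => ?_
      rw [interior_Icc] at hw
      rw [(hder w).deriv]
      linarith [hsl w ⟨hw.1, hw.2.trans hu.2⟩]
    have := hmono (left_mem_Icc.2 hu.1.le) (right_mem_Icc.2 hu.1.le) hu.1.le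
    simp only [hS.zero] at this
    linarith
  set C2 := (1 + ε) * (K / 2) * (2 * (a / (1 - ε))) + a * ε * (a / (1 - ε)) with hC2
  have hC20 : 0 < C2 := by positivity
  refine ⟨√C2, Real.sqrt_pos.2 hC20, fun u hu => ?_⟩
  obtain ⟨hr, hρ⟩ := hmem u hu
  have hu0 := hu.1
  have hrle : R u ≤ a / (1 - ε) := by
    rw [le_div_iff₀ he1, mul_comm]; exact radius_le h hr.le hρ.le
  rw [Real.sqrt_le_left (by positivity), mul_pow, Real.sq_sqrt hC20.le]
  have hcos : 1 - u ^ 2 / 2 ≤ Real.cos u := Real.one_sub_sq_div_two_le_cos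
  have h1 : polRho a ε u (R u) ≤ (a - (1 + ε) * R u) * (a + (1 - ε) * R u) + a * ε * R u * u ^ 2 := by
    have : 0 ≤ 2 * a * ε * R u * (Real.cos u - (1 - u ^ 2 / 2)) :=
      mul_nonneg (by positivity) (by linarith)
    unfold polRho
    nlinarith
  have h2 : a - (1 + ε) * R u ≤ (1 + ε) * (K / 2) * u ^ 2 := by
    have h3 := mul_le_mul_of_nonneg_left (hlow u hu) (by positivity : 0 ≤ 1 + ε)
    have h4 : (1 + ε) * (a / (1 + ε) - K / 2 * u ^ 2) = a - (1 + ε) * (K / 2) * u ^ 2 := by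
      field_simp
    linarith
  have h3 : a + (1 - ε) * R u ≤ 2 * (a / (1 - ε)) := by
    have : a ≤ a / (1 - ε) := by rw [le_div_iff₀ he1]; nlinarith
    nlinarith
  have h4 : (a - (1 + ε) * R u) * (a + (1 - ε) * R u) ≤
      (1 + ε) * (K / 2) * u ^ 2 * (2 * (a / (1 - ε))) :=
    (mul_le_mul_of_nonneg_right h2 (by positivity)).trans
      (mul_le_mul_of_nonneg_left h3 (by positivity))
  have h5 : a * ε * R u * u ^ 2 ≤ a * ε * (a / (1 - ε)) * u ^ 2 := by gcongr
  rw [hC2]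
  linarith

/-- One turn: a solution starting below the separatrix inside the ergoregion stays so as the angle
decreases, as long as it is positive. -/
lemma below (hS : IsSeparatrix a ε R up) (h : Params a ε) {x : ℝ → ℝ} (hx : IsSol a ε x)
    {m us : ℝ} (hm : 0 ≤ m) (hus : us ∈ Ioc 0 (2 * Real.pi))
    (hpos : ∀ u ∈ Icc m us, 0 < x u) (hρ : 0 < polRho a ε us (x us)) (hlt : x us < R us) :
    ∀ u ∈ Icc m us, 0 < polRho a ε u (x u) := by
  have hπ := Real.pi_pos
  have hgc := hx.continuous_polRho
  have hxc := hx.continuous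
  have hRc := hS.sol.continuous
  -- For decreasing `u` in `(π, 2π)` the function `ρ` would increase wherever it is nonpositive, so
  -- a solution starting inside stays inside.
  have hA : ∀ u ∈ Icc m us, Real.pi < u → 0 < polRho a ε u (x u) := by
    intro u hu hπu
    rcases eq_or_lt_of_le hu.2 with h1 | h1
    · rw [h1]; exact hρ
    · refine pos_of_deriv_neg_of_nonpos (f := fun u => polRho a ε u (x u)) (a := u) (b := us)
        hgc.continuousOn hρ.le (fun w hw hgw => ?_) u ⟨le_rfl, h1⟩
      obtain ⟨d, hd, hder⟩ := hx.exists_hasDerivAt_polRho h (hpos w ⟨hu.1.trans hw.1, hw.2.le⟩) hgw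
      exact ⟨_, mul_neg_of_neg_of_pos (sin_neg_of_mem ⟨hπu.trans_le hw.1, hw.2.trans_le hus.2⟩) hd,
        hder⟩
  -- At the contact with `R` nearest to `us` the point lies before `up`, because `R` is not inside
  -- from there on. Interior uniqueness then extends the contact to the right, which is absurd.
  have hB : ∀ u ∈ Icc m us, 0 < u → x u < R u := by
    intro u hu hu0
    by_contra! hle
    have hZc : IsCompact (Icc u us ∩ (fun w => R w - x w) ⁻¹' Iic 0) :=
      isCompact_Icc.inter_right (isClosed_Iic.preimage (by fun_prop))
    obtain ⟨c, ⟨hc1, hc2⟩, hmax⟩ := hZc.exists_isGreatest ⟨u, ⟨le_rfl, hu.2⟩, by simpa using hle⟩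
    have hc2 : R c ≤ x c := by simpa using hc2
    have hcus : c < us := lt_of_le_of_ne hc1.2 fun heq => by
      rw [heq] at hc2; linarith
    have hright : ∀ w ∈ Ioc c us, x w < R w := by
      intro w hw
      by_contra! hle'
      exact absurd (hmax ⟨⟨hc1.1.trans hw.1.le, hw.2⟩, by simpa using hle'⟩) (not_le.2 hw.1)
    have hceq : x c = R c := by
      refine le_antisymm ?_ hc2
      refine le_of_tendsto_of_tendsto (hxc.continuousAt.tendsto.mono_left nhdsWithin_le_nhds)
        (hRc.continuousAt.tendsto.mono_left nhdsWithin_le_nhds : Tendsto R (𝓝[>] c) _) ?_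
      filter_upwards [Ioo_mem_nhdsGT hcus] with w hw using (hright w ⟨hw.1, hw.2.le⟩).le
    have hcm : c ∈ Icc m us := ⟨hu.1.trans hc1.1, hc1.2⟩
    have hc0 : 0 < c := hu0.trans_le hc1.1
    have hcup : c < up := by
      by_contra! hge
      have h1 := hA c hcm (hS.up_mem.1.trans_le hge)
      rw [hceq] at h1
      rcases eq_or_lt_of_le hge with h2 | h2
      · rw [← h2, hS.exit] at h1; exact lt_irrefl _ h1
      · exact absurd h1 (not_lt.2 (hS.outside c ⟨h2, hc1.2.trans hus.2⟩).le)
    have hev := hx.eventually_eq h hS.sol hceq (hpos c hcm) (by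
      rw [hceq]; exact hS.inside c ⟨hc0, hcup⟩)
    obtain ⟨w, hw1, hw2⟩ := ((hev.filter_mono nhdsWithin_le_nhds).and
      (Ioo_mem_nhdsGT hcus : Ioo c us ∈ 𝓝[>] c)).exists
    have := hright w ⟨hw2.1, hw2.2.le⟩
    linarith
  have hC : ∀ u ∈ Icc m us, 0 < u → 0 < polRho a ε u (x u) := by
    intro u hu hu0
    rcases le_or_gt u Real.pi with h1 | h1
    · exact polRho_pos_of_lt h (hpos u hu).le (hB u hu hu0)
        (hS.inside u ⟨hu0, h1.trans_lt hS.up_mem.1⟩).le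
    · exact hA u hu h1
  intro u hu
  rcases eq_or_lt_of_le (hm.trans hu.1) with h0 | h0
  swap
  · exact hC u hu h0
  subst h0
  have hm0 : m = 0 := le_antisymm hu.1 hm
  subst hm0
  rw [polRho_saddle_pos_iff h (hpos 0 hu).le, ← hS.zero]
  by_contra! hle
  have he1 : 0 < 1 - ε := by linarith [h.eps_lt]
  set c := min us (1 - ε) with hc
  have hc0 : 0 < c := lt_min hus.1 he1
  have hcus : c ≤ us := min_le_left _ _
  have hcπ : c < up := (min_le_right us (1 - ε)).trans_lt
    (by linarith [Real.pi_gt_three, hS.up_mem.1, h.eps_pos])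
  -- Only `u = 0` is left, where uniqueness fails. By `slopeField_antitone` the gap `R - x` can only
  -- widen as `u` tends to `0`, so it remains positive at the saddle.
  have hanti : AntitoneOn (fun w => R w - x w) (Icc 0 c) := by
    refine antitoneOn_of_deriv_nonpos (convex_Icc _ _) (by fun_prop)
      (fun w _ => ((hS.sol w).sub (hx w)).differentiableAt.differentiableWithinAt) fun w hw => ?_
    rw [interior_Icc] at hw
    have hwm : w ∈ Icc 0 us := ⟨hw.1.le, hw.2.le.trans hcus⟩
    have hρR := (hS.inside w ⟨hw.1, hw.2.trans hcπ⟩).le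
    have hρx := (hC w hwm hw.1).le
    have hlt' := hB w hwm hw.1
    have hdd : deriv (fun w => R w - x w) w = extSlope a ε w (R w) - extSlope a ε w (x w) :=
      ((hS.sol w).sub (hx w)).deriv
    rw [hdd, extSlope_eq h ((hpos w hwm).le.trans hlt'.le) hρR,
      extSlope_eq h (hpos w hwm).le hρx, sub_nonpos]
    exact slopeField_antitone h ⟨hw.1, hw.2.trans_le (min_le_right _ _)⟩ (hpos w hwm).le hlt'.le
      hρx hρR
  have h1 := hanti (left_mem_Icc.2 hc0.le) (right_mem_Icc.2 hc0.le) hc0.le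
  have h2 := hB c ⟨hc0.le, hcus⟩ hc0
  simp only at h1
  linarith

/-- The same over any number of turns. -/
lemma inside_of_pos (hS : IsSeparatrix a ε R up) (h : Params a ε) {x : ℝ → ℝ} (hx : IsSol a ε x)
    {u₀ : ℝ} (hu₀ : u₀ ∈ Ioc 0 (2 * Real.pi)) (hρ : 0 < polRho a ε u₀ (x u₀)) (hlt : x u₀ < R u₀)
    (k : ℕ) : ∀ m, -(k * (2 * Real.pi)) ≤ m → (∀ u ∈ Icc m u₀, 0 < x u) →
      ∀ u ∈ Icc m u₀, 0 < polRho a ε u (x u) := by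
  have hπ := Real.pi_pos
  induction k with
  | zero =>
    intro m hm hpos
    exact hS.below h hx (by simpa using hm) hu₀ hpos hρ hlt
  | succ k ih =>
    intro m hm hpos u hu
    rcases le_or_gt (-(k * (2 * Real.pi))) u with h1 | h1
    · exact ih u h1 (fun w hw => hpos w ⟨hu.1.trans hw.1, hw.2⟩) u ⟨le_rfl, hu.2⟩
    set b : ℝ := -(k * (2 * Real.pi)) with hb
    have hb0 : b ≤ 0 := by simp only [hb, Left.neg_nonpos_iff]; positivity
    have hbu : b ≤ u₀ := hb0.trans hu₀.1.le
    have hρb : 0 < polRho a ε b (x b) :=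
      ih b le_rfl (fun w hw => hpos w ⟨by linarith [hu.1, hw.1], hw.2⟩) b ⟨le_rfl, hbu⟩
    have hxb : 0 < x b := hpos b ⟨by linarith [hu.1], hbu⟩
    set s : ℤ := -(k + 1 : ℤ) with hs
    have e1 : 2 * Real.pi + s * (2 * Real.pi) = b := by simp [hs, hb]; ring
    have hρ0 : ∀ r, polRho a ε b r = polRho a ε (2 * Real.pi) r := fun r => by
      rw [← e1, polRho_add_int]
    have hy := hx.shift s
    have hcast : (s : ℝ) * (2 * Real.pi) = -((k + 1 : ℕ) * (2 * Real.pi)) := by simp [hs]; ring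
    -- The next turn is moved back to `[0, 2π]`. Being inside at `2π` means `r < a / (1 + ε)`, while
    -- `R (2π)` is outside and hence larger, so the solution starts the turn below `R` again.
    have := hS.below h hy (m := u - s * (2 * Real.pi)) (us := 2 * Real.pi)
      (by rw [hcast]; linarith [hu.1]) ⟨by positivity, le_rfl⟩
      (fun w hw => hpos _ ⟨by linarith [hw.1, hu.1], by linarith [hw.2, e1]⟩)
      (by simp only [e1]; rw [← hρ0]; exact hρb)
      (by
        simp only [e1]
        rw [hρ0, polRho_two_pi, polRho_saddle_pos_iff h hxb.le] at hρb
        refine hρb.trans ((polRho_saddle_neg_iff h (hS.pos _ ⟨by positivity, le_rfl⟩).le).1 ?_)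
        rw [← polRho_two_pi]
        exact hS.outside _ ⟨hS.up_mem.2, le_rfl⟩)
      (u - s * (2 * Real.pi)) ⟨le_rfl, by linarith [e1]⟩
    rw [← polRho_add_int a ε _ _ s] at this
    simpa using this

/-- Solutions starting below the separatrix reach `r = 0`. -/
lemma exists_nonpos (hS : IsSeparatrix a ε R up) (h : Params a ε) {x : ℝ → ℝ} (hx : IsSol a ε x)
    {u₀ : ℝ} (hu₀ : u₀ ∈ Ioc 0 (2 * Real.pi)) (hρ : 0 < polRho a ε u₀ (x u₀)) (hlt : x u₀ < R u₀) :
    ∃ u ≤ u₀, x u ≤ 0 := by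
  by_contra! hpos
  have ha := h.a_pos
  have he := h.eps_pos
  have he1 : 0 < 1 - ε := by linarith [h.eps_lt]
  have hd := h.one_sub_sq_pos
  have hπ := Real.pi_pos
  have hin : ∀ u ≤ u₀, 0 < polRho a ε u (x u) := by
    intro u hu
    obtain ⟨k, hk⟩ := exists_nat_ge (-u / (2 * Real.pi))
    rw [div_le_iff₀ (by positivity)] at hk
    exact hS.inside_of_pos h hx hu₀ hρ hlt k u (by linarith) (fun w hw => hpos w hw.2) u ⟨le_rfl, hu⟩
  obtain ⟨w₀, hw₀, hmin⟩ := isCompact_Icc.exists_isMinOn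
    (nonempty_Icc.2 (by linarith : u₀ - 2 * Real.pi ≤ u₀)) hx.continuous_polRho.continuousOn
  -- The minimum of `ρ` over one turn, capped by its value at `r = 0`, is a lower bound on all
  -- earlier turns.
  set δ := min (a ^ 2) (polRho a ε w₀ (x w₀)) with hδ
  have hδ0 : 0 < δ := lt_min (by positivity) (hin w₀ hw₀.2)
  have hlow : ∀ u ≤ u₀, δ ≤ polRho a ε u (x u) := by
    intro u hu
    obtain ⟨n, hn⟩ : ∃ n : ℕ, u + n * (2 * Real.pi) ∈ Icc (u₀ - 2 * Real.pi) u₀ := by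
      refine ⟨⌊(u₀ - u) / (2 * Real.pi)⌋₊, ?_, ?_⟩
      · have := Nat.lt_floor_add_one ((u₀ - u) / (2 * Real.pi))
        rw [div_lt_iff₀ (by positivity)] at this
        linarith
      · have := Nat.floor_le (div_nonneg (by linarith : 0 ≤ u₀ - u) (by positivity : 0 ≤ 2 * Real.pi))
        rw [le_div_iff₀ (by positivity)] at this
        linarith
    set v := u + n * (2 * Real.pi) with hv
    have hρv : ∀ r, polRho a ε v r = polRho a ε u r := fun r => by
      have := polRho_add_int a ε u r n
      rwa [Int.cast_natCast] at this
    have hδv : δ ≤ polRho a ε u (x v) := by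
      rw [← hρv]; exact (min_le_right _ _).trans (isMinOn_iff.1 hmin v hn)
    rcases Nat.eq_zero_or_pos n with h0 | h0
    · have : v = u := by rw [hv, h0]; simp
      rwa [this] at hδv
    have huv : u < v := by rw [hv]; have : (0 : ℝ) < n := by exact_mod_cast h0
                           have := mul_pos this (by positivity : 0 < 2 * Real.pi); linarith
    have hl := hx.lyap_strictMonoOn h (b := u) (c := v) (fun w hw => hpos w (hw.2.le.trans hn.2))
      (fun w hw => hin w (hw.2.le.trans hn.2)) (left_mem_Icc.2 huv.le) (right_mem_Icc.2 huv.le) huv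
    have hl' : lyap a ε u (x u) < lyap a ε u (x v) := by
      simpa [lyap, hv, Real.cos_add_nat_mul_two_pi] using hl
    have hxlt := lt_of_lyap_lt h (hpos u hu).le (hin u hu).le hl'
    have hxu := hpos u hu
    have hxv := hpos v hn.2
    -- The monotone quantity gives a smaller radius on the earlier turn at the same direction, and
    -- concavity bounds `ρ` there by a weighted mean of `a²` and its value on the later turn.
    refine le_of_mul_le_mul_left (?_ : x v * δ ≤ x v * polRho a ε u (x u)) hxv
    rw [polRho_concave a ε u (x u) (x v)]
    have h1 : (x v - x u) * δ ≤ (x v - x u) * a ^ 2 :=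
      mul_le_mul_of_nonneg_left (min_le_left _ _) (by linarith)
    have h2 : x u * δ ≤ x u * polRho a ε u (x v) := mul_le_mul_of_nonneg_left hδv hxu.le
    have h3 : 0 ≤ (1 - ε ^ 2) * (x u * x v * (x v - x u)) :=
      mul_nonneg hd.le (mul_nonneg (by positivity) (by linarith))
    linarith
  set c := Real.exp (-(1 / 2)) * (√δ * ((1 - ε) * (a / 2)) / a) with hc
  have hc0 : 0 < c := by have := Real.sqrt_pos.2 hδ0; positivity
  have hder : ∀ u ≤ u₀, ∃ d, c ≤ d ∧ HasDerivAt (fun u => lyap a ε u (x u)) d u := by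
    intro u hu
    refine ⟨_, ?_, hx.hasDerivAt_lyap h (hpos u hu) (hin u hu).le⟩
    have h1 := (kappa_sub_pos h (hin u hu).le).1
    have h2 : √δ ≤ √(polRho a ε u (x u)) := Real.sqrt_le_sqrt (hlow u hu)
    have h3 := half_le_kappa h (hin u hu).le
    have h4 : -(1 / 2) ≤ -(ε * x u * Real.cos u) / a := by
      rw [le_div_iff₀ ha]; linarith
    have h5 : a * (1 - ε ^ 2 * Real.sin u ^ 2) ≤ a := by
      have : 0 ≤ ε ^ 2 * Real.sin u ^ 2 := by positivity
      nlinarith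
    have h6 : 0 < a * (1 - ε ^ 2 * Real.sin u ^ 2) := mul_pos ha (h.den_pos u)
    have h7 := Real.sqrt_nonneg (polRho a ε u (x u))
    have h8 : 0 ≤ (1 - ε) * (a / 2) := by positivity
    have h9 := mul_nonneg h7 (h8.trans h1)
    rw [hc]
    gcongr
  set M := lyap a ε u₀ (x u₀)
  have hM0 : 0 < M := mul_pos (hpos u₀ le_rfl) (Real.exp_pos _)
  have hmono : MonotoneOn (fun u => lyap a ε u (x u) - c * u) (Iic u₀) := by
    have hd' : ∀ u ≤ u₀, ∃ d, 0 ≤ d ∧ HasDerivAt (fun u => lyap a ε u (x u) - c * u) d u := by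
      intro u hu
      obtain ⟨d, hd1, hd2⟩ := hder u hu
      exact ⟨d - c * 1, by linarith, hd2.sub ((hasDerivAt_id u).const_mul c)⟩
    refine monotoneOn_of_deriv_nonneg (convex_Iic _)
      (fun u hu => (hd' u hu).choose_spec.2.continuousAt.continuousWithinAt)
      (fun u hu => (hd' u (mem_Iic.1 (interior_subset hu))).choose_spec.2.differentiableAt.differentiableWithinAt)
      fun u hu => ?_
    obtain ⟨d, h1, h2⟩ := hd' u (mem_Iic.1 (interior_subset hu))
    rw [h2.deriv]; exact h1
  -- The monotone quantity has derivative at least `c`, so after an angle `M / c` its initial value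
  -- `M` is used up while it ought to be positive.
  have hw : u₀ - M / c ≤ u₀ := by have := div_pos hM0 hc0; linarith
  have h1 := hmono (mem_Iic.2 hw) (mem_Iic.2 le_rfl) hw
  have h2 : 0 < lyap a ε (u₀ - M / c) (x (u₀ - M / c)) := mul_pos (hpos _ hw) (Real.exp_pos _)
  have h3 : c * (M / c) = M := mul_div_cancel₀ _ hc0.ne'
  simp only [mul_sub, h3] at h1
  linarith

/-- Through every point below the separatrix passes a solution that reaches `r = 0` inside the
ergoregion as the angle decreases. -/
lemma exists_solution_to_zero (hS : IsSeparatrix a ε R up) (h : Params a ε) {u₀ r₀ : ℝ}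
    (hu₀ : u₀ ∈ Ioc 0 (2 * Real.pi)) (hr₀ : 0 < r₀) (hρ : 0 < polRho a ε u₀ r₀) (hlt : r₀ < R u₀) :
    ∃ (x : ℝ → ℝ) (α β : ℝ), IsSol a ε x ∧ u₀ ∈ Ioo α β ∧ x u₀ = r₀ ∧ x α = 0 ∧
      ∀ u ∈ Ioo α β, 0 < x u ∧ 0 < polRho a ε u (x u) := by
  have hπ := Real.pi_pos
  obtain ⟨x, hx0, hx⟩ := exists_isSol h u₀ r₀
  have hxc := hx.continuous
  subst hx0
  obtain ⟨v, hv, hxv⟩ := hS.exists_nonpos h hx hu₀ hρ hlt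
  have hZc : IsCompact (Icc v u₀ ∩ x ⁻¹' Iic 0) :=
    isCompact_Icc.inter_right (isClosed_Iic.preimage hxc)
  obtain ⟨α, ⟨hα1, hα2⟩, hmax⟩ := hZc.exists_isGreatest ⟨v, ⟨le_rfl, hv⟩, hxv⟩
  have hα2 : x α ≤ 0 := hα2
  have hαu : α < u₀ := lt_of_le_of_ne hα1.2 fun heq => by rw [heq] at hα2; linarith
  have hpos : ∀ u ∈ Ioc α u₀, 0 < x u := by
    intro u hu
    by_contra! hle
    exact absurd (hmax ⟨⟨hα1.1.trans hu.1.le, hu.2⟩, hle⟩) (not_le.2 hu.1)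
  have hxα : x α = 0 := by
    refine le_antisymm hα2 (ge_of_tendsto (hxc.continuousAt.tendsto.mono_left nhdsWithin_le_nhds :
      Tendsto x (𝓝[>] α) _) ?_)
    filter_upwards [Ioo_mem_nhdsGT hαu] with w hw using (hpos w ⟨hw.1, hw.2.le⟩).le
  have hin : ∀ u ∈ Ioc α u₀, 0 < polRho a ε u (x u) := by
    intro u hu
    obtain ⟨k, hk⟩ := exists_nat_ge (-u / (2 * Real.pi))
    rw [div_le_iff₀ (by positivity)] at hk
    exact hS.inside_of_pos h hx hu₀ hρ hlt k u (by linarith)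
      (fun w hw => hpos w ⟨hu.1.trans_le hw.1, hw.2⟩) u ⟨le_rfl, hu.2⟩
  have hev : ∀ᶠ u in 𝓝[>] u₀, 0 < x u ∧ 0 < polRho a ε u (x u) :=
    ((hxc.continuousAt.eventually (lt_mem_nhds hr₀)).and
      (hx.continuous_polRho.continuousAt.eventually (lt_mem_nhds hρ))).filter_mono nhdsWithin_le_nhds
  obtain ⟨β, hβ, hsub⟩ := mem_nhdsGT_iff_exists_Ioo_subset.1 hev
  refine ⟨x, α, β, hx, ⟨hαu, hβ⟩, rfl, hxα, fun u hu => ?_⟩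
  rcases le_or_gt u u₀ with h1 | h1
  · exact ⟨hpos u ⟨hu.1, h1⟩, hin u ⟨hu.1, h1⟩⟩
  · exact hsub ⟨h1, hu.2⟩

end IsSeparatrix

/-! ### Polar coordinates adapted to a family -/

/-- The point at distance `r` and at (oriented) angle `u` from the positive `x₂`-axis. -/
def pt (σ r u : ℝ) : Plane := !₂[-(σ * r * Real.sin u), r * Real.cos u]

@[simp] lemma pt_fst (σ r u : ℝ) : pt σ r u 0 = -(σ * r * Real.sin u) := by simp [pt]

@[simp] lemma pt_snd (σ r u : ℝ) : pt σ r u 1 = r * Real.cos u := by simp [pt]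

lemma pt_normSq {σ : ℝ} (hσ : σ ^ 2 = 1) (r u : ℝ) :
    (pt σ r u 0) ^ 2 + (pt σ r u 1) ^ 2 = r ^ 2 := by
  simp only [pt_fst, pt_snd]
  linear_combination (r ^ 2 * Real.sin u ^ 2) * hσ + r ^ 2 * Real.sin_sq_add_cos_sq u

lemma norm_pt {σ r : ℝ} (hσ : σ ^ 2 = 1) (hr : 0 ≤ r) (u : ℝ) : ‖pt σ r u‖ = r := by
  rw [← abs_of_nonneg hr, ← abs_norm, ← sq_eq_sq_iff_abs_eq_abs, normSq_eq, pt_normSq hσ, sq_abs]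

lemma pt_ne_zero {σ r : ℝ} (hσ : σ ^ 2 = 1) (hr : 0 < r) (u : ℝ) : pt σ r u ≠ 0 := by
  rw [← norm_pos_iff, norm_pt hσ hr.le]; exact hr

lemma rho_pt {σ : ℝ} (hσ : σ ^ 2 = 1) (a ε r u : ℝ) : rho a ε (pt σ r u) = polRho a ε u r := by
  rw [rho, pt_normSq hσ, pt_snd, polRho]; ring

lemma polar_eq_pt {σ : ℝ} (hσ : σ = 1 ∨ σ = -1) (r u : ℝ) :
    polar r (Real.pi / 2 + σ * u) = pt σ r u := by
  refine plane_ext ?_ ?_ <;> rcases hσ with rfl | rfl <;>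
    simp [polar, Real.cos_add, Real.sin_add]

lemma pt_add_int (σ r u : ℝ) (k : ℤ) : pt σ r (u + k * (2 * Real.pi)) = pt σ r u := by
  simp [pt, Real.sin_add_int_mul_two_pi, Real.cos_add_int_mul_two_pi]

lemma continuous_pt (σ : ℝ) : Continuous fun p : ℝ × ℝ => pt σ p.1 p.2 := by
  unfold pt; fun_prop

/-- The complex number whose argument is the angle from the negative `x₂`-axis. -/
def toC (σ : ℝ) : Plane →L[ℝ] ℂ :=
  (-(EuclideanSpace.proj 1 : Plane →L[ℝ] ℝ)).smulRight (1 : ℂ) +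
    (σ • (EuclideanSpace.proj 0 : Plane →L[ℝ] ℝ)).smulRight Complex.I

@[simp] lemma toC_re (σ : ℝ) (x : Plane) : (toC σ x).re = -x 1 := by simp [toC]

@[simp] lemma toC_im (σ : ℝ) (x : Plane) : (toC σ x).im = σ * x 0 := by simp [toC]

/-- The angle `u ∈ (0, 2π]`. -/
def ang (σ : ℝ) (x : Plane) : ℝ := Real.pi + Complex.arg (toC σ x)

lemma ang_mem (σ : ℝ) (x : Plane) : ang σ x ∈ Ioc 0 (2 * Real.pi) := by
  have := Complex.arg_mem_Ioc (toC σ x)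
  exact ⟨by rw [ang]; linarith [this.1], by rw [ang]; linarith [this.2]⟩

lemma norm_toC {σ : ℝ} (hσ : σ ^ 2 = 1) (x : Plane) : ‖toC σ x‖ = ‖x‖ := by
  rw [← abs_norm, ← abs_norm x, ← sq_eq_sq_iff_abs_eq_abs, normSq_eq, Complex.sq_norm,
    Complex.normSq_apply, toC_re, toC_im]
  linear_combination (x 0 ^ 2) * hσ

lemma pt_ang {σ : ℝ} (hσ : σ ^ 2 = 1) (x : Plane) : pt σ ‖x‖ (ang σ x) = x := by
  have h1 := Complex.norm_mul_cos_arg (toC σ x)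
  have h2 := Complex.norm_mul_sin_arg (toC σ x)
  rw [norm_toC hσ, toC_re] at h1
  rw [norm_toC hσ, toC_im] at h2
  refine plane_ext ?_ ?_
  · rw [pt_fst, ang, add_comm, Real.sin_add_pi]
    linear_combination σ * h2 + x 0 * hσ
  · rw [pt_snd, ang, add_comm, Real.cos_add_pi]
    linear_combination -h1

lemma toC_pt {σ : ℝ} (hσ : σ ^ 2 = 1) (r u : ℝ) : toC σ (pt σ r u) =
    (r : ℂ) * (Complex.cos ((u - Real.pi : ℝ) : ℂ) + Complex.sin ((u - Real.pi : ℝ) : ℂ) * Complex.I) := by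
  rw [← Complex.ofReal_cos, ← Complex.ofReal_sin, Real.cos_sub_pi, Real.sin_sub_pi]
  apply Complex.ext
  · simp [-Complex.ofReal_cos, -Complex.ofReal_sin]
  · simp [-Complex.ofReal_cos, -Complex.ofReal_sin]
    linear_combination (r * Real.sin u) * hσ

lemma ang_pt {σ r u : ℝ} (hσ : σ ^ 2 = 1) (hr : 0 < r) (hu : u ∈ Ioc 0 (2 * Real.pi)) :
    ang σ (pt σ r u) = u := by
  rw [ang, toC_pt hσ, Complex.arg_mul_cos_add_sin_mul_I hr
    ⟨by linarith [hu.1], by linarith [hu.2]⟩]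
  ring

lemma hasGradientAt_arg_toC {σ : ℝ} (hσ : σ ^ 2 = 1) {x : Plane} (hx : toC σ x ∈ Complex.slitPlane) :
    HasGradientAt (fun y => Complex.arg (toC σ y)) ((σ / (x 0 ^ 2 + x 1 ^ 2)) • rot x) x := by
  have h1 := (((Complex.hasStrictDerivAt_log hx).hasStrictFDerivAt.restrictScalars ℝ).hasFDerivAt).comp
    x (toC σ).hasFDerivAt
  have h2 := Complex.imCLM.hasFDerivAt.comp x h1
  have e : (fun y => Complex.arg (toC σ y)) = Complex.imCLM ∘ Complex.log ∘ (toC σ) := by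
    funext y; simp [Complex.log_im]
  rw [e]
  refine hasGradientAt_of_hasFDerivAt h2 fun y => ?_
  have hn : Complex.normSq (toC σ x) = x 0 ^ 2 + x 1 ^ 2 := by
    rw [Complex.normSq_apply, toC_re, toC_im]; linear_combination (x 0 ^ 2) * hσ
  have hpos : 0 < x 0 ^ 2 + x 1 ^ 2 := by
    rw [← hn]; exact Complex.normSq_pos.2 (Complex.slitPlane_ne_zero hx)
  simp [rot, hn, Complex.inv_re, Complex.inv_im]
  field_simp
  ring

lemma hasGradientAt_ang {σ : ℝ} (hσ : σ ^ 2 = 1) {x : Plane} (hx : toC σ x ∈ Complex.slitPlane) :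
    HasGradientAt (ang σ) ((σ / (x 0 ^ 2 + x 1 ^ 2)) • rot x) x := by
  refine hasGradientAt_of_hasFDerivAt
    ((hasFDerivAt_inner_of_hasGradientAt (hasGradientAt_arg_toC hσ hx)).const_add Real.pi) fun y => ?_
  simp [inner_eq]
  ring

lemma hasGradientAt_norm {x : Plane} (hx : x ≠ 0) :
    HasGradientAt (fun y : Plane => ‖y‖) (‖x‖⁻¹ • x) x := by
  have hn := normSq_pos hx
  have hr := norm_pos_iff.2 hx
  have h1 : HasFDerivAt (fun y : Plane => ‖y‖ ^ 2) (2 • innerSL ℝ x) x :=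
    (hasStrictFDerivAt_norm_sq x).hasFDerivAt
  have h2 := h1.sqrt (by positivity)
  have e : (fun y : Plane => ‖y‖) = fun y : Plane => √(‖y‖ ^ 2) := by
    funext y; rw [Real.sqrt_sq (norm_nonneg y)]
  rw [e]
  refine hasGradientAt_of_hasFDerivAt h2 fun y => ?_
  simp [inner_eq, Real.sqrt_sq hr.le]
  field_simp

/-- The cut of `ang` is the closed half-axis from `O` through the saddle; near the corner direction
`ang` is smooth. -/
lemma toC_mem_slitPlane_iff {σ : ℝ} (hσ : σ ^ 2 = 1) (x : Plane) :
    toC σ x ∈ Complex.slitPlane ↔ x 1 < 0 ∨ x 0 ≠ 0 := by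
  have : σ ≠ 0 := by rintro rfl; norm_num at hσ
  rw [Complex.mem_slitPlane_iff, toC_re, toC_im]
  simp [this]

lemma hasDerivAt_plane {f : ℝ → Plane} {f' : Plane} {s : ℝ}
    (h0 : HasDerivAt (fun s => f s 0) (f' 0) s) (h1 : HasDerivAt (fun s => f s 1) (f' 1) s) :
    HasDerivAt f f' s := by
  have h : HasDerivAt (fun s i => f s i) (fun i => f' i) s :=
    hasDerivAt_pi.2 fun i => by fin_cases i <;> assumption
  exact (PiLp.continuousLinearEquiv 2 ℝ (fun _ : Fin 2 => ℝ)).symm.hasFDerivAt.comp_hasDerivAt s h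

lemma hasDerivAt_of_hasGradientAt {f : Plane → ℝ} {g : Plane} {γ : ℝ → Plane} {w : Plane} {s : ℝ}
    (hf : HasGradientAt f g (γ s)) (hγ : HasDerivAt γ w s) :
    HasDerivAt (fun s => f (γ s)) (g 0 * w 0 + g 1 * w 1) s := by
  have := (hasFDerivAt_inner_of_hasGradientAt hf).comp_hasDerivAt s hγ
  rwa [innerSL_apply_apply, inner_eq] at this

/-! ### Trajectories and the scalar equation -/

/-- The angular speed `du/dx₀` of the trajectories. -/
def angSpeed (a ε u r : ℝ) : ℝ :=
  -(√(polRho a ε u r) * ((a - ε * r * Real.cos u) + ε * Real.sin u * √(polRho a ε u r))) /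
    (r * (r ^ 2 + polRho a ε u r))

/-- The bracket in the numerator is positive because `√ρ ≤ a - ε r cos u` and `ε < 1`. Thus time
runs against `u`, and the future of a point is found by letting `u` decrease. -/
lemma angSpeed_neg {a ε u r : ℝ} (h : Params a ε) (hr : 0 < r) (hρ : 0 < polRho a ε u r) :
    angSpeed a ε u r < 0 := by
  have h1 := (kappa_sub_pos h hρ.le).2
  have h2 : 0 < (1 - ε) * (a / 2) := mul_pos (by linarith [h.eps_lt]) (by linarith [h.a_pos])
  have h3 := Real.sqrt_pos.2 hρ
  refine div_neg_of_neg_of_pos (neg_neg_of_pos (mul_pos h3 (by linarith))) (by positivity)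

lemma slope_mul_angSpeed {a ε u r : ℝ} (h : Params a ε) (hr : 0 < r) (hρ : 0 ≤ polRho a ε u r) :
    slopeField a ε u r * angSpeed a ε u r = √(polRho a ε u r) *
      (-√(polRho a ε u r) * (a - ε * r * Real.cos u) + ε * Real.sin u * r ^ 2) /
        (r * (r ^ 2 + polRho a ε u r)) := by
  have h1 := h.den_pos u
  have h3 : √(polRho a ε u r) ^ 2 = (a - ε * r * Real.cos u) ^ 2 -
      r ^ 2 * (1 - ε ^ 2 * Real.sin u ^ 2) := (Real.sq_sqrt hρ).trans (polRho_eq a ε u r)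
  have h4 : 0 < r ^ 2 + polRho a ε u r := by positivity
  unfold slopeField angSpeed
  set t := √(polRho a ε u r)
  set N := r ^ 2 + polRho a ε u r
  field_simp
  linear_combination (-(t * ε * Real.sin u)) * h3

/-- Reflection in the `x₂`-axis exchanges the families. With the angle oriented by `σ`, the polar
velocity no longer depends on `σ`, so one scalar equation serves both. -/
lemma familyField_pt {a ε σ u r : ℝ} (hσ : σ ^ 2 = 1) (h : Params a ε) (hr : 0 < r)
    (hρ : 0 ≤ polRho a ε u r) :
    familyField (-a) ε σ (pt σ r u) =
      !₂[-(σ * (slopeField a ε u r * angSpeed a ε u r * Real.sin u + r * Real.cos u * angSpeed a ε u r)),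
        slopeField a ε u r * angSpeed a ε u r * Real.cos u - r * Real.sin u * angSpeed a ε u r] := by
  have hx := pt_ne_zero hσ hr u
  have hρ' : 0 ≤ rho a ε (pt σ r u) := by rwa [rho_pt hσ]
  have hA := inner_familyField σ hx hρ'
  have hB := inner_rot_familyField σ hx hρ'
  have hn := pt_normSq hσ r u
  rw [hn, rho_pt hσ, norm_pt hσ hr.le] at hA hB
  rw [slope_mul_angSpeed h hr hρ, angSpeed]
  set w := familyField (-a) ε σ (pt σ r u)
  have hN : 0 < r ^ 2 + polRho a ε u r := by positivity
  set t := √(polRho a ε u r)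
  set N := r ^ 2 + polRho a ε u r
  simp only [pt_fst, pt_snd] at hA hB
  rw [eq_div_iff hN.ne'] at hA hB
  have hsc := Real.sin_sq_add_cos_sq u
  set S := Real.sin u
  set C := Real.cos u
  have e0 : r ^ 2 * N * w 0 = (-(σ * r * S)) * (t * (-t * (a - ε * (r * C)) - ε * r * (σ * -(σ * r * S)))) -
      (r * C) * (t * (t * (ε * -(σ * r * S)) - σ * r * (a - ε * (r * C)))) := by
    rw [← hA, ← hB]
    linear_combination (-(r ^ 2 * N * S ^ 2 * w 0)) * hσ - (r ^ 2 * N * w 0) * hsc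
  have e1 : r ^ 2 * N * w 1 = (r * C) * (t * (-t * (a - ε * (r * C)) - ε * r * (σ * -(σ * r * S)))) +
      (-(σ * r * S)) * (t * (t * (ε * -(σ * r * S)) - σ * r * (a - ε * (r * C)))) := by
    rw [← hA, ← hB]
    linear_combination (-(r ^ 2 * N * S ^ 2 * w 1)) * hσ - (r ^ 2 * N * w 1) * hsc
  refine plane_ext ?_ ?_
  · simp only [Matrix.cons_val_zero]
    refine mul_left_cancel₀ (by positivity : r ^ 2 * N ≠ 0) (e0.trans ?_)
    field_simp
    linear_combination (-(r ^ 2 * t * ε * S ^ 2 * σ)) * hσ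
  · simp only [Matrix.cons_val_one, Matrix.cons_val_fin_one]
    refine mul_left_cancel₀ (by positivity : r ^ 2 * N ≠ 0) (e1.trans ?_)
    field_simp
    ring_nf
    have : σ ^ 2 = 1 := hσ
    simp only [this]
    ring

lemma hasDerivAt_pt (σ : ℝ) {r u : ℝ → ℝ} {r' u' s : ℝ} (hr : HasDerivAt r r' s)
    (hu : HasDerivAt u u' s) : HasDerivAt (fun s => pt σ (r s) (u s))
      !₂[-(σ * (r' * Real.sin (u s) + r s * Real.cos (u s) * u')),
        r' * Real.cos (u s) - r s * Real.sin (u s) * u'] s := by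
  refine hasDerivAt_plane ?_ ?_
  · simp only [pt_fst]
    refine (((hr.const_mul σ).mul hu.sin).neg).congr_deriv ?_
    simp; ring
  · simp only [pt_snd]
    refine (hr.mul hu.cos).congr_deriv ?_
    simp; ring

/-- A solution of the scalar equation inside the ergoregion, reparametrised by `x₀`. -/
lemma IsSol.exists_trajectory {a ε σ : ℝ} (hσ : σ ^ 2 = 1) (h : Params a ε) {x : ℝ → ℝ}
    (hx : IsSol a ε x) {α β : ℝ} (hαβ : α < β)
    (hin : ∀ u ∈ Ioo α β, 0 < x u ∧ 0 < polRho a ε u (x u)) :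
    ∃ (I : Set ℝ) (U : ℝ → ℝ), (∀ s ∈ I, U s ∈ Ioo α β) ∧
      (∀ s ∈ I, HasDerivAt U (angSpeed a ε (U s) (x (U s))) s) ∧ U '' I = Ioo α β ∧
      StrictAntiOn U I ∧ IsTrajectory (-a) ε σ (fun s => pt σ (x (U s)) (U s)) I := by
  have hxc := hx.continuous
  have hρc := hx.continuous_polRho
  have hφ : ContinuousOn (fun u => angSpeed a ε u (x u)) (Ioo α β) := by
    unfold angSpeed
    refine ContinuousOn.div (Continuous.continuousOn (by fun_prop))
      (Continuous.continuousOn (by fun_prop)) fun u hu => ?_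
    obtain ⟨h1, h2⟩ := hin u hu
    positivity
  obtain ⟨I, U, h1, h2, h3, h4, h5, h6⟩ := exists_reparametrization_of_neg hαβ hφ
    fun u hu => angSpeed_neg h (hin u hu).1 (hin u hu).2
  refine ⟨I, U, h3, h4, h5, h6, h1, h2, fun s hs => ?_, fun s hs => ?_⟩
  · obtain ⟨q1, q2⟩ := hin _ (h3 s hs)
    refine ⟨?_, pt_ne_zero hσ q1 _⟩
    rw [ergoregion_eq h.a_pos, mem_ofPred_eq, rho_pt hσ]
    exact q2
  · obtain ⟨q1, q2⟩ := hin _ (h3 s hs)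
    have hr := (hx (U s)).comp s (h4 s hs)
    have := hasDerivAt_pt σ hr (h4 s hs)
    refine this.congr_deriv ?_
    rw [familyField_pt hσ h q1 q2.le, extSlope_eq h q1.le q2.le]
    rfl

/-- Along a trajectory the polar coordinates satisfy the scalar equations. -/
lemma IsTrajectory.hasDerivAt_polar {a ε σ : ℝ} (hσ : σ ^ 2 = 1) (h : Params a ε) {γ : ℝ → Plane}
    {I : Set ℝ} (hγ : IsTrajectory (-a) ε σ γ I) {s : ℝ} (hs : s ∈ I)
    (hslit : toC σ (γ s) ∈ Complex.slitPlane) :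
    HasDerivAt (fun s => ang σ (γ s)) (angSpeed a ε (ang σ (γ s)) ‖γ s‖) s ∧
    HasDerivAt (fun s => ‖γ s‖) (slopeField a ε (ang σ (γ s)) ‖γ s‖ *
      angSpeed a ε (ang σ (γ s)) ‖γ s‖) s := by
  obtain ⟨hmem, hne⟩ := hγ.mem s hs
  have hr := norm_pos_iff.2 hne
  have hpt := pt_ang hσ (γ s)
  have hρ : 0 < polRho a ε (ang σ (γ s)) ‖γ s‖ := by
    rw [← rho_pt hσ, hpt]
    rwa [ergoregion_eq h.a_pos] at hmem
  have hder := hγ.hasDerivAt s hs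
  have hf := familyField_pt hσ h hr hρ.le
  rw [hpt] at hf
  rw [hf] at hder
  have h1 := hasDerivAt_of_hasGradientAt (hasGradientAt_ang hσ hslit) hder
  have h2 := hasDerivAt_of_hasGradientAt (hasGradientAt_norm hne) hder
  have hn : γ s 0 ^ 2 + γ s 1 ^ 2 = ‖γ s‖ ^ 2 := (normSq_eq _).symm
  have c0 : γ s 0 = -(σ * ‖γ s‖ * Real.sin (ang σ (γ s))) := by
    conv_lhs => rw [← hpt]
    simp
  have c1 : γ s 1 = ‖γ s‖ * Real.cos (ang σ (γ s)) := by
    conv_lhs => rw [← hpt]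
    simp
  have hsc := Real.sin_sq_add_cos_sq (ang σ (γ s))
  rw [hn] at h1
  simp only [rot, PiLp.smul_apply, Matrix.cons_val_zero, Matrix.cons_val_one,
    smul_eq_mul, c0, c1] at h1 h2
  set A := ang σ (γ s)
  set r := ‖γ s‖
  set g := slopeField a ε A r
  set w := angSpeed a ε A r
  have hr' := hr.ne'
  refine ⟨h1.congr_deriv ?_, h2.congr_deriv ?_⟩
  · field_simp
    ring_nf
    simp only [hσ]
    linear_combination (w * r) * hsc
  · field_simp
    ring_nf
    simp only [hσ]
    linear_combination (g * w) * hsc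

/-! ### Star-shaped domains given by a radius function of the angle -/

lemma ang_smul (σ : ℝ) {c : ℝ} (hc : 0 < c) (x : Plane) : ang σ (c • x) = ang σ x := by
  rw [ang, ang, map_smul, Complex.real_smul, Complex.arg_real_mul _ hc]

lemma toC_ne_zero {σ : ℝ} (hσ : σ ^ 2 = 1) {x : Plane} (hx : x ≠ 0) : toC σ x ≠ 0 := by
  rw [← norm_ne_zero_iff, norm_toC hσ, norm_ne_zero_iff]; exact hx

/-- The angle jumps across its cut, but it is continuous as a map to the circle `ℝ / 2πℤ`, and `Φ`
with equal end values descends to that circle. -/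
lemma continuousAt_comp_ang {σ : ℝ} (hσ : σ ^ 2 = 1) {Φ : ℝ → ℝ}
    (hΦ : ContinuousOn Φ (Icc 0 (2 * Real.pi))) (hper : Φ 0 = Φ (2 * Real.pi)) {x : Plane}
    (hx : x ≠ 0) : ContinuousAt (fun y => Φ (ang σ y)) x := by
  have : Fact (0 < 2 * Real.pi) := ⟨Real.two_pi_pos⟩
  have e : (fun y => Φ (ang σ y)) =
      fun y => AddCircle.liftIoc (2 * Real.pi) 0 Φ ((ang σ y : ℝ) : AddCircle (2 * Real.pi)) := by
    funext y
    rw [AddCircle.liftIoc_zero_coe_apply (ang_mem σ y)]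
  rw [e]
  have h1 : Continuous (AddCircle.liftIoc (2 * Real.pi) 0 Φ) :=
    AddCircle.liftIoc_continuous (by rwa [zero_add]) (by rwa [zero_add])
  have h2 : ContinuousAt (fun y => ((ang σ y : ℝ) : AddCircle (2 * Real.pi))) x := by
    have h3 : ContinuousAt (fun y => ((Complex.arg (toC σ y) : ℝ) : AddCircle (2 * Real.pi))) x :=
      (Complex.continuousAt_arg_coe_angle (toC_ne_zero hσ hx)).comp (toC σ).continuous.continuousAt
    have h4 := (continuousAt_const (y := ((Real.pi : ℝ) : AddCircle (2 * Real.pi)))).add h3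
    simpa [ang] using! h4
  exact h1.continuousAt.comp h2

/-- The star-shaped domain `r < Φ(u)`. -/
def starDomain (σ : ℝ) (Φ : ℝ → ℝ) : Set Plane := {x | x = 0 ∨ ‖x‖ < Φ (ang σ x)}

lemma isConnected_starDomain (σ : ℝ) (Φ : ℝ → ℝ) : IsConnected (starDomain σ Φ) := by
  have h0 : (0 : Plane) ∈ starDomain σ Φ := Or.inl rfl
  have hs : StarConvex ℝ 0 (starDomain σ Φ) := by
    rw [starConvex_zero_iff]
    intro x hx c hc0 hc1
    rcases eq_or_lt_of_le hc0 with h | h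
    · rw [← h, zero_smul]; exact h0
    rcases hx with hx | hx
    · rw [hx, smul_zero]; exact h0
    refine Or.inr ?_
    rw [ang_smul σ h, norm_smul, Real.norm_of_nonneg hc0]
    nlinarith [norm_nonneg x]
  exact (hs.isPathConnected h0).isConnected

/-- Admissible radius functions. -/
structure IsRadius (Φ : ℝ → ℝ) : Prop where
  cont : ContinuousOn Φ (Icc 0 (2 * Real.pi))
  per : Φ 0 = Φ (2 * Real.pi)
  pos : ∀ u ∈ Icc 0 (2 * Real.pi), 0 < Φ u

namespace IsRadius

variable {σ : ℝ} {Φ : ℝ → ℝ}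

lemma pos_ang (hΦ : IsRadius Φ) (x : Plane) : 0 < Φ (ang σ x) :=
  hΦ.pos _ (Ioc_subset_Icc_self (ang_mem σ x))

lemma exists_pos_le (hΦ : IsRadius Φ) : ∃ m > 0, ∀ u ∈ Icc 0 (2 * Real.pi), m ≤ Φ u := by
  obtain ⟨w, hw, hmin⟩ := isCompact_Icc.exists_isMinOn
    (nonempty_Icc.2 Real.two_pi_pos.le) hΦ.cont
  exact ⟨Φ w, hΦ.pos w hw, fun u hu => isMinOn_iff.1 hmin u hu⟩

lemma le_norm (hΦ : IsRadius Φ) : ∃ m > 0, ∀ x ∉ starDomain σ Φ, m ≤ ‖x‖ := by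
  obtain ⟨m, hm, hle⟩ := hΦ.exists_pos_le
  refine ⟨m, hm, fun x hx => (hle _ (Ioc_subset_Icc_self (ang_mem σ x))).trans ?_⟩
  simp only [starDomain, mem_ofPred_eq, not_or, not_lt] at hx
  exact hx.2

lemma isOpen (hσ : σ ^ 2 = 1) (hΦ : IsRadius Φ) : IsOpen (starDomain σ Φ) := by
  obtain ⟨m, hm, hle⟩ := hΦ.le_norm (σ := σ)
  rw [isOpen_iff_mem_nhds]
  intro x hx
  rcases eq_or_ne x 0 with h0 | h0
  · filter_upwards [Metric.ball_mem_nhds x hm] with y hy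
    by_contra hny
    rw [h0, mem_ball_zero_iff] at hy
    exact absurd hy (not_lt.2 (hle y hny))
  · have := (continuous_norm.continuousAt (x := x)).eventually_lt
      (continuousAt_comp_ang hσ hΦ.cont hΦ.per h0) (hx.resolve_left h0)
    filter_upwards [this] with y hy using Or.inr hy

lemma closure_eq (hσ : σ ^ 2 = 1) (hΦ : IsRadius Φ) :
    closure (starDomain σ Φ) = {x | x = 0 ∨ ‖x‖ ≤ Φ (ang σ x)} := by
  refine Subset.antisymm (closure_minimal (fun x hx => hx.imp_right le_of_lt) ?_) fun x hx => ?_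
  · rw [← isOpen_compl_iff, isOpen_iff_mem_nhds]
    intro x hx
    simp only [mem_compl_iff, mem_ofPred_eq, not_or, not_le] at hx
    have := (continuousAt_comp_ang hσ hΦ.cont hΦ.per hx.1).eventually_lt
      (continuous_norm.continuousAt (x := x)) hx.2
    filter_upwards [this, isOpen_ne.mem_nhds hx.1] with y hy hy0
    simp only [mem_compl_iff, mem_ofPred_eq, not_or, not_le]
    exact ⟨hy0, hy⟩
  · rcases eq_or_ne x 0 with h0 | h0
    · exact subset_closure (Or.inl h0)
    have hle := hx.resolve_left h0
    have ht : Tendsto (fun c : ℝ => c • x) (𝓝[<] 1) (𝓝 x) := by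
      have : Tendsto (fun c : ℝ => c • x) (𝓝 1) (𝓝 ((1 : ℝ) • x)) :=
        (continuous_id.smul continuous_const).tendsto 1
      rw [one_smul] at this
      exact this.mono_left nhdsWithin_le_nhds
    refine mem_closure_of_tendsto ht ?_
    filter_upwards [Ioo_mem_nhdsLT (zero_lt_one' ℝ)] with c hc
    refine Or.inr ?_
    rw [ang_smul σ hc.1, norm_smul, Real.norm_of_nonneg hc.1.le]
    nlinarith [norm_pos_iff.2 h0, hc.2]

lemma frontier_eq (hσ : σ ^ 2 = 1) (hΦ : IsRadius Φ) :
    frontier (starDomain σ Φ) = {x | x ≠ 0 ∧ ‖x‖ = Φ (ang σ x)} := by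
  rw [frontier, (hΦ.isOpen hσ).interior_eq, hΦ.closure_eq hσ]
  ext x
  simp only [starDomain, Set.mem_sdiff, mem_ofPred_eq, not_or, not_lt]
  constructor
  · rintro ⟨h1, h2, h3⟩
    exact ⟨h2, le_antisymm (h1.resolve_left h2) h3⟩
  · rintro ⟨h1, h2⟩
    exact ⟨Or.inr h2.le, h1, h2.ge⟩

lemma frontier_eq_image (hσ : σ ^ 2 = 1) (hΦ : IsRadius Φ) :
    frontier (starDomain σ Φ) = (fun u => pt σ (Φ u) u) '' Ioc 0 (2 * Real.pi) := by
  rw [hΦ.frontier_eq hσ]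
  ext x
  constructor
  · rintro ⟨h1, h2⟩
    exact ⟨ang σ x, ang_mem σ x, by simp only [← h2]; exact pt_ang hσ x⟩
  · rintro ⟨u, hu, rfl⟩
    have hp := hΦ.pos u (Ioc_subset_Icc_self hu)
    exact ⟨pt_ne_zero hσ hp u, by rw [ang_pt hσ hp hu, norm_pt hσ hp.le]⟩

lemma isBounded (hΦ : IsRadius Φ) : Bornology.IsBounded (starDomain σ Φ) := by
  obtain ⟨w, hw, hmax⟩ := isCompact_Icc.exists_isMaxOn
    (nonempty_Icc.2 Real.two_pi_pos.le) hΦ.cont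
  refine (Metric.isBounded_closedBall (x := (0 : Plane)) (r := Φ w)).subset fun x hx => ?_
  rw [mem_closedBall_zero_iff]
  rcases hx with hx | hx
  · rw [hx, norm_zero]; exact (hΦ.pos w hw).le
  · exact hx.le.trans (isMaxOn_iff.1 hmax _ (Ioc_subset_Icc_self (ang_mem σ x)))

end IsRadius

/-! ### The ergosphere in polar coordinates -/

/-- The radius of the ergosphere. -/
def ergRadius (a ε u : ℝ) : ℝ := a / (ε * Real.cos u + √(1 - ε ^ 2 * Real.sin u ^ 2))

lemma abs_eps_cos_lt {a ε : ℝ} (h : Params a ε) (u : ℝ) :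
    |ε * Real.cos u| < √(1 - ε ^ 2 * Real.sin u ^ 2) := by
  refine Real.lt_sqrt_of_sq_lt ?_
  rw [sq_abs]
  nlinarith [h.one_sub_sq_pos, Real.sin_sq_add_cos_sq u]

lemma polRho_eq_mul {a ε : ℝ} (h : Params a ε) (u r : ℝ) : polRho a ε u r =
    (a - r * (ε * Real.cos u + √(1 - ε ^ 2 * Real.sin u ^ 2))) *
      (a + r * (√(1 - ε ^ 2 * Real.sin u ^ 2) - ε * Real.cos u)) := by
  rw [polRho_eq]
  linear_combination r ^ 2 * Real.sq_sqrt (h.den_pos u).le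

lemma ergRadius_pos {a ε : ℝ} (h : Params a ε) (u : ℝ) : 0 < ergRadius a ε u :=
  div_pos h.a_pos (by linarith [(abs_lt.1 (abs_eps_cos_lt h u)).1])

lemma polRho_pos_iff {a ε : ℝ} (h : Params a ε) {u r : ℝ} (hr : 0 ≤ r) :
    0 < polRho a ε u r ↔ r < ergRadius a ε u := by
  have h1 := abs_lt.1 (abs_eps_cos_lt h u)
  have h2 : 0 < a + r * (√(1 - ε ^ 2 * Real.sin u ^ 2) - ε * Real.cos u) :=
    add_pos_of_pos_of_nonneg h.a_pos (mul_nonneg hr (by linarith [h1.2]))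
  rw [polRho_eq_mul h, mul_pos_iff_of_pos_right h2, sub_pos, ergRadius,
    lt_div_iff₀ (by linarith [h1.1])]

lemma polRho_eq_zero_iff {a ε : ℝ} (h : Params a ε) {u r : ℝ} (hr : 0 ≤ r) :
    polRho a ε u r = 0 ↔ r = ergRadius a ε u := by
  have h1 := abs_lt.1 (abs_eps_cos_lt h u)
  have h2 : 0 < a + r * (√(1 - ε ^ 2 * Real.sin u ^ 2) - ε * Real.cos u) :=
    add_pos_of_pos_of_nonneg h.a_pos (mul_nonneg hr (by linarith [h1.2]))
  have h3 : 0 < ε * Real.cos u + √(1 - ε ^ 2 * Real.sin u ^ 2) := by linarith [h1.1]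
  rw [polRho_eq_mul h, mul_eq_zero, or_iff_left h2.ne', sub_eq_zero, ergRadius, eq_div_iff h3.ne',
    eq_comm]

lemma continuous_ergRadius {a ε : ℝ} (h : Params a ε) : Continuous (ergRadius a ε) := by
  unfold ergRadius
  refine continuous_const.div (by fun_prop) fun u => ?_
  have := (abs_lt.1 (abs_eps_cos_lt h u)).1
  linarith

lemma ergRadius_two_pi (a ε : ℝ) : ergRadius a ε (2 * Real.pi) = ergRadius a ε 0 := by
  simp [ergRadius]

lemma ergRadius_zero (a ε : ℝ) : ergRadius a ε 0 = a / (1 + ε) := by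
  simp [ergRadius, add_comm]

lemma ergRadius_two_pi_sub (a ε u : ℝ) : ergRadius a ε (2 * Real.pi - u) = ergRadius a ε u := by
  simp [ergRadius, Real.sin_two_pi_sub, Real.cos_two_pi_sub]

/-! ### The basins of the singularity -/

namespace IsSeparatrix

variable {a ε : ℝ} {R : ℝ → ℝ} {up : ℝ}

lemma le_ergRadius (hS : IsSeparatrix a ε R up) (h : Params a ε) {u : ℝ} (hu : u ∈ Icc 0 up) :
    R u ≤ ergRadius a ε u := by
  have hr := (hS.pos u ⟨hu.1, hu.2.trans hS.up_mem.2.le⟩).le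
  rcases (hS.polRho_nonneg_of_mem h hu).eq_or_lt with h1 | h1
  · exact ((polRho_eq_zero_iff h hr).1 h1.symm).le
  · exact ((polRho_pos_iff h hr).1 h1).le

lemma ergRadius_le (hS : IsSeparatrix a ε R up) (h : Params a ε) {u : ℝ}
    (hu : u ∈ Icc up (2 * Real.pi)) : ergRadius a ε u ≤ R u := by
  have hr := (hS.pos u ⟨by linarith [hu.1, hS.up_mem.1, Real.pi_pos], hu.2⟩).le
  by_contra! hlt
  have h1 := (polRho_pos_iff h hr).2 hlt
  rcases hu.1.eq_or_lt with h2 | h2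
  · rw [← h2, hS.exit] at h1; exact lt_irrefl _ h1
  · exact absurd h1 (hS.outside u ⟨h2, hu.2⟩).le.not_gt

lemma isRadius_basin (hS : IsSeparatrix a ε R up) (h : Params a ε) :
    IsRadius fun u => min (R u) (ergRadius a ε u) where
  cont := (hS.sol.continuous.min (continuous_ergRadius h)).continuousOn
  -- At `2π` the separatrix is beyond the ergosphere, so the minimum is the ergosphere radius, which
  -- in that direction is `a / (1 + ε) = R 0`.
  per := by
    have h1 := hS.ergRadius_le h (u := 2 * Real.pi) ⟨hS.up_mem.2.le, le_rfl⟩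
    rw [min_eq_right h1, ergRadius_two_pi, hS.zero, ergRadius_zero, min_self]
  pos u hu := lt_min (hS.pos u hu) (ergRadius_pos h u)

lemma rho_eq_polRho_ang {σ : ℝ} (hσ : σ ^ 2 = 1) (a ε : ℝ) (x : Plane) :
    rho a ε x = polRho a ε (ang σ x) ‖x‖ := by
  rw [← rho_pt hσ, pt_ang hσ]

/-- The solution through the point reaches `r = 0` at an angle `α` as `u` decreases. Reparametrised
by time, it is a trajectory along which `u` decreases to `α`, hence one ending at `O`. -/
lemma subset_basin (hS : IsSeparatrix a ε R up) (h : Params a ε) {σ : ℝ} (hσ : σ ^ 2 = 1) {x : Plane}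
    (hx0 : x ≠ 0) (hx : ‖x‖ < min (R (ang σ x)) (ergRadius a ε (ang σ x))) :
    x ∈ basin (-a) ε σ := by
  have hr := norm_pos_iff.2 hx0
  obtain ⟨y, α, β, hy, hu, hyu, hyα, hin⟩ := hS.exists_solution_to_zero h (ang_mem σ x) hr
    ((polRho_pos_iff h hr.le).2 (hx.trans_le (min_le_right _ _))) (hx.trans_le (min_le_left _ _))
  obtain ⟨I, U, hU, -, hUI, hanti, hγ⟩ := hy.exists_trajectory hσ h (hu.1.trans hu.2) hin
  refine ⟨I, _, hγ, ?_, ?_⟩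
  · obtain ⟨s₀, hs₀, -⟩ : ang σ x ∈ U '' I := by rw [hUI]; exact hu
    have : Nonempty I := ⟨⟨s₀, hs₀⟩⟩
    rw [tendsto_zero_iff_norm_tendsto_zero]
    refine Metric.tendsto_nhds.2 fun δ hδ => ?_
    have hev : ∀ᶠ u in 𝓝[>] α, y u < δ :=
      (hy.continuous.continuousAt.eventually (gt_mem_nhds (by rwa [hyα]))).filter_mono
        nhdsWithin_le_nhds
    obtain ⟨c, hc, hcsub⟩ := mem_nhdsGT_iff_exists_Ioo_subset.1 hev
    obtain ⟨w, hw1, hw2⟩ := exists_between (lt_min hc (hu.1.trans hu.2))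
    obtain ⟨s₁, hs₁, hsw⟩ : w ∈ U '' I := by
      rw [hUI]; exact ⟨hw1, hw2.trans_le (min_le_right _ _)⟩
    filter_upwards [eventually_ge_atTop (⟨s₁, hs₁⟩ : I)] with s hs
    have h1 : U s ≤ w := hsw ▸ hanti.antitoneOn hs₁ s.2 hs
    have h2 := hU s s.2
    have h3 : y (U s) < δ := hcsub ⟨h2.1, h1.trans_lt (hw2.trans_le (min_le_left _ _))⟩
    have h4 := (hin _ h2).1
    simpa [norm_pt hσ h4.le, abs_of_pos h4] using h3
  · obtain ⟨s₀, hs₀, hsu⟩ : ang σ x ∈ U '' I := by rw [hUI]; exact hu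
    refine ⟨s₀, hs₀, ?_⟩
    simp only [hsu, hyu]
    exact pt_ang hσ x

/-- A trajectory on the separatrix stays on it nearby. -/
lemma eventually_eq_of_eq (hS : IsSeparatrix a ε R up) (h : Params a ε) {σ : ℝ} (hσ : σ ^ 2 = 1)
    {γ : ℝ → Plane} {I : Set ℝ} (hγ : IsTrajectory (-a) ε σ γ I) {c : ℝ} (hc : c ∈ I)
    (hu : ang σ (γ c) ∈ Ioo 0 up) (heq : ‖γ c‖ = R (ang σ (γ c))) :
    ∀ᶠ s in 𝓝 c, ‖γ s‖ = R (ang σ (γ s)) := by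
  have hslit : toC σ (γ c) ∈ Complex.slitPlane := by
    rw [Complex.mem_slitPlane_iff_arg]
    refine ⟨fun harg => ?_, toC_ne_zero hσ (hγ.mem c hc).2⟩
    have := hu.2.trans hS.up_mem.2
    rw [ang, harg] at this
    linarith
  have hγc : ContinuousAt γ c := (hγ.hasDerivAt c hc).continuousAt
  have hd := hγ.hasDerivAt_polar hσ h hc hslit
  have hac := hd.1.continuousAt
  have hnc := hd.2.continuousAt
  have hRac : ContinuousAt (fun s => R (ang σ (γ s))) c := hS.sol.continuous.continuousAt.comp hac
  have hr := norm_pos_iff.2 (hγ.mem c hc).2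
  have hρ : 0 < polRho a ε (ang σ (γ c)) ‖γ c‖ := by rw [heq]; exact hS.inside _ hu
  obtain ⟨K, hK⟩ := exists_lipschitz_slopeField h hρ
  have ht : Tendsto (fun s => (ang σ (γ s), ‖γ s‖, R (ang σ (γ s)))) (𝓝 c)
      (𝓝 (ang σ (γ c), ‖γ c‖, ‖γ c‖)) := by
    refine hac.tendsto.prodMk_nhds (hnc.tendsto.prodMk_nhds ?_)
    conv => rw [heq]
    exact hRac.tendsto
  have hw : ContinuousAt (fun s => angSpeed a ε (ang σ (γ s)) ‖γ s‖) c := by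
    unfold angSpeed polRho
    refine ContinuousAt.div (by fun_prop) (by fun_prop) ?_
    have : 0 < ‖γ c‖ ^ 2 + polRho a ε (ang σ (γ c)) ‖γ c‖ := by positivity
    exact (mul_pos hr this).ne'
  have hM : ∀ᶠ s in 𝓝 c, |angSpeed a ε (ang σ (γ s)) ‖γ s‖| ≤
      |angSpeed a ε (ang σ (γ c)) ‖γ c‖| + 1 :=
    hw.abs.eventually (ge_mem_nhds (by linarith))
  set M := |angSpeed a ε (ang σ (γ c)) ‖γ c‖| + 1
  have hM0 : 0 ≤ M := by positivity
  have hsl : ∀ᶠ s in 𝓝 c, toC σ (γ s) ∈ Complex.slitPlane :=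
    ((toC σ).continuous.continuousAt.comp hγc).eventually
      (Complex.isOpen_slitPlane.mem_nhds hslit)
  have hall : ∀ᶠ s in 𝓝 c, s ∈ I ∧ toC σ (γ s) ∈ Complex.slitPlane ∧ ang σ (γ s) ∈ Ioo 0 up ∧
      |angSpeed a ε (ang σ (γ s)) ‖γ s‖| ≤ M ∧
      |slopeField a ε (ang σ (γ s)) ‖γ s‖ - slopeField a ε (ang σ (γ s)) (R (ang σ (γ s)))| ≤
        K * |‖γ s‖ - R (ang σ (γ s))| := by
    filter_upwards [hγ.isOpen.mem_nhds hc, hsl, hac.eventually (isOpen_Ioo.mem_nhds hu), hM,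
      ht.eventually hK] with s q1 q2 q3 q4 q5 using ⟨q1, q2, q3, q4, q5⟩
  obtain ⟨δ, hδ, hball⟩ := Metric.eventually_nhds_iff_ball.1 hall
  have hsub : ∀ s ∈ Icc (c - δ / 2) (c + δ / 2), s ∈ Metric.ball c δ := by
    intro s hs
    rw [Metric.mem_ball, Real.dist_eq, abs_lt]
    constructor <;> linarith [hs.1, hs.2]
  -- The difference of radii satisfies a linear differential inequality: the slope is Lipschitz at
  -- an interior point and the angular speed is bounded by `M`.
  have hz : ∀ s ∈ Icc (c - δ / 2) (c + δ / 2), ‖γ s‖ - R (ang σ (γ s)) = 0 := by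
    refine eqOn_zero_of_abs_deriv_le (h := fun s => ‖γ s‖ - R (ang σ (γ s)))
      (h' := fun s => slopeField a ε (ang σ (γ s)) ‖γ s‖ * angSpeed a ε (ang σ (γ s)) ‖γ s‖ -
        slopeField a ε (ang σ (γ s)) (R (ang σ (γ s))) * angSpeed a ε (ang σ (γ s)) ‖γ s‖)
      (C := |K| * M) (c := c) (fun s hs => ?_) ⟨by linarith, by linarith⟩ (by simp [heq])
    obtain ⟨hsI, hss, hsu, hsM, hsK⟩ := hball s (hsub s hs)
    obtain ⟨d1, d2⟩ := hγ.hasDerivAt_polar hσ h hsI hss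
    have hR := (hS.sol (ang σ (γ s))).comp s d1
    have hRpos := hS.pos _ ⟨hsu.1.le, (hsu.2.trans hS.up_mem.2).le⟩
    rw [extSlope_eq h hRpos.le (hS.inside _ hsu).le] at hR
    refine ⟨d2.sub hR, ?_⟩
    rw [← sub_mul, abs_mul]
    calc _ ≤ (|K| * |‖γ s‖ - R (ang σ (γ s))|) * M :=
          mul_le_mul (hsK.trans (mul_le_mul_of_nonneg_right (le_abs_self K) (abs_nonneg _))) hsM
            (abs_nonneg _) (by positivity)
      _ = _ := by ring
  filter_upwards [Icc_mem_nhds (show c - δ / 2 < c by linarith) (show c < c + δ / 2 by linarith)]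
    with s hs
  exact sub_eq_zero.1 (hz s hs)

/-- A trajectory outside the domain can only enter through the arc of `R` before `up`, since
trajectories never meet the ergosphere. On that arc uniqueness keeps it on `R`; so it stays outside,
at a positive distance from `O`. -/
lemma basin_subset (hS : IsSeparatrix a ε R up) (h : Params a ε) {σ : ℝ} (hσ : σ ^ 2 = 1) {x : Plane}
    (hx : x ∈ basin (-a) ε σ) :
    x ∈ starDomain σ fun u => min (R u) (ergRadius a ε u) := by
  obtain ⟨I, γ, hγ, ht, s₀, hs₀, rfl⟩ := hx
  set Φ : ℝ → ℝ := fun u => min (R u) (ergRadius a ε u) with hΦdef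
  have hΦ : IsRadius Φ := hS.isRadius_basin h
  have hopen := hΦ.isOpen hσ
  by_contra hx
  have hstay : ∀ s ∈ I, s₀ ≤ s → γ s ∉ starDomain σ Φ := by
    intro s₁ hs₁ hle hmem
    have hIcc : Icc s₀ s₁ ⊆ I := hγ.ordConnected.out hs₀ hs₁
    have hcont : ContinuousOn γ (Icc s₀ s₁) := fun s hs =>
      (hγ.hasDerivAt s (hIcc hs)).continuousAt.continuousWithinAt
    have hZ : IsCompact (Icc s₀ s₁ ∩ γ ⁻¹' (starDomain σ Φ)ᶜ) :=
      isCompact_Icc.of_isClosed_subset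
        (hcont.preimage_isClosed_of_isClosed isClosed_Icc hopen.isClosed_compl) inter_subset_left
    obtain ⟨c, ⟨hc1, hc2⟩, hmax⟩ := hZ.exists_isGreatest ⟨s₀, ⟨le_rfl, hle⟩, hx⟩
    have hcs : c < s₁ := lt_of_le_of_ne hc1.2 fun heq => hc2 (by rwa [heq])
    have hright : ∀ s ∈ Ioc c s₁, γ s ∈ starDomain σ Φ := by
      intro s hs
      by_contra hns
      exact absurd (hmax ⟨⟨hc1.1.trans hs.1.le, hs.2⟩, hns⟩) (not_le.2 hs.1)
    have hcI := hIcc hc1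
    obtain ⟨hmem_c, hne⟩ := hγ.mem c hcI
    rw [ergoregion_eq h.a_pos, mem_ofPred_eq, rho_eq_polRho_ang hσ,
      polRho_pos_iff h (norm_nonneg _)] at hmem_c
    simp only [starDomain, mem_compl_iff, mem_ofPred_eq, not_or, not_lt, hΦdef, mem_preimage] at hc2
    have hRle : R (ang σ (γ c)) ≤ ‖γ c‖ := by
      rcases min_le_iff.1 hc2.2 with h1 | h1
      · exact h1
      · exact absurd hmem_c (not_lt.2 h1)
    have hu : ang σ (γ c) ∈ Ioo 0 up := by
      refine ⟨(ang_mem σ _).1, ?_⟩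
      by_contra! hge
      have := hS.ergRadius_le h ⟨hge, (ang_mem σ (γ c)).2⟩
      linarith
    have hγc : ContinuousAt γ c := (hγ.hasDerivAt c hcI).continuousAt
    have hev : ∀ᶠ s in 𝓝 c, R (ang σ (γ s)) ≤ ‖γ s‖ := by
      rcases hRle.eq_or_lt with heq | hlt
      · filter_upwards [hS.eventually_eq_of_eq h hσ hγ hcI hu heq.symm] with s hs using hs.ge
      · have hslit : toC σ (γ c) ∈ Complex.slitPlane := by
          rw [Complex.mem_slitPlane_iff_arg]
          refine ⟨fun harg => ?_, toC_ne_zero hσ hne⟩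
          have := hu.2.trans hS.up_mem.2
          rw [ang, harg] at this
          linarith
        have hac := (hγ.hasDerivAt_polar hσ h hcI hslit).1.continuousAt
        filter_upwards [ContinuousAt.eventually_lt (f := fun s => R (ang σ (γ s)))
          (hS.sol.continuous.continuousAt.comp hac) hγc.norm hlt] with s hs using hs.le
    obtain ⟨s, hs1, hs2⟩ := ((hev.filter_mono nhdsWithin_le_nhds).and
      (Ioc_mem_nhdsGT hcs : Ioc c s₁ ∈ 𝓝[>] c)).exists
    have hsne := (hγ.mem s (hIcc ⟨hc1.1.trans hs2.1.le, hs2.2⟩)).2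
    have h2 := (hright s hs2).resolve_left hsne
    have h3 := h2.trans_le (min_le_left _ _)
    linarith
  obtain ⟨m, hm, hle⟩ := hΦ.le_norm (σ := σ)
  have : Nonempty I := ⟨⟨s₀, hs₀⟩⟩
  have hev : ∀ᶠ s : I in atTop, ‖γ s‖ < m := by
    have := ht.norm
    rw [norm_zero] at this
    exact this.eventually (gt_mem_nhds hm)
  obtain ⟨s, hs1, hs2⟩ := (hev.and (eventually_ge_atTop (⟨s₀, hs₀⟩ : I))).exists
  exact absurd hs1 (not_lt.2 (hle _ (hstay s s.2 hs2)))

/-- The basin of the singularity, filled in. -/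
lemma insert_basin_eq (hS : IsSeparatrix a ε R up) (h : Params a ε) {σ : ℝ} (hσ : σ ^ 2 = 1) :
    insert 0 (basin (-a) ε σ) = starDomain σ fun u => min (R u) (ergRadius a ε u) := by
  ext x
  rw [mem_insert_iff]
  constructor
  · rintro (rfl | hx)
    · exact Or.inl rfl
    · exact hS.basin_subset h hσ hx
  · intro hx
    rcases eq_or_ne x 0 with h0 | h0
    · exact Or.inl h0
    · exact Or.inr (hS.subset_basin h hσ h0 (hx.resolve_left h0))

end IsSeparatrix

/-! ### Time along the separatrix -/

lemma eq_Ioi_sInf {I : Set ℝ} (hI : IsOpen I) (hc : I.OrdConnected) (hne : I.Nonempty)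
    (hb : BddBelow I) (ha : ¬BddAbove I) : I = Ioi (sInf I) := by
  ext s
  constructor
  · intro hs
    refine lt_of_le_of_ne (csInf_le hb hs) fun heq => ?_
    obtain ⟨l, u, hlu, hsub⟩ := mem_nhds_iff_exists_Ioo_subset.1 (hI.mem_nhds hs)
    obtain ⟨w, hw1, hw2⟩ := exists_between hlu.1
    have := csInf_le hb (hsub ⟨hw1, hw2.trans hlu.2⟩)
    linarith
  · intro hs
    obtain ⟨i, hi, his⟩ := exists_lt_of_csInf_lt hne hs
    obtain ⟨j, hj, hsj⟩ := not_bddAbove_iff.1 ha s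
    exact hc.out hi hj ⟨his.le, hsj.le⟩

/-- `U` parametrises by time the separatrix, as a trajectory of the `(σ)` family. -/
structure IsBoundaryTime (a ε σ : ℝ) (R : ℝ → ℝ) (up : ℝ) (U : ℝ → ℝ) : Prop where
  mem : ∀ s ∈ Ioi (0 : ℝ), U s ∈ Ioo 0 up
  image : U '' Ioi 0 = Ioo 0 up
  anti : StrictAntiOn U (Ioi 0)
  traj : IsTrajectory (-a) ε σ (fun s => pt σ (R (U s)) (U s)) (Ioi 0)

namespace IsSeparatrix

variable {a ε : ℝ} {R : ℝ → ℝ} {up : ℝ}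

lemma mem_inside (hS : IsSeparatrix a ε R up) {u : ℝ} (hu : u ∈ Ioo 0 up) :
    0 < R u ∧ 0 < polRho a ε u (R u) :=
  ⟨hS.pos u ⟨hu.1.le, (hu.2.trans hS.up_mem.2).le⟩, hS.inside u hu⟩

/-- The separatrix does not reach the saddle in finite time. -/
lemma not_bddAbove (hS : IsSeparatrix a ε R up) (h : Params a ε) {I : Set ℝ} {U : ℝ → ℝ}
    (hc : I.OrdConnected) (hU : ∀ s ∈ I, U s ∈ Ioo 0 up)
    (hd : ∀ s ∈ I, HasDerivAt U (angSpeed a ε (U s) (R (U s))) s) (himg : U '' I = Ioo 0 up)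
    (hanti : StrictAntiOn U I) : ¬BddAbove I := by
  rintro ⟨B, hB⟩
  have hπ := Real.pi_pos
  obtain ⟨C, hC, hCt⟩ := hS.exists_sqrt_polRho_le h
  have hRc := hS.sol.continuous
  have hρc := hS.sol.continuous_polRho
  have hcont : ContinuousOn (fun u => ((a - ε * R u * Real.cos u) +
      ε * Real.sin u * √(polRho a ε u (R u))) / (R u * (R u ^ 2 + polRho a ε u (R u))))
      (Icc 0 Real.pi) := by
    refine ContinuousOn.div (Continuous.continuousOn (by fun_prop))
      (Continuous.continuousOn (by fun_prop)) fun u hu => ?_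
    have h1 := hS.pos u ⟨hu.1, by linarith [hu.2]⟩
    have h2 := hS.polRho_nonneg_of_mem h (u := u) ⟨hu.1, hu.2.trans hS.up_mem.1.le⟩
    positivity
  obtain ⟨M, hM⟩ := isCompact_Icc.exists_bound_of_continuousOn hcont
  have hM0 : 0 ≤ M := (norm_nonneg _).trans (hM 0 ⟨le_rfl, hπ.le⟩)
  -- The bound `√ρ ≤ C u` makes the angular speed at most linear in `u`, so `u` decays at most
  -- exponentially and needs infinite time to vanish.
  have hω : ∀ u ∈ Ioo 0 Real.pi, -(C * M * u) ≤ angSpeed a ε u (R u) := by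
    intro u hu
    have h1 := (Real.norm_eq_abs _ ▸ hM u ⟨hu.1.le, hu.2.le⟩)
    have h2 := (abs_le.1 h1).2
    have h3 := hCt u hu
    rw [angSpeed, neg_div, neg_le_neg_iff, mul_div_assoc]
    refine (mul_le_mul_of_nonneg_left h2 (Real.sqrt_nonneg _)).trans ?_
    refine (mul_le_mul_of_nonneg_right h3 hM0).trans (le_of_eq (by ring))
  obtain ⟨s₁, hs₁, hUs₁⟩ : Real.pi / 2 ∈ U '' I := by
    rw [himg]; exact ⟨by positivity, by linarith [hS.up_mem.1]⟩
  have hmono : MonotoneOn (fun s => Real.log (U s) + C * M * s) (I ∩ Ioi s₁) := by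
    have hlog : ∀ s ∈ I, HasDerivAt (fun s => Real.log (U s) + C * M * s)
        (angSpeed a ε (U s) (R (U s)) / U s + C * M) s := fun s hs =>
      ((hd s hs).log (hU s hs).1.ne').add (by simpa using (hasDerivAt_id s).const_mul (C * M))
    refine monotoneOn_of_deriv_nonneg ((hc.inter ordConnected_Ioi).convex)
      (fun s hs => (hlog s hs.1).continuousAt.continuousWithinAt)
      (fun s hs => (hlog s (interior_subset hs).1).differentiableAt.differentiableWithinAt)
      fun s hs => ?_
    have hs' := interior_subset hs
    rw [(hlog s hs'.1).deriv]
    have hu := (hU s hs'.1).1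
    have hlt : U s < Real.pi / 2 := by
      rw [← hUs₁]; exact hanti hs₁ hs'.1 hs'.2
    have h1 := hω (U s) ⟨hu, by linarith⟩
    have h2 : -(C * M) ≤ angSpeed a ε (U s) (R (U s)) / U s := by
      rw [le_div_iff₀ hu]; linarith
    linarith
  obtain ⟨s₂, hs₂, hUs₂⟩ : Real.pi / 4 ∈ U '' I := by
    rw [himg]; exact ⟨by positivity, by linarith [hS.up_mem.1]⟩
  have hs12 : s₁ < s₂ := (hanti.lt_iff_gt hs₂ hs₁).1 (by rw [hUs₁, hUs₂]; linarith)
  -- The value below which `u` cannot fall by time `B`, according to the monotonicity of `log U + C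
  -- M s`.
  set δ := Real.exp (Real.log (Real.pi / 4) + C * M * s₂ - C * M * B) with hδ
  obtain ⟨w, hw0, hw1⟩ := exists_between (lt_min (Real.exp_pos _ : 0 < δ)
    (by positivity : (0 : ℝ) < Real.pi / 4))
  obtain ⟨s, hs, hUs⟩ : w ∈ U '' I := by
    rw [himg]; exact ⟨hw0, by linarith [hw1.trans_le (min_le_right _ _), hS.up_mem.1]⟩
  have hss : s₂ < s := (hanti.lt_iff_gt hs hs₂).1 (by
    rw [hUs, hUs₂]; exact hw1.trans_le (min_le_right _ _))
  have h1 := hmono ⟨hs₂, hs12⟩ ⟨hs, hs12.trans hss⟩ hss.le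
  simp only [hUs, hUs₂] at h1
  have h2 : Real.log w < Real.log (Real.pi / 4) + C * M * s₂ - C * M * B := by
    rw [Real.log_lt_iff_lt_exp hw0]
    exact hw1.trans_le (min_le_left _ _)
  have h3 : C * M * s ≤ C * M * B := mul_le_mul_of_nonneg_left (hB hs) (by positivity)
  linarith

/-- The separatrix starts on the ergosphere at a finite time. -/
lemma bddBelow (hS : IsSeparatrix a ε R up) (h : Params a ε) {I : Set ℝ} {U : ℝ → ℝ}
    (hc : I.OrdConnected) (hU : ∀ s ∈ I, U s ∈ Ioo 0 up)
    (hd : ∀ s ∈ I, HasDerivAt U (angSpeed a ε (U s) (R (U s))) s) (himg : U '' I = Ioo 0 up)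
    (hanti : StrictAntiOn U I) : BddBelow I := by
  have hπ := Real.pi_pos
  have hRc := hS.sol.continuous
  have hρc := hS.sol.continuous_polRho
  have hup := hS.up_mem
  have hup0 : 0 < up := hπ.trans hup.1
  have hRup := hS.pos up ⟨hup0.le, hup.2.le⟩
  obtain ⟨d, hd0, hdup⟩ := hS.sol.exists_hasDerivAt_polRho h hRup hS.exit.le
  set dρ : ℝ → ℝ := fun u => -2 * (a * ε * Real.cos u + (1 - ε ^ 2) * R u) * extSlope a ε u (R u) +
    2 * a * ε * R u * Real.sin u with hdρ
  have hder : ∀ u, HasDerivAt (fun u => polRho a ε u (R u)) (dρ u) u := hS.sol.hasDerivAt_polRho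
  have hdneg : dρ up < 0 := by
    rw [(hder up).unique hdup]
    exact mul_neg_of_neg_of_pos (sin_neg_of_mem hup) hd0
  have hext : Continuous fun u => extSlope a ε u (R u) :=
    (continuous_extSlope h).comp (continuous_id.prodMk hRc)
  -- The rate of `t = √ρ` in time: the `√ρ` in the angular speed cancels that of `dt = dρ / (2√ρ)`,
  -- so `q` is continuous at `up`, and positive there because the exit is transversal.
  set q : ℝ → ℝ := fun u => -dρ u * ((a - ε * R u * Real.cos u) +
    ε * Real.sin u * √(polRho a ε u (R u))) / (2 * (R u * (R u ^ 2 + polRho a ε u (R u)))) with hq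
  have hqc : ContinuousAt q up := by
    simp only [hq, hdρ]
    refine ContinuousAt.div (Continuous.continuousAt (by fun_prop))
      (Continuous.continuousAt (by fun_prop)) ?_
    rw [hS.exit]; positivity
  have hq0 : 0 < q up := by
    simp only [hq]
    rw [hS.exit, Real.sqrt_zero, mul_zero, add_zero, add_zero]
    have := half_le_kappa h hS.exit.ge
    have ha := h.a_pos
    refine div_pos (mul_pos (neg_pos.2 hdneg) (by linarith)) (by positivity)
  have hev : ∀ᶠ u in 𝓝[<] up, q up / 2 < q u :=
    (hqc.eventually (lt_mem_nhds (by linarith))).filter_mono nhdsWithin_le_nhds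
  obtain ⟨l, hl, hlsub⟩ := mem_nhdsLT_iff_exists_Ioo_subset.1 hev
  obtain ⟨w, hw1, hw2⟩ := exists_between (max_lt hl hup0)
  obtain ⟨s₁, hs₁, hUs₁⟩ : w ∈ U '' I := by
    rw [himg]; exact ⟨(le_max_right _ _).trans_lt hw1, hw2⟩
  set t : ℝ → ℝ := fun s => √(polRho a ε (U s) (R (U s))) with ht
  have htd : ∀ s ∈ I, HasDerivAt t (q (U s)) s := by
    intro s hs
    obtain ⟨h1, h2⟩ := hS.mem_inside (hU s hs)
    have h3 := Real.sqrt_pos.2 h2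
    refine (((hder (U s)).comp s (hd s hs)).sqrt h2.ne').congr_deriv ?_
    simp only [hq, angSpeed, Function.comp_apply]
    have h4 : 0 < R (U s) ^ 2 + polRho a ε (U s) (R (U s)) := by positivity
    field_simp
  have hmono : MonotoneOn (fun s => t s - q up / 2 * s) (I ∩ Iio s₁) := by
    have hdd : ∀ s ∈ I, HasDerivAt (fun s => t s - q up / 2 * s) (q (U s) - q up / 2) s :=
      fun s hs => (htd s hs).sub (by simpa using (hasDerivAt_id s).const_mul (q up / 2))
    refine monotoneOn_of_deriv_nonneg ((hc.inter ordConnected_Iio).convex)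
      (fun s hs => (hdd s hs.1).continuousAt.continuousWithinAt)
      (fun s hs => (hdd s (interior_subset hs).1).differentiableAt.differentiableWithinAt)
      fun s hs => ?_
    have hs' := interior_subset hs
    rw [(hdd s hs'.1).deriv]
    have h1 : w < U s := hUs₁ ▸ hanti hs'.1 hs₁ hs'.2
    have h2 : q up / 2 < q (U s) :=
      hlsub ⟨((le_max_left _ _).trans_lt hw1).trans h1, (hU s hs'.1).2⟩
    linarith
  obtain ⟨w₂, hw₂, hw₂'⟩ := exists_between hw2
  obtain ⟨s₂, hs₂, hUs₂⟩ : w₂ ∈ U '' I := by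
    rw [himg]; exact ⟨(le_max_right l 0).trans_lt (hw1.trans hw₂), hw₂'⟩
  have hs21 : s₂ < s₁ := (hanti.lt_iff_gt hs₁ hs₂).1 (by rw [hUs₁, hUs₂]; exact hw₂)
  -- Going back from `s₂`, `t` falls at rate at least `q up / 2` and must stay nonnegative, which
  -- leaves at most the time `t s₂ / (q up / 2)`.
  refine ⟨min s₂ (s₂ - t s₂ / (q up / 2)), fun s hs => ?_⟩
  rcases le_or_gt s₂ s with h1 | h1
  · exact (min_le_left _ _).trans h1
  · refine (min_le_right _ _).trans ?_
    have h2 := hmono ⟨hs, h1.trans hs21⟩ ⟨hs₂, hs21⟩ h1.le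
    have h3 : 0 ≤ t s := Real.sqrt_nonneg _
    simp only at h2
    rw [sub_le_comm, le_div_iff₀ (by linarith)]
    linarith

lemma exists_boundaryTime (hS : IsSeparatrix a ε R up) (h : Params a ε) {σ : ℝ} (hσ : σ ^ 2 = 1) :
    ∃ U, IsBoundaryTime a ε σ R up U := by
  have hup0 : 0 < up := Real.pi_pos.trans hS.up_mem.1
  obtain ⟨I, U, hU, hd, himg, hanti, hγ⟩ := hS.sol.exists_trajectory hσ h hup0
    fun u hu => hS.mem_inside hu
  have hne : I.Nonempty := by
    rw [← image_nonempty (f := U), himg]; exact nonempty_Ioo.2 hup0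
  have hI := eq_Ioi_sInf hγ.isOpen hγ.ordConnected hne
    (hS.bddBelow h hγ.ordConnected hU hd himg hanti)
    (hS.not_bddAbove h hγ.ordConnected hU hd himg hanti)
  set s₀ := sInf I
  have hm : ∀ s ∈ Ioi (0 : ℝ), s + s₀ ∈ I := fun s hs => by
    rw [hI, mem_Ioi]; linarith [mem_Ioi.1 hs]
  refine ⟨fun s => U (s + s₀), fun s hs => hU _ (hm s hs), ?_, ?_, ?_⟩
  · rw [← himg]
    ext u
    constructor
    · rintro ⟨s, hs, rfl⟩; exact ⟨_, hm s hs, rfl⟩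
    · rintro ⟨s, hs, rfl⟩
      refine ⟨s - s₀, ?_, by simp⟩
      rw [hI, mem_Ioi] at hs
      rw [mem_Ioi]; linarith
  · exact fun s hs s' hs' hlt => hanti (hm s hs) (hm s' hs') (by linarith)
  · refine ⟨isOpen_Ioi, ordConnected_Ioi, fun s hs => hγ.mem _ (hm s hs), fun s hs => ?_⟩
    exact (hγ.hasDerivAt _ (hm s hs)).comp_add_const s s₀

end IsSeparatrix

namespace IsBoundaryTime

variable {a ε σ : ℝ} {R : ℝ → ℝ} {up : ℝ} {U : ℝ → ℝ}

lemma exists_time (hU : IsBoundaryTime a ε σ R up U) {u : ℝ} (hu : u ∈ Ioo 0 up) :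
    ∃ s, 0 < s ∧ U s = u := by
  rw [← hU.image] at hu
  exact hu

lemma tendsto_zero (hU : IsBoundaryTime a ε σ R up U) (hup : 0 < up) :
    Tendsto U (𝓝[>] 0) (𝓝 up) := by
  refine tendsto_order.2 ⟨fun l hl => ?_, fun l hl => ?_⟩
  · obtain ⟨w, hw1, hw2⟩ := exists_between (max_lt hl hup)
    obtain ⟨s₁, hs₁, hUs⟩ := hU.exists_time ⟨(le_max_right _ _).trans_lt hw1, hw2⟩
    filter_upwards [Ioo_mem_nhdsGT hs₁] with s hs
    have := hU.anti hs.1 hs₁ hs.2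
    rw [hUs] at this
    exact (le_max_left _ _).trans_lt (hw1.trans this)
  · filter_upwards [self_mem_nhdsWithin] with s hs using (hU.mem s hs).2.trans hl

lemma tendsto_atTop (hU : IsBoundaryTime a ε σ R up U) (hup : 0 < up) :
    Tendsto U atTop (𝓝 0) := by
  refine tendsto_order.2 ⟨fun l hl => ?_, fun l hl => ?_⟩
  · filter_upwards [eventually_gt_atTop 0] with s hs using hl.trans (hU.mem s hs).1
  · obtain ⟨w, hw1, hw2⟩ := exists_between (lt_min hl hup)
    obtain ⟨s₁, hs₁, hUs⟩ := hU.exists_time ⟨hw1, hw2.trans_le (min_le_right _ _)⟩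
    filter_upwards [eventually_gt_atTop s₁] with s hs
    have := hU.anti hs₁ (hs₁.trans hs) hs
    rw [hUs] at this
    exact this.trans (hw2.trans_le (min_le_left _ _))

lemma image_curve (hU : IsBoundaryTime a ε σ R up U) :
    (fun s => pt σ (R (U s)) (U s)) '' Ioi 0 = (fun u => pt σ (R u) u) '' Ioo 0 up := by
  rw [← hU.image, image_image]

lemma image_Ici (hU : IsBoundaryTime a ε σ R up U) {s₁ : ℝ} (hs₁ : 0 < s₁) :
    (fun s => pt σ (R (U s)) (U s)) '' Ici s₁ = (fun u => pt σ (R u) u) '' Ioc 0 (U s₁) := by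
  have : U '' Ici s₁ = Ioc 0 (U s₁) := by
    ext u
    constructor
    · rintro ⟨s, hs, rfl⟩
      have hs0 : s ∈ Ioi (0 : ℝ) := hs₁.trans_le hs
      exact ⟨(hU.mem s hs0).1, hU.anti.antitoneOn hs₁ hs0 hs⟩
    · rintro ⟨h0, h1⟩
      obtain ⟨s, hs, rfl⟩ := hU.exists_time ⟨h0, h1.trans_lt (hU.mem s₁ hs₁).2⟩
      refine ⟨s, ?_, rfl⟩
      by_contra! hlt
      exact absurd (hU.anti hs hs₁ (not_le.1 hlt)) (not_lt.2 h1)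
  rw [← this, image_image]

lemma tendsto_curve {l : Filter ℝ} {u : ℝ} (hR : Continuous R) (hU : Tendsto U l (𝓝 u)) (σ : ℝ) :
    Tendsto (fun s => pt σ (R (U s)) (U s)) l (𝓝 (pt σ (R u) u)) :=
  ((continuous_pt σ).comp (hR.prodMk continuous_id)).continuousAt.tendsto.comp hU

lemma deriv_curve (hU : IsBoundaryTime a ε σ R up U) (hσ : σ ^ 2 = 1) (h : Params a ε)
    (hS : IsSeparatrix a ε R up) {s : ℝ} (hs : 0 < s) :
    deriv (fun s => pt σ (R (U s)) (U s)) s = angSpeed a ε (U s) (R (U s)) •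
      !₂[-(σ * (extSlope a ε (U s) (R (U s)) * Real.sin (U s) + R (U s) * Real.cos (U s))),
        extSlope a ε (U s) (R (U s)) * Real.cos (U s) - R (U s) * Real.sin (U s)] := by
  obtain ⟨h1, h2⟩ := hS.mem_inside (hU.mem s hs)
  rw [(hU.traj.hasDerivAt s hs).deriv, familyField_pt hσ h h1 h2.le, extSlope_eq h h1.le h2.le]
  refine plane_ext ?_ ?_ <;> simp <;> ring

/-- The velocity vanishes at the saddle, but it is a negative scalar times a vector continuous in
`u`, equal to `-R 0 • (σ, 0)` at `u = 0`. Normalising removes the scalar up to its sign. -/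
lemma tendsto_unit_tangent (hU : IsBoundaryTime a ε σ R up U) (hσ : σ ^ 2 = 1) (h : Params a ε)
    (hS : IsSeparatrix a ε R up) :
    Tendsto (fun s => ‖deriv (fun s => pt σ (R (U s)) (U s)) s‖⁻¹ •
      deriv (fun s => pt σ (R (U s)) (U s)) s) atTop (𝓝 !₂[σ, 0]) := by
  have hup0 : 0 < up := Real.pi_pos.trans hS.up_mem.1
  have hRc := hS.sol.continuous
  have hext : Continuous fun u => extSlope a ε u (R u) :=
    (continuous_extSlope h).comp (continuous_id.prodMk hRc)
  set V : ℝ → Plane := fun u =>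
    !₂[-(σ * (extSlope a ε u (R u) * Real.sin u + R u * Real.cos u)),
        extSlope a ε u (R u) * Real.cos u - R u * Real.sin u] with hV
  have hVc : Continuous V := by simp only [hV]; fun_prop
  have hR0 : 0 < R 0 := hS.pos 0 ⟨le_rfl, Real.two_pi_pos.le⟩
  have hext0 : extSlope a ε 0 (R 0) = 0 := by
    rw [hS.zero, extSlope, polRho_saddle_self h]; simp
  have hV0 : V 0 = (-R 0) • !₂[σ, 0] := by
    simp only [hV, hext0]
    refine plane_ext ?_ ?_ <;> simp; ring
  have hunit : ‖(!₂[σ, 0] : Plane)‖ = 1 := by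
    rw [← sq_eq_sq₀ (norm_nonneg _) zero_le_one, normSq_eq]; simpa using hσ
  have hn0 : ‖V 0‖ = R 0 := by
    rw [hV0, norm_smul, hunit, mul_one, norm_neg, Real.norm_of_nonneg hR0.le]
  have hlim : Tendsto (fun u => -(‖V u‖⁻¹ • V u)) (𝓝 0) (𝓝 !₂[σ, 0]) := by
    have hc : ContinuousAt (fun u => -(‖V u‖⁻¹ • V u)) 0 := by
      have h1 : ContinuousAt (fun u => ‖V u‖⁻¹) 0 :=
        hVc.norm.continuousAt.inv₀ (by rw [hn0]; exact hR0.ne')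
      exact (h1.smul hVc.continuousAt).neg
    have : -(‖V 0‖⁻¹ • V 0) = !₂[σ, 0] := by
      rw [hn0, hV0, smul_smul, mul_neg, inv_mul_cancel₀ hR0.ne', neg_smul, one_smul, neg_neg]
    rw [← this]
    exact hc.tendsto
  refine (hlim.comp (hU.tendsto_atTop hup0)).congr' ?_
  filter_upwards [eventually_gt_atTop 0] with s hs
  obtain ⟨h1, h2⟩ := hS.mem_inside (hU.mem s hs)
  have hω := angSpeed_neg h h1 h2
  rw [hU.deriv_curve hσ h hS hs]
  show -(‖V (U s)‖⁻¹ • V (U s)) = ‖_ • V (U s)‖⁻¹ • _ • V (U s)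
  rw [norm_smul, Real.norm_of_nonpos hω.le, smul_smul, mul_inv, ← neg_smul]
  congr 1
  have := hω.ne
  field_simp

end IsBoundaryTime

/-- The two boundary trajectories cross transversally on the symmetry axis. -/
lemma linearIndependent_corner {a ε : ℝ} {R : ℝ → ℝ} {up : ℝ} (h : Params a ε)
    (hS : IsSeparatrix a ε R up) {U V : ℝ → ℝ} (hU : IsBoundaryTime a ε 1 R up U)
    (hV : IsBoundaryTime a ε (-1) R up V) {s t : ℝ} (hs : 0 < s) (ht : 0 < t)
    (hUs : U s = Real.pi) (hVt : V t = Real.pi) :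
    LinearIndependent ℝ ![deriv (fun s => pt 1 (R (U s)) (U s)) s,
      deriv (fun s => pt (-1) (R (V s)) (V s)) t] := by
  obtain ⟨h1, h2⟩ := hS.mem_inside (hU.mem s hs)
  rw [hU.deriv_curve (by norm_num) h hS hs, hV.deriv_curve (by norm_num) h hS ht, hUs, hVt]
  rw [hUs] at h1 h2
  have hω := angSpeed_neg h h1 h2
  have he : 0 < extSlope a ε Real.pi (R Real.pi) := by
    rw [extSlope_eq h h1.le h2.le, slopeField]
    simpa using Real.sqrt_pos.2 h2
  set w := angSpeed a ε Real.pi (R Real.pi)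
  set e := extSlope a ε Real.pi (R Real.pi)
  rw [LinearIndependent.pair_iff]
  intro x y hxy
  have e0 := congrArg (fun v : Plane => v 0) hxy
  have e1 := congrArg (fun v : Plane => v 1) hxy
  simp at e0 e1
  -- At `u = π` the two velocities are mirror images with both components nonzero: the radial slope
  -- is positive since the separatrix is still inside the ergoregion.
  have f0 : (w * R Real.pi) * (x - y) = 0 := by linear_combination e0
  have f1 : (w * e) * (x + y) = 0 := by linear_combination -e1
  have g0 := (mul_eq_zero.1 f0).resolve_left (mul_neg_of_neg_of_pos hω h1).ne
  have g1 := (mul_eq_zero.1 f1).resolve_left (mul_neg_of_neg_of_pos hω he).ne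
  constructor <;> linarith

/-! ### The angle from the symmetry axis through the saddle -/

/-- The angle `u ∈ (-π, π]`. -/
def cang (x : Plane) : ℝ := Complex.arg (toC 1 (-x))

lemma cang_mem (x : Plane) : cang x ∈ Ioc (-Real.pi) Real.pi := Complex.arg_mem_Ioc _

lemma pt_cang (x : Plane) : pt 1 ‖x‖ (cang x) = x := by
  have h := pt_ang (σ := 1) (by norm_num) (-x)
  have h0 := congrArg (fun v : Plane => v 0) h
  have h1 := congrArg (fun v : Plane => v 1) h
  rw [norm_neg, ang] at h0 h1
  simp only [pt_fst, pt_snd, add_comm Real.pi, Real.sin_add_pi, Real.cos_add_pi, PiLp.neg_apply]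
    at h0 h1
  refine plane_ext ?_ ?_
  · rw [pt_fst, cang]; linarith
  · rw [pt_snd, cang]; linarith

lemma hasGradientAt_cang {x : Plane} (hx : toC 1 (-x) ∈ Complex.slitPlane) :
    HasGradientAt cang ((1 / (x 0 ^ 2 + x 1 ^ 2)) • rot x) x := by
  have h1 := hasFDerivAt_inner_of_hasGradientAt (hasGradientAt_arg_toC (σ := 1) (by norm_num) hx)
  have h2 := h1.comp x (hasFDerivAt_id x).neg
  refine hasGradientAt_of_hasFDerivAt (f := cang) h2 fun y => ?_
  simp [inner_eq, rot]
  ring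

lemma toC_neg_mem_slitPlane_iff (x : Plane) :
    toC 1 (-x) ∈ Complex.slitPlane ↔ 0 < x 1 ∨ x 0 ≠ 0 := by
  rw [toC_mem_slitPlane_iff (by norm_num)]
  simp

lemma ang_one_eq {x : Plane} (hx : x ≠ 0) :
    ang 1 x = if 0 < cang x then cang x else cang x + 2 * Real.pi := by
  have hr := norm_pos_iff.2 hx
  have hm := cang_mem x
  have hπ := Real.pi_pos
  split_ifs with h
  · conv_lhs => rw [← pt_cang x]
    exact ang_pt (by norm_num) hr ⟨h, by linarith [hm.2]⟩
  · have := pt_add_int 1 ‖x‖ (cang x) 1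
    rw [pt_cang, Int.cast_one, one_mul] at this
    conv_lhs => rw [← this]
    exact ang_pt (by norm_num) hr ⟨by linarith [hm.1], by linarith⟩

lemma min_ang_eq {x : Plane} (hx : x ≠ 0) :
    min (ang 1 x) (2 * Real.pi - ang 1 x) = |cang x| := by
  have hm := cang_mem x
  rw [ang_one_eq hx]
  split_ifs with h
  · rw [abs_of_pos h, min_eq_left (by linarith [hm.2])]
  · rw [abs_of_nonpos (not_lt.1 h), min_eq_right (by linarith [hm.1])]
    ring

lemma pt_neg_two_pi_sub (σ r u : ℝ) : pt (-σ) r (2 * Real.pi - u) = pt σ r u := by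
  simp [pt, Real.sin_two_pi_sub, Real.cos_two_pi_sub]

lemma ang_neg {σ : ℝ} (hσ : σ ^ 2 = 1) {x : Plane} (hx : x ≠ 0) (h : ang σ x < 2 * Real.pi) :
    ang (-σ) x = 2 * Real.pi - ang σ x := by
  have hm := ang_mem σ x
  conv_lhs => rw [← pt_ang hσ x, ← pt_neg_two_pi_sub]
  exact ang_pt (by rwa [neg_sq]) (norm_pos_iff.2 hx) ⟨by linarith, by linarith [hm.1]⟩

lemma ang_neg_of_eq {σ : ℝ} (hσ : σ ^ 2 = 1) {x : Plane} (hx : x ≠ 0) (h : ang σ x = 2 * Real.pi) :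
    ang (-σ) x = 2 * Real.pi := by
  have e : pt σ ‖x‖ (2 * Real.pi) = pt (-σ) ‖x‖ (2 * Real.pi) := by simp [pt]
  conv_lhs => rw [← pt_ang hσ x, h, e]
  exact ang_pt (by rwa [neg_sq]) (norm_pos_iff.2 hx) ⟨Real.two_pi_pos, le_rfl⟩

/-! ### Jordan curves -/

/-- The curve is a radial graph over the unit circle; points with different directions are
different. -/
lemma IsRadius.isJordanCurve {σ : ℝ} {Φ : ℝ → ℝ} (hσ : σ ^ 2 = 1) (hΦ : IsRadius Φ) :
    IsJordanCurve (frontier (starDomain σ Φ)) := by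
  set e : Circle → Plane := fun z => !₂[(z : ℂ).re, (z : ℂ).im] with he
  have hen : ∀ z, ‖e z‖ = 1 := fun z => by
    rw [← sq_eq_sq₀ (norm_nonneg _) zero_le_one, normSq_eq]
    have := Circle.normSq_coe z
    rw [Complex.normSq_apply] at this
    simp only [he, Matrix.cons_val_zero, Matrix.cons_val_one, Matrix.cons_val_fin_one]
    linarith
  have he0 : ∀ z, e z ≠ 0 := fun z => by rw [← norm_ne_zero_iff, hen]; exact one_ne_zero
  have hec : Continuous e := by
    have h1 : Continuous fun z : Circle => (z : ℂ).re :=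
      Complex.continuous_re.comp continuous_subtype_val
    have h2 : Continuous fun z : Circle => (z : ℂ).im :=
      Complex.continuous_im.comp continuous_subtype_val
    simp only [he]
    fun_prop
  have hpos := fun z => hΦ.pos_ang (σ := σ) (e z)
  have hnorm : ∀ z, ‖Φ (ang σ (e z)) • e z‖ = Φ (ang σ (e z)) := fun z => by
    rw [norm_smul, hen, mul_one, Real.norm_of_nonneg (hpos z).le]
  refine ⟨fun z => Φ (ang σ (e z)) • e z, ?_, ?_, ?_⟩
  · have hc : Continuous fun z => Φ (ang σ (e z)) := continuous_iff_continuousAt.2 fun z =>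
      (continuousAt_comp_ang hσ hΦ.cont hΦ.per (he0 z)).comp (f := e) hec.continuousAt
    exact hc.smul hec
  · intro z w hzw
    simp only at hzw
    have h1 : Φ (ang σ (e z)) = Φ (ang σ (e w)) := by rw [← hnorm z, ← hnorm w, hzw]
    rw [h1] at hzw
    have h2 := smul_right_injective Plane (hpos w).ne' hzw
    have h3 := congrArg (fun v : Plane => v 0) h2
    have h4 := congrArg (fun v : Plane => v 1) h2
    simp only [he, Matrix.cons_val_zero, Matrix.cons_val_one, Matrix.cons_val_fin_one] at h3 h4
    exact Circle.ext (Complex.ext h3 h4)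
  · rw [hΦ.frontier_eq hσ]
    ext x
    constructor
    · rintro ⟨z, rfl⟩
      refine ⟨smul_ne_zero (hpos z).ne' (he0 z), ?_⟩
      simp only
      rw [hnorm, ang_smul σ (hpos z)]
    · rintro ⟨h1, h2⟩
      have hr := norm_pos_iff.2 h1
      have hn : ‖(⟨x 0 / ‖x‖, x 1 / ‖x‖⟩ : ℂ)‖ = 1 := by
        rw [← sq_eq_sq₀ (norm_nonneg _) zero_le_one, Complex.sq_norm, Complex.normSq_mk]
        field_simp
        rw [normSq_eq]
      obtain ⟨w, hw⟩ : ∃ w : Circle, (w : ℂ) = ⟨x 0 / ‖x‖, x 1 / ‖x‖⟩ :=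
        ⟨⟨_, mem_sphere_zero_iff_norm.2 hn⟩, rfl⟩
      have hx : e w = ‖x‖⁻¹ • x := by
        refine plane_ext ?_ ?_ <;> simp [he, hw, div_eq_inv_mul]
      refine ⟨w, ?_⟩
      simp only
      rw [hx, ang_smul σ (inv_pos.2 hr), ← h2, smul_smul, mul_inv_cancel₀ hr.ne', one_smul]

/-! ### Barriers -/

lemma hasGradientAt_barrier {g : ℝ → ℝ} {B : Plane → ℝ} {p σ : ℝ} {y : Plane}
    (hB : HasGradientAt B ((σ / (y 0 ^ 2 + y 1 ^ 2)) • rot y) y) (hg : HasDerivAt g p (B y))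
    (hy : y ≠ 0) : HasGradientAt (fun z => ‖z‖ - g (B z))
      (‖y‖⁻¹ • y - (p * (σ / (y 0 ^ 2 + y 1 ^ 2))) • rot y) y := by
  refine hasGradientAt_of_hasFDerivAt
    ((hasFDerivAt_inner_of_hasGradientAt (hasGradientAt_norm hy)).sub
      (hg.comp_hasFDerivAt y (hasFDerivAt_inner_of_hasGradientAt hB))) fun z => ?_
  simp [inner_eq]
  ring

lemma barrier_inner_velocity {σ : ℝ} (hσ : σ ^ 2 = 1) (a ε p u : ℝ) {y : Plane} (hy : y ≠ 0)
    (hu : pt σ ‖y‖ u = y) :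
    velocity (-a) ε y 0 * (‖y‖⁻¹ • y - (p * (σ / (y 0 ^ 2 + y 1 ^ 2))) • rot y) 0 +
      velocity (-a) ε y 1 * (‖y‖⁻¹ • y - (p * (σ / (y 0 ^ 2 + y 1 ^ 2))) • rot y) 1 =
      (-(a - ε * ‖y‖ * Real.cos u) + ε * Real.sin u * p) / ‖y‖ := by
  have h1 := inner_velocity a ε hy
  have h2 := inner_rot_velocity a ε hy
  have hr := norm_pos_iff.2 hy
  have hn : y 0 ^ 2 + y 1 ^ 2 = ‖y‖ ^ 2 := (normSq_eq y).symm
  have c0 : y 0 = -(σ * ‖y‖ * Real.sin u) := by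
    conv_lhs => rw [← hu]
    simp
  have c1 : y 1 = ‖y‖ * Real.cos u := by
    conv_lhs => rw [← hu]
    simp
  rw [hn]
  set v0 := velocity (-a) ε y 0
  set v1 := velocity (-a) ε y 1
  simp only [rot, PiLp.sub_apply, PiLp.smul_apply, smul_eq_mul, Matrix.cons_val_zero,
    Matrix.cons_val_one, Matrix.cons_val_fin_one]
  have e : v0 * (‖y‖⁻¹ * y 0 - p * (σ / ‖y‖ ^ 2) * -y 1) +
      v1 * (‖y‖⁻¹ * y 1 - p * (σ / ‖y‖ ^ 2) * y 0) =
      ‖y‖⁻¹ * (y 0 * v0 + y 1 * v1) - p * (σ / ‖y‖ ^ 2) * (y 0 * v1 - y 1 * v0) := by ring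
  rw [e, h1, h2, c0, c1]
  field_simp
  linear_combination (ε * p * Real.sin u) * hσ

lemma barrier_normSq {σ : ℝ} (hσ : σ ^ 2 = 1) (p : ℝ) {y : Plane} (hy : y ≠ 0) :
    (‖y‖⁻¹ • y - (p * (σ / (y 0 ^ 2 + y 1 ^ 2))) • rot y) 0 ^ 2 +
      (‖y‖⁻¹ • y - (p * (σ / (y 0 ^ 2 + y 1 ^ 2))) • rot y) 1 ^ 2 =
      (‖y‖ ^ 2 + p ^ 2) / ‖y‖ ^ 2 := by
  have hr := norm_pos_iff.2 hy
  have hn : y 0 ^ 2 + y 1 ^ 2 = ‖y‖ ^ 2 := (normSq_eq y).symm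
  rw [hn]
  simp only [rot, PiLp.sub_apply, PiLp.smul_apply, smul_eq_mul, Matrix.cons_val_zero,
    Matrix.cons_val_one, Matrix.cons_val_fin_one]
  field_simp
  linear_combination (‖y‖ ^ 2 + p ^ 2 * σ ^ 2) * hn + (p ^ 2 * ‖y‖ ^ 2) * hσ

/-! ### Forward null geodesics and barriers -/

/-- The rate of change of time along a bicharacteristic. -/
def timeRate (A ε : ℝ) (x : ℝ → Plane) (ξ : ℝ → Fin 3 → ℝ) (s : ℝ) : ℝ :=
  2 * ∑ k, gInv A ε (x s) 0 k * ξ s k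

namespace IsForwardNullBichar

variable {a ε : ℝ} {x₀ : ℝ → ℝ} {x : ℝ → Plane} {ξ : ℝ → Fin 3 → ℝ} {I : Set ℝ}

lemma continuousAt_space (hx : IsForwardNullBichar (-a) ε x₀ x ξ I) {s : ℝ} (hs : s ∈ I) :
    ContinuousAt x s :=
  (hasDerivAt_plane (f' := !₂[_, _]) (by simpa using! hx.deriv_space s hs 0)
    (by simpa using! hx.deriv_space s hs 1)).continuousAt

/-- Along a forward null geodesic a function grows at most at the rate given by the light cone. -/
lemma exists_deriv_le (hx : IsForwardNullBichar (-a) ε x₀ x ξ I) {s : ℝ} (hs : s ∈ I)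
    {f : Plane → ℝ} {η : Plane} (hf : HasGradientAt f η (x s)) :
    ∃ h', HasDerivAt (fun s => f (x s)) h' s ∧ h' ≤ timeRate (-a) ε x ξ s *
      (velocity (-a) ε (x s) 0 * η 0 + velocity (-a) ε (x s) 1 * η 1 +
        √(η 0 ^ 2 + η 1 ^ 2)) := by
  set v := velocity (-a) ε (x s) with hv
  set k := timeRate (-a) ε x ξ s with hk
  have hk0 : 0 < k := hx.forward s hs
  have hkv : k = 2 * (ξ s 0 + v 0 * ξ s 1 + v 1 * ξ s 2) := by
    simp [hk, timeRate, gInv, Fin.sum_univ_three, hv]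
  have d0 : HasDerivAt (fun s => x s 0) (k * v 0 - 2 * ξ s 1) s := by
    refine (hx.deriv_space s hs 0).congr_deriv ?_
    rw [hkv]
    simp [gInv, Fin.sum_univ_three, hv]
    ring
  have d1 : HasDerivAt (fun s => x s 1) (k * v 1 - 2 * ξ s 2) s := by
    refine (hx.deriv_space s hs 1).congr_deriv ?_
    rw [hkv]
    simp [gInv, Fin.sum_univ_three, hv]
    ring
  -- The null condition says that the velocity relative to the flow has length equal to the rate of
  -- time, i.e. the signal speed is `1`. Cauchy–Schwarz then gives the factor `v · η + |η|`.
  have hnull : 4 * (ξ s 1 ^ 2 + ξ s 2 ^ 2) = k ^ 2 := by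
    have := hx.null s hs
    rw [hkv]
    simp [gInv, Fin.sum_univ_three, ← hv] at this
    linear_combination (-4) * this
  have hd : HasDerivAt x !₂[k * v 0 - 2 * ξ s 1, k * v 1 - 2 * ξ s 2] s :=
    hasDerivAt_plane (by simpa using! d0) (by simpa using! d1)
  refine ⟨_, hasDerivAt_of_hasGradientAt hf hd, ?_⟩
  simp only [Matrix.cons_val_zero, Matrix.cons_val_one, Matrix.cons_val_fin_one]
  have hcs : |-(2 * (η 0 * ξ s 1 + η 1 * ξ s 2))| ≤ k * √(η 0 ^ 2 + η 1 ^ 2) := by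
    refine abs_le_of_sq_le_sq ?_ (mul_nonneg hk0.le (Real.sqrt_nonneg _))
    rw [mul_pow, Real.sq_sqrt (by positivity), ← hnull]
    nlinarith [sq_nonneg (η 0 * ξ s 2 - η 1 * ξ s 1)]
  have := (abs_le.1 hcs).2
  nlinarith

lemma continuousOn_timeRate (hx : IsForwardNullBichar (-a) ε x₀ x ξ I) :
    ContinuousOn (timeRate (-a) ε x ξ) I := by
  intro s hs
  have hxc := hx.continuousAt_space hs
  have hx0 : ContinuousAt (fun s => x s 0) s := (hx.deriv_space s hs 0).continuousAt
  have hx1 : ContinuousAt (fun s => x s 1) s := (hx.deriv_space s hs 1).continuousAt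
  have h0 : ContinuousAt (fun s => ξ s 0) s := (hx.deriv_energy s hs).continuousAt
  have h1 : ContinuousAt (fun s => ξ s 1) s := (hx.deriv_covector s hs 0).continuousAt
  have h2 : ContinuousAt (fun s => ξ s 2) s := (hx.deriv_covector s hs 1).continuousAt
  have hn := normSq_pos (hx.ne_zero s hs)
  have hc : ContinuousAt (fun s => 2 * (ξ s 0 +
      (-a * x s 0 / (x s 0 ^ 2 + x s 1 ^ 2)) * ξ s 1 +
      (-a * x s 1 / (x s 0 ^ 2 + x s 1 ^ 2) + ε) * ξ s 2)) s := by
    refine continuousAt_const.mul ((h0.add (ContinuousAt.mul ?_ h1)).add (ContinuousAt.mul ?_ h2))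
    · exact (continuousAt_const.mul hx0).div ((hx0.pow 2).add (hx1.pow 2)) hn.ne'
    · exact ((continuousAt_const.mul hx1).div ((hx0.pow 2).add (hx1.pow 2)) hn.ne').add
        continuousAt_const
  refine (hc.congr ?_).continuousWithinAt
  filter_upwards [hx.isOpen.mem_nhds hs] with w hw
  simp [timeRate, gInv, Fin.sum_univ_three, velocity_eq a ε (hx.ne_zero w hw)]

/-- Null geodesics do not cross outwards a curve `r = g(u)` on which the eikonal equation holds. -/
lemma norm_le_of_barrier (hx : IsForwardNullBichar (-a) ε x₀ x ξ I) (hε : ε ∈ Ioo 0 1) {σ : ℝ}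
    (hσ : σ ^ 2 = 1) {c b m : ℝ} (hm : 0 < m) (hI : Icc c b ⊆ I) {B : Plane → ℝ} {g p : ℝ → ℝ}
    (hB : ∀ s ∈ Icc c b,
      HasGradientAt B ((σ / (x s 0 ^ 2 + x s 1 ^ 2)) • rot (x s)) (x s) ∧
        pt σ ‖x s‖ (B (x s)) = x s)
    (hg : ∀ s ∈ Icc c b, HasDerivAt g (p (B (x s))) (B (x s)) ∧ m ≤ g (B (x s)) ∧
      √(g (B (x s)) ^ 2 + p (B (x s)) ^ 2) =
        (a - ε * g (B (x s)) * Real.cos (B (x s))) - ε * Real.sin (B (x s)) * p (B (x s)))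
    (h0 : ‖x c‖ ≤ g (B (x c))) : ∀ s ∈ Icc c b, ‖x s‖ ≤ g (B (x s)) := by
  obtain ⟨K, hK⟩ := isCompact_Icc.exists_bound_of_continuousOn (hx.continuousOn_timeRate.mono hI)
  have hgrad : ∀ s ∈ Icc c b, HasGradientAt (fun z => ‖z‖ - g (B z)) _ (x s) := fun s hs =>
    hasGradientAt_barrier (hB s hs).1 (hg s hs).1 (hx.ne_zero s (hI hs))
  have key : ∀ s ∈ Icc c b, ‖x s‖ - g (B (x s)) ≤ 0 := by
    refine nonpos_of_deriv_le_mul (h := fun s => ‖x s‖ - g (B (x s))) (C := K * (2 / m))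
      (fun s hs => ?_) (by linarith) fun s hs hpos => ?_
    · obtain ⟨h', hd, -⟩ := hx.exists_deriv_le (hI hs) (hgrad s hs)
      exact hd.continuousAt.continuousWithinAt
    · have hs' := Ioo_subset_Icc_self hs
      obtain ⟨h', hd, hle⟩ := hx.exists_deriv_le (hI hs') (hgrad s hs')
      refine ⟨h', hd, hle.trans ?_⟩
      have hne := hx.ne_zero s (hI hs')
      have hr := norm_pos_iff.2 hne
      obtain ⟨-, hmg, heik⟩ := hg s hs'
      rw [barrier_inner_velocity hσ a ε _ _ hne (hB s hs').2, barrier_normSq hσ _ hne,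
        Real.sqrt_div (by positivity), Real.sqrt_sq hr.le, ← add_div]
      set r := ‖x s‖
      set u := B (x s)
      set q := p u
      have hgr : g u < r := by linarith
      -- The eikonal equation is known only at radius `g u`. Moving out to `r` costs at most `r - g
      -- u` in the root and as much in the cosine term, so the rate is bounded by a multiple of `r -
      -- g u`.
      have hsq : √(r ^ 2 + q ^ 2) ≤ √(g u ^ 2 + q ^ 2) + (r - g u) := by
        rw [Real.sqrt_le_left (by positivity)]
        have h1 : g u ≤ √(g u ^ 2 + q ^ 2) := Real.le_sqrt_of_sq_le (by nlinarith [sq_nonneg q])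
        have h2 := Real.sq_sqrt (by positivity : 0 ≤ g u ^ 2 + q ^ 2)
        nlinarith
      have hcos : ε * (r - g u) * Real.cos u ≤ r - g u := by
        have h1 := Real.cos_le_one u
        have h2 := Real.neg_one_le_cos u
        have h3 : 0 ≤ ε * (r - g u) := mul_nonneg hε.1.le (by linarith)
        nlinarith [hε.2]
      have hnum : -(a - ε * r * Real.cos u) + ε * Real.sin u * q + √(r ^ 2 + q ^ 2) ≤
          2 * (r - g u) := by linarith
      have hk0 : 0 ≤ timeRate (-a) ε x ξ s := (hx.forward s (hI hs')).le
      have hkK : timeRate (-a) ε x ξ s ≤ K := (le_abs_self _).trans (hK s hs')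
      have hq : (-(a - ε * r * Real.cos u) + ε * Real.sin u * q + √(r ^ 2 + q ^ 2)) / r ≤
          2 / m * (r - g u) := by
        rw [div_le_iff₀ hr]
        refine hnum.trans ?_
        have : 1 ≤ r / m := by rw [one_le_div hm]; linarith
        have h3 : 2 / m * (r - g u) * r = 2 * (r - g u) * (r / m) := by ring
        rw [h3]
        exact le_mul_of_one_le_right (by linarith) this
      have hnn : 0 ≤ 2 / m * (r - g u) := mul_nonneg (by positivity) (by linarith)
      calc _ ≤ timeRate (-a) ε x ξ s * (2 / m * (r - g u)) := mul_le_mul_of_nonneg_left hq hk0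
        _ ≤ K * (2 / m * (r - g u)) := mul_le_mul_of_nonneg_right hkK hnn
        _ = _ := by ring
  intro s hs
  linarith [key s hs]

end IsForwardNullBichar

namespace IsSeparatrix

variable {a ε : ℝ} {R : ℝ → ℝ} {up : ℝ}

/-! ### The eikonal equation on the separatrix -/

/-- Beyond being characteristic, this records which of the two signs occurs: with `F = r - R(u)` it
reads `v · ∇F = -|∇F|` on the curve, so no future-directed null motion has an outward component. -/
lemma eikonal (hS : IsSeparatrix a ε R up) (h : Params a ε) {u : ℝ} (hu : u ∈ Icc 0 up) :
    √(R u ^ 2 + extSlope a ε u (R u) ^ 2) =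
      (a - ε * R u * Real.cos u) - ε * Real.sin u * extSlope a ε u (R u) := by
  have hr := hS.pos u ⟨hu.1, hu.2.trans hS.up_mem.2.le⟩
  have hρ := hS.polRho_nonneg_of_mem h hu
  have hd := h.den_pos u
  rw [extSlope_eq h hr.le hρ, slopeField]
  have h1 := (kappa_sub_pos h hρ).1
  have h2 : 0 < (1 - ε) * (a / 2) := mul_pos (by linarith [h.eps_lt]) (by linarith [h.a_pos])
  have h3 : √(polRho a ε u (R u)) ^ 2 = (a - ε * R u * Real.cos u) ^ 2 -
      R u ^ 2 * (1 - ε ^ 2 * Real.sin u ^ 2) := (Real.sq_sqrt hρ).trans (polRho_eq a ε u (R u))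
  set t := √(polRho a ε u (R u))
  set κ := a - ε * R u * Real.cos u
  have h4 : κ - ε * Real.sin u * ((t - ε * Real.sin u * κ) / (1 - ε ^ 2 * Real.sin u ^ 2)) =
      (κ - ε * Real.sin u * t) / (1 - ε ^ 2 * Real.sin u ^ 2) := by
    field_simp; ring
  have h5 : R u ^ 2 + ((t - ε * Real.sin u * κ) / (1 - ε ^ 2 * Real.sin u ^ 2)) ^ 2 =
      ((κ - ε * Real.sin u * t) / (1 - ε ^ 2 * Real.sin u ^ 2)) ^ 2 := by
    field_simp
    linear_combination (1 - ε ^ 2 * Real.sin u ^ 2) * h3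
  rw [h4, h5, Real.sqrt_sq (div_pos (by linarith) hd).le]

lemma extSlope_zero_eq (hS : IsSeparatrix a ε R up) (h : Params a ε) :
    extSlope a ε 0 (R 0) = 0 := by
  rw [hS.zero, extSlope, polRho_saddle_self h]; simp

/-- The slope of the even extension of the separatrix. -/
def evenSlope (a ε : ℝ) (R : ℝ → ℝ) (w : ℝ) : ℝ :=
  (SignType.sign w : ℝ) * extSlope a ε |w| (R |w|)

/-- The slope of `R` vanishes at the saddle, so reflecting it to an even function creates no kink.
The two boundary arcs then form one barrier across the saddle. -/
lemma hasDerivAt_even (hS : IsSeparatrix a ε R up) (h : Params a ε) (w : ℝ) :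
    HasDerivAt (fun w => R |w|) (evenSlope a ε R w) w := by
  rcases eq_or_ne w 0 with rfl | hw
  · have h0 := hS.sol 0
    rw [hS.extSlope_zero_eq h, hasDerivAt_iff_isLittleO_nhds_zero] at h0
    have h1 : Tendsto (fun z : ℝ => |z|) (𝓝 0) (𝓝 0) := by
      simpa using (continuous_abs (G := ℝ)).tendsto 0
    have h2 := (h0.comp_tendsto h1).trans_le (k := fun z : ℝ => z) fun z => by simp
    rw [evenSlope, sign_zero, hasDerivAt_iff_isLittleO_nhds_zero]
    refine h2.congr_left fun z => ?_
    simp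
  · have := (hS.sol |w|).comp w (hasDerivAt_abs hw)
    exact this.congr_deriv (mul_comm _ _)

lemma eikonal_even (hS : IsSeparatrix a ε R up) (h : Params a ε) {w : ℝ} (hw : |w| ≤ up) :
    √(R |w| ^ 2 + evenSlope a ε R w ^ 2) =
      (a - ε * R |w| * Real.cos w) - ε * Real.sin w * evenSlope a ε R w := by
  have key := hS.eikonal h ⟨abs_nonneg w, hw⟩
  rcases lt_trichotomy w 0 with h0 | rfl | h0
  · rw [evenSlope, sign_neg h0, ← Real.cos_abs w]
    rw [abs_of_neg h0, Real.sin_neg] at key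
    rw [abs_of_neg h0]
    simp only [SignType.coe_neg_one, neg_mul, one_mul, even_two, Even.neg_pow, mul_neg] at key ⊢
    linarith
  · rw [abs_zero, hS.extSlope_zero_eq h] at key
    simpa [evenSlope] using key
  · rw [evenSlope, sign_pos h0]
    rw [abs_of_pos h0] at key ⊢
    simpa using key

/-! ### The black hole as a star-shaped domain -/

/-- The radius function of the black hole. -/
def holeRadius (R : ℝ → ℝ) (u : ℝ) : ℝ := R (min u (2 * Real.pi - u))

lemma holeRadius_ang (R : ℝ → ℝ) {x : Plane} (hx : x ≠ 0) :
    holeRadius R (ang 1 x) = R |cang x| := by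
  rw [holeRadius, min_ang_eq hx]

lemma isRadius_hole (hS : IsSeparatrix a ε R up) : IsRadius (holeRadius R) where
  cont := (hS.sol.continuous.comp (by fun_prop)).continuousOn
  per := by simp [holeRadius, Real.two_pi_pos.le]
  pos u hu := hS.pos _ ⟨le_min hu.1 (by linarith [hu.2]), (min_le_left _ _).trans hu.2⟩

lemma le_reflect (hS : IsSeparatrix a ε R up) (h : Params a ε) {w : ℝ} (hw : w ∈ Ioc 0 Real.pi) :
    R w ≤ R (2 * Real.pi - w) := by
  rcases hw.2.eq_or_lt with h1 | h1
  · rw [h1]; exact le_of_eq (by ring_nf)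
  · exact (hS.lt_reflect h ⟨hw.1, h1⟩).le

/-- In terms of `ang 1`, the second basin has radius function reflected by `u ↦ 2π - u`. Of `R u`
and `R (2π - u)` the one with argument at most `π` is smaller, by `le_reflect`, and it lies within
the ergosphere. -/
lemma blackHole_eq (hS : IsSeparatrix a ε R up) (h : Params a ε) :
    blackHole (-a) ε = starDomain 1 (holeRadius R) := by
  have h1 : (1 : ℝ) ^ 2 = 1 := by norm_num
  have h2 : (-1 : ℝ) ^ 2 = 1 := by norm_num
  have hπ := Real.pi_pos
  rw [blackHole, insert_inter_distrib, hS.insert_basin_eq h h1, hS.insert_basin_eq h h2]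
  ext x
  rcases eq_or_ne x 0 with h0 | h0
  · simp [starDomain, h0]
  simp only [starDomain, mem_inter_iff, mem_ofPred_eq, h0, false_or, lt_min_iff, holeRadius]
  rcases (ang_mem 1 x).2.eq_or_lt with he | he
  · rw [ang_neg_of_eq h1 h0 he, he, sub_self, min_eq_right (by positivity), and_self,
      ergRadius_two_pi, ergRadius_zero, hS.zero, and_iff_right_iff_imp]
    intro hlt
    have := hS.ergRadius_le h (u := 2 * Real.pi) ⟨hS.up_mem.2.le, le_rfl⟩
    rw [ergRadius_two_pi, ergRadius_zero] at this
    exact hlt.trans_le this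
  · rw [ang_neg h1 h0 he, ergRadius_two_pi_sub]
    have hu := (ang_mem 1 x).1
    set u := ang 1 x
    rcases le_total u Real.pi with hle | hle
    · rw [min_eq_left (by linarith)]
      have e1 := hS.le_reflect h ⟨hu, hle⟩
      have e2 := hS.le_ergRadius h (u := u) ⟨hu.le, hle.trans hS.up_mem.1.le⟩
      exact ⟨fun hx => hx.1.1, fun hx => ⟨⟨hx, hx.trans_le e2⟩, hx.trans_le e1, hx.trans_le e2⟩⟩
    · rw [min_eq_right (by linarith)]
      have e1 := hS.le_reflect h (w := 2 * Real.pi - u) ⟨by linarith, by linarith⟩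
      have e2 := hS.le_ergRadius h (u := 2 * Real.pi - u)
        ⟨by linarith, by linarith [hS.up_mem.1]⟩
      rw [ergRadius_two_pi_sub] at e2
      rw [sub_sub_cancel] at e1
      exact ⟨fun hx => hx.2.1, fun hx => ⟨⟨hx.trans_le e1, hx.trans_le e2⟩, hx, hx.trans_le e2⟩⟩

lemma frontier_hole (hS : IsSeparatrix a ε R up) :
    frontier (starDomain 1 (holeRadius R)) = {x | x ≠ 0 ∧ ‖x‖ = R |cang x|} := by
  rw [hS.isRadius_hole.frontier_eq (by norm_num)]
  ext x
  simp only [mem_ofPred_eq]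
  refine and_congr_right fun hx => ?_
  rw [holeRadius_ang R hx]

lemma closure_hole (hS : IsSeparatrix a ε R up) :
    closure (starDomain 1 (holeRadius R)) = {x | x = 0 ∨ ‖x‖ ≤ R |cang x|} := by
  rw [hS.isRadius_hole.closure_eq (by norm_num)]
  ext x
  simp only [mem_ofPred_eq]
  refine or_congr_right' fun hx => ?_
  rw [holeRadius_ang R hx]

lemma pt_one_neg (r u : ℝ) : pt 1 r (-u) = pt (-1) r u := by simp [pt]

lemma frontier_hole_eq_union (hS : IsSeparatrix a ε R up) :
    frontier (starDomain 1 (holeRadius R)) = (fun u => pt 1 (R u) u) '' Ioc 0 Real.pi ∪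
      (fun u => pt (-1) (R u) u) '' Ioc 0 Real.pi ∪ {pt 1 (R 0) 0} := by
  have hπ := Real.pi_pos
  rw [hS.frontier_hole]
  ext x
  constructor
  · rintro ⟨hx, hn⟩
    have hm := cang_mem x
    have hp := pt_cang x
    rw [hn] at hp
    rcases lt_trichotomy (cang x) 0 with h0 | h0 | h0
    · refine Or.inl (Or.inr ⟨-cang x, ⟨by linarith, by linarith [hm.1]⟩, ?_⟩)
      rw [abs_of_neg h0] at hp
      simp only
      rw [← pt_one_neg, neg_neg, hp]
    · rw [h0, abs_zero] at hp
      exact Or.inr hp.symm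
    · refine Or.inl (Or.inl ⟨cang x, ⟨h0, hm.2⟩, ?_⟩)
      rwa [abs_of_pos h0] at hp
  · have key : ∀ σ : ℝ, σ ^ 2 = 1 → ∀ u ∈ Icc 0 Real.pi, pt σ (R u) u ≠ 0 ∧
        (ang 1 (pt σ (R u) u) = 2 * Real.pi - u ∨ ang 1 (pt σ (R u) u) = u →
          ‖pt σ (R u) u‖ = R |cang (pt σ (R u) u)|) := by
      intro σ hσ u hu
      have hr := hS.pos u ⟨hu.1, by linarith [hu.2]⟩
      have hne := pt_ne_zero hσ hr u
      refine ⟨hne, fun h => ?_⟩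
      rw [norm_pt hσ hr.le, ← min_ang_eq hne]
      rcases h with h | h
      · rw [h, min_eq_right (by linarith [hu.2])]; ring_nf
      · rw [h, min_eq_left (by linarith [hu.2])]
    rintro ((⟨u, hu, rfl⟩ | ⟨u, hu, rfl⟩) | rfl)
    · obtain ⟨h1, h2⟩ := key 1 (by norm_num) u ⟨hu.1.le, hu.2⟩
      exact ⟨h1, h2 (Or.inr (ang_pt (by norm_num) (hS.pos u ⟨hu.1.le, by linarith [hu.2]⟩)
        ⟨hu.1, by linarith [hu.2]⟩))⟩
    · obtain ⟨h1, h2⟩ := key (-1) (by norm_num) u ⟨hu.1.le, hu.2⟩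
      refine ⟨h1, h2 (Or.inl ?_)⟩
      have e : pt (-1) (R u) u = pt 1 (R u) (2 * Real.pi - u) := by
        have := pt_neg_two_pi_sub (-1) (R u) u
        rw [neg_neg] at this
        exact this.symm
      rw [e]
      exact ang_pt (by norm_num) (hS.pos u ⟨hu.1.le, by linarith [hu.2]⟩)
        ⟨by linarith [hu.2], by linarith [hu.1]⟩
    · obtain ⟨h1, h2⟩ := key 1 (by norm_num) 0 ⟨le_rfl, hπ.le⟩
      refine ⟨h1, h2 (Or.inl ?_)⟩
      have e : pt 1 (R 0) 0 = pt 1 (R 0) (2 * Real.pi) := by simp [pt]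
      rw [e, sub_zero]
      exact ang_pt (by norm_num) (hS.pos 0 ⟨le_rfl, by positivity⟩) ⟨by positivity, le_rfl⟩

lemma inter_arcs (hS : IsSeparatrix a ε R up) :
    (fun u => pt 1 (R u) u) '' Ioc 0 Real.pi ∩ (fun u => pt (-1) (R u) u) '' Ioc 0 Real.pi =
      {pt 1 (R Real.pi) Real.pi} := by
  have hπ := Real.pi_pos
  ext x
  constructor
  · rintro ⟨⟨u, hu, rfl⟩, v, hv, hvx⟩
    simp only at hvx
    have hru := hS.pos u ⟨hu.1.le, by linarith [hu.2]⟩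
    have hrv := hS.pos v ⟨hv.1.le, by linarith [hv.2]⟩
    have e : pt (-1) (R v) v = pt 1 (R v) (2 * Real.pi - v) := by
      have := pt_neg_two_pi_sub (-1) (R v) v
      rw [neg_neg] at this
      exact this.symm
    rw [e] at hvx
    have h1 := congrArg (ang 1) hvx
    rw [ang_pt (by norm_num) hrv ⟨by linarith [hv.2], by linarith [hv.1]⟩,
      ang_pt (by norm_num) hru ⟨hu.1, by linarith [hu.2]⟩] at h1
    have : u = Real.pi := by linarith [hu.2, hv.2]
    rw [this, mem_singleton_iff]
  · rintro rfl
    refine ⟨⟨Real.pi, ⟨hπ, le_rfl⟩, rfl⟩, Real.pi, ⟨hπ, le_rfl⟩, ?_⟩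
    simp [pt]

/-! ### The boundary of the black hole is characteristic -/

lemma contDiffAt_cang {x : Plane} (hx : toC 1 (-x) ∈ Complex.slitPlane) :
    ContDiffAt ℝ 1 cang x := by
  have h1 : ContDiffAt ℝ 1 Complex.log (toC 1 (-x)) := (Complex.contDiffAt_log hx).restrict_scalars ℝ
  have h2 : ContDiffAt ℝ 1 (fun y : Plane => toC 1 (-y)) x :=
    ((toC 1).contDiff.comp contDiff_neg).contDiffAt
  have h3 := Complex.imCLM.contDiff.contDiffAt.comp x (h1.comp x h2)
  have e : cang = Complex.imCLM ∘ Complex.log ∘ fun y : Plane => toC 1 (-y) := by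
    funext y; simp [cang, Complex.log_im]
  rw [e]
  exact h3

lemma isPiecewiseCharacteristic (hS : IsSeparatrix a ε R up) (h : Params a ε) :
    IsPiecewiseCharacteristic (-a) ε (frontier (starDomain 1 (holeRadius R))) := by
  -- The exceptional points are the saddle, where `|cang|` is not smooth, and the corner, which lies
  -- on the cut of `cang`.
  refine ⟨{pt 1 (R 0) 0, pt 1 (R Real.pi) Real.pi}, by simp, fun x hx hxT => ?_⟩
  rw [hS.frontier_hole] at hx ⊢
  obtain ⟨hx0, hxn⟩ := hx
  have hp := pt_cang x
  have hm := cang_mem x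
  simp only [mem_insert_iff, mem_singleton_iff, not_or] at hxT
  have hc0 : cang x ≠ 0 := fun h0 => by
    rw [hxn, h0, abs_zero] at hp
    exact hxT.1 hp.symm
  have hcπ : cang x ≠ Real.pi := fun h0 => by
    rw [hxn, h0, abs_of_pos Real.pi_pos] at hp
    exact hxT.2 hp.symm
  have hslit : toC 1 (-x) ∈ Complex.slitPlane :=
    Complex.mem_slitPlane_iff_arg.2 ⟨hcπ, toC_ne_zero (by norm_num) (neg_ne_zero.2 hx0)⟩
  have hgrad := hasGradientAt_barrier (hasGradientAt_cang hslit) (hS.hasDerivAt_even h (cang x)) hx0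
  have hsq := barrier_normSq (σ := 1) (by norm_num) (evenSlope a ε R (cang x)) hx0
  have hv := barrier_inner_velocity (σ := 1) (by norm_num) a ε (evenSlope a ε R (cang x)) (cang x)
    hx0 hp
  have hr := norm_pos_iff.2 hx0
  refine ⟨fun y => ‖y‖ - R |cang y|, ?_, ?_, ?_, ?_⟩
  · exact (contDiffAt_norm ℝ hx0).sub
      ((hS.sol.contDiff h).contDiffAt.comp x ((contDiffAt_abs hc0).comp x (contDiffAt_cang hslit)))
  · rw [hgrad.gradient]
    intro h0
    rw [h0] at hsq
    have : 0 < (‖x‖ ^ 2 + evenSlope a ε R (cang x) ^ 2) / ‖x‖ ^ 2 := by positivity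
    rw [← hsq] at this
    simp at this
  · filter_upwards [isOpen_ne.mem_nhds hx0] with y hy
    rw [sub_eq_zero]
    exact ⟨fun h => h.2, fun h => ⟨hy, h⟩⟩
  · rw [hgrad.gradient, spatialForm_eq, hv, hsq]
    have heik := hS.eikonal_even h (w := cang x)
      ((abs_le.2 ⟨hm.1.le, hm.2⟩).trans hS.up_mem.1.le)
    rw [← hxn] at heik
    have h2 := Real.sq_sqrt (by positivity : 0 ≤ ‖x‖ ^ 2 + evenSlope a ε R (cang x) ^ 2)
    rw [heik] at h2
    rw [div_pow, ← sub_div, div_eq_zero_iff]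
    left
    linarith

/-! ### No null geodesic leaves the black hole -/

lemma exists_Icc_subset {x : ℝ → Plane} {c s : ℝ} (hcs : c < s) (hx : ContinuousAt x c)
    {W : Set Plane} (hW : IsOpen W) (hxW : x c ∈ W) :
    ∃ b, c < b ∧ b ≤ s ∧ ∀ z ∈ Icc c b, x z ∈ W := by
  obtain ⟨δ, hδ, hball⟩ := Metric.eventually_nhds_iff_ball.1 (hx.eventually (hW.mem_nhds hxW))
  refine ⟨min s (c + δ / 2), lt_min hcs (by linarith), min_le_left _ _, fun z hz => hball z ?_⟩
  rw [Metric.mem_ball, Real.dist_eq, abs_lt]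
  have := hz.2.trans (min_le_right _ _)
  constructor <;> linarith [hz.1]

/-- A null geodesic on the boundary of the black hole stays for a while in the closure. -/
lemma exists_stay (hS : IsSeparatrix a ε R up) (h : Params a ε) {x₀ : ℝ → ℝ} {x : ℝ → Plane}
    {ξ : ℝ → Fin 3 → ℝ} {I : Set ℝ} (hx : IsForwardNullBichar (-a) ε x₀ x ξ I) {c s : ℝ}
    (hcs : c < s) (hI : Icc c s ⊆ I) (hfr : ‖x c‖ = R |cang (x c)|) :
    ∃ b, c < b ∧ b ≤ s ∧ ‖x b‖ ≤ R |cang (x b)| := by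
  have hπ := Real.pi_pos
  have hcI : c ∈ I := hI ⟨le_rfl, hcs.le⟩
  have hxc := hx.continuousAt_space hcI
  have hne := hx.ne_zero c hcI
  have h1 : (1 : ℝ) ^ 2 = 1 := by norm_num
  have h1' : (-1 : ℝ) ^ 2 = 1 := by norm_num
  obtain ⟨w, hw, hmin⟩ := isCompact_Icc.exists_isMinOn
    (nonempty_Icc.2 Real.two_pi_pos.le) hS.sol.continuous.continuousOn
  have hm0 := hS.pos w hw
  have hmle : ∀ u ∈ Icc 0 (2 * Real.pi), R w ≤ R u := fun u hu => isMinOn_iff.1 hmin u hu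
  -- Away from the negative `x₂`-axis, the saddle included, the even extension is a single barrier.
  by_cases hslit : toC 1 (-x c) ∈ Complex.slitPlane
  · obtain ⟨b, hcb, hbs, hW⟩ := exists_Icc_subset hcs hxc (W := {y | toC 1 (-y) ∈ Complex.slitPlane})
      (Complex.isOpen_slitPlane.preimage ((toC 1).continuous.comp continuous_neg)) hslit
    refine ⟨b, hcb, hbs, ?_⟩
    have hIb : Icc c b ⊆ I := (Icc_subset_Icc_right hbs).trans hI
    refine hx.norm_le_of_barrier ⟨h.eps_pos, h.eps_lt⟩ h1 hm0 hIb (B := cang) (g := fun u => R |u|)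
      (p := evenSlope a ε R) (fun z hz => ⟨hasGradientAt_cang (hW z hz), pt_cang _⟩)
      (fun z hz => ?_) hfr.le b ⟨hcb.le, le_rfl⟩
    have hle : |cang (x z)| ≤ Real.pi := abs_le.2 ⟨(cang_mem _).1.le, (cang_mem _).2⟩
    exact ⟨hS.hasDerivAt_even h _, hmle _ ⟨abs_nonneg _, by linarith⟩,
      hS.eikonal_even h (hle.trans hS.up_mem.1.le)⟩
  · have hq : x c 0 = 0 ∧ x c 1 < 0 := by
      rw [toC_neg_mem_slitPlane_iff, not_or, not_not, not_lt] at hslit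
      refine ⟨hslit.2, lt_of_le_of_ne hslit.1 fun h0 => hne (plane_ext ?_ ?_)⟩
      · simpa using hslit.2
      · simpa using h0
    have hcang : cang (x c) = Real.pi := by
      by_contra hcn
      exact hslit (Complex.mem_slitPlane_iff_arg.2
        ⟨hcn, toC_ne_zero h1 (neg_ne_zero.2 hne)⟩)
    rw [hcang, abs_of_pos hπ] at hfr
    have hang : ∀ σ : ℝ, ang σ (x c) = Real.pi := by
      intro σ
      have : toC σ (x c) = ((-(x c 1) : ℝ) : ℂ) := by
        apply Complex.ext
        · rw [toC_re, Complex.ofReal_re]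
        · rw [toC_im, Complex.ofReal_im, hq.1, mul_zero]
      rw [ang, this, Complex.arg_ofReal_of_nonneg (by linarith [hq.2]), add_zero]
    -- At the corner each family supplies its own barrier: `R` solves the eikonal equation up to `up
    -- > π`, so it continues past the symmetry axis. Both bounds hold, and the closure of the black
    -- hole needs only the one for the smaller angle.
    have key : ∀ σ : ℝ, σ ^ 2 = 1 → ∃ b₁, c < b₁ ∧ b₁ ≤ s ∧
        ∀ z ∈ Icc c b₁, ang σ (x z) < up ∧ ‖x z‖ ≤ R (ang σ (x z)) := by
      intro σ hσ
      have hsl : toC σ (x c) ∈ Complex.slitPlane := by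
        rw [toC_mem_slitPlane_iff hσ]; exact Or.inl hq.2
      have hac : ContinuousAt (ang σ) (x c) :=
        (hasFDerivAt_inner_of_hasGradientAt (hasGradientAt_ang hσ hsl)).continuousAt
      have hnb : ∀ᶠ y in 𝓝 (x c), toC σ y ∈ Complex.slitPlane ∧ ang σ y ∈ Iio up :=
        (((toC σ).continuous.continuousAt).eventually (Complex.isOpen_slitPlane.mem_nhds hsl)).and
          (hac.eventually (isOpen_Iio.mem_nhds (by rw [hang]; exact hS.up_mem.1)))
      obtain ⟨W, hWsub, hWo, hxW⟩ := eventually_nhds_iff.1 hnb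
      obtain ⟨b₁, hcb, hbs, hW⟩ := exists_Icc_subset hcs hxc (W := W) hWo hxW
      refine ⟨b₁, hcb, hbs, fun z hz => ⟨(hWsub _ (hW z hz)).2, ?_⟩⟩
      refine hx.norm_le_of_barrier ⟨h.eps_pos, h.eps_lt⟩ hσ hm0
        ((Icc_subset_Icc_right hbs).trans hI) (B := ang σ) (g := R)
        (p := fun u => extSlope a ε u (R u))
        (fun z hz => ⟨hasGradientAt_ang hσ (hWsub _ (hW z hz)).1, pt_ang hσ _⟩)
        (fun z hz => ?_) (by rw [hang, hfr]) z hz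
      have hlt := (hWsub _ (hW z hz)).2
      have hpos := (ang_mem σ (x z)).1
      exact ⟨hS.sol _, hmle _ (Ioc_subset_Icc_self (ang_mem σ _)),
        hS.eikonal h ⟨hpos.le, (mem_Iio.1 hlt).le⟩⟩
    obtain ⟨b₁, hc1, hs1, hb1⟩ := key 1 h1
    obtain ⟨b₂, hc2, hs2, hb2⟩ := key (-1) h1'
    refine ⟨min b₁ b₂, lt_min hc1 hc2, (min_le_left _ _).trans hs1, ?_⟩
    have e1 := hb1 (min b₁ b₂) ⟨(lt_min hc1 hc2).le, min_le_left _ _⟩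
    have e2 := hb2 (min b₁ b₂) ⟨(lt_min hc1 hc2).le, min_le_right _ _⟩
    have hbne := hx.ne_zero _ (hI ⟨(lt_min hc1 hc2).le, (min_le_left b₁ b₂).trans hs1⟩)
    rw [← min_ang_eq hbne]
    rcases min_choice (ang 1 (x (min b₁ b₂))) (2 * Real.pi - ang 1 (x (min b₁ b₂))) with he | he
    · rw [he]; exact e1.2
    · rw [he]
      rw [← ang_neg h1 hbne (e1.1.trans hS.up_mem.2)]
      exact e2.2

/-- At the last time in the closure the geodesic is on the frontier, because the interior is open;
`exists_stay` then produces a later time in the closure. -/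
lemma noEscape (hS : IsSeparatrix a ε R up) (h : Params a ε) {x₀ : ℝ → ℝ} {x : ℝ → Plane}
    {ξ : ℝ → Fin 3 → ℝ} {I : Set ℝ} (hx : IsForwardNullBichar (-a) ε x₀ x ξ I) {s₁ s₂ : ℝ}
    (hs₁ : s₁ ∈ I) (hs₂ : s₂ ∈ I) (hle : s₁ ≤ s₂) (hD : x s₁ ∈ starDomain 1 (holeRadius R)) :
    x s₂ ∈ closure (starDomain 1 (holeRadius R)) := by
  by_contra hout
  set D := starDomain 1 (holeRadius R)
  have hIcc : Icc s₁ s₂ ⊆ I := hx.ordConnected.out hs₁ hs₂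
  have hcont : ContinuousOn x (Icc s₁ s₂) := fun s hs =>
    (hx.continuousAt_space (hIcc hs)).continuousWithinAt
  have hZ : IsCompact (Icc s₁ s₂ ∩ x ⁻¹' closure D) :=
    isCompact_Icc.of_isClosed_subset
      (hcont.preimage_isClosed_of_isClosed isClosed_Icc isClosed_closure) inter_subset_left
  obtain ⟨c, ⟨hc1, hc2⟩, hmax⟩ := hZ.exists_isGreatest ⟨s₁, ⟨le_rfl, hle⟩, subset_closure hD⟩
  have hcs : c < s₂ := lt_of_le_of_ne hc1.2 fun heq => hout (by rwa [← heq])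
  have hright : ∀ b, c < b → b ≤ s₂ → x b ∉ closure D := fun b hb hb2 hmem =>
    absurd (hmax ⟨⟨hc1.1.trans hb.le, hb2⟩, hmem⟩) (not_le.2 hb)
  have hnD : x c ∉ D := by
    intro hmem
    obtain ⟨b, hb1, hb2, hb3⟩ := exists_Icc_subset hcs (hx.continuousAt_space (hIcc hc1))
      (hS.isRadius_hole.isOpen (σ := 1) (by norm_num)) hmem
    exact hright b hb1 hb2 (subset_closure (hb3 b ⟨hb1.le, le_rfl⟩))
  have hfr : x c ∈ frontier D := by
    rw [frontier, (hS.isRadius_hole.isOpen (σ := 1) (by norm_num)).interior_eq]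
    exact ⟨hc2, hnD⟩
  rw [hS.frontier_hole] at hfr
  obtain ⟨b, hb1, hb2, hb3⟩ := hS.exists_stay h hx hcs
    ((Icc_subset_Icc_left hc1.1).trans hIcc) hfr.2
  refine hright b hb1 hb2 ?_
  rw [hS.closure_hole]
  exact Or.inr hb3

lemma isBlackHole (hS : IsSeparatrix a ε R up) (h : Params a ε) :
    IsBlackHole (-a) ε (blackHole (-a) ε) := by
  rw [hS.blackHole_eq h]
  have h1 : (1 : ℝ) ^ 2 = 1 := by norm_num
  exact ⟨hS.isRadius_hole.isOpen h1, isConnected_starDomain _ _, hS.isRadius_hole.isBounded,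
    hS.isRadius_hole.isJordanCurve h1, hS.isPiecewiseCharacteristic h,
    fun x₀ x ξ I hx s₁ hs₁ s₂ hs₂ hle hD => hS.noEscape h hx hs₁ hs₂ hle hD⟩

end IsSeparatrix

/-! ### Boundaries of the basins in the original polar angle -/

lemma polar_eq_pt_sub {σ : ℝ} (hσ : σ = 1 ∨ σ = -1) (r u : ℝ) :
    polar r (Real.pi / 2 + σ * (u - 2 * Real.pi)) = pt σ r u := by
  have := pt_add_int σ r u (-1)
  rw [polar_eq_pt hσ, ← this]
  congr 1
  push_cast
  ring

namespace IsSeparatrix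

variable {a ε : ℝ} {R : ℝ → ℝ} {up : ℝ}

lemma frontier_basin (hS : IsSeparatrix a ε R up) (h : Params a ε) {σ : ℝ} (hσ : σ ^ 2 = 1) :
    frontier (insert 0 (basin (-a) ε σ)) = (fun u => pt σ (R u) u) '' Ioo 0 up ∪
      (fun u => pt σ (ergRadius a ε u) u) '' Icc up (2 * Real.pi) := by
  have hup0 : 0 < up := Real.pi_pos.trans hS.up_mem.1
  rw [hS.insert_basin_eq h hσ, (hS.isRadius_basin h).frontier_eq_image hσ,
    ← Ioo_union_Icc_eq_Ioc hup0 hS.up_mem.2.le, image_union]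
  congr 1
  · refine image_congr fun u hu => ?_
    rw [min_eq_left (hS.le_ergRadius h ⟨hu.1.le, hu.2.le⟩)]
  · refine image_congr fun u hu => ?_
    rw [min_eq_right (hS.ergRadius_le h hu)]

lemma arc_eq (h : Params a ε) {σ up : ℝ} (hσ : σ = 1 ∨ σ = -1) {J : Set ℝ}
    (hJ : J = (fun u => Real.pi / 2 + σ * (u - 2 * Real.pi)) '' Icc up (2 * Real.pi)) :
    (fun u => pt σ (ergRadius a ε u) u) '' Icc up (2 * Real.pi) =
      {x | x ∈ ergosphere (-a) ε ∧ ∃ r θ : ℝ, 0 < r ∧ θ ∈ J ∧ x = polar r θ} := by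
  have hσ2 : σ ^ 2 = 1 := by rcases hσ with rfl | rfl <;> norm_num
  rw [ergosphere_eq h.a_pos h.eps_pos h.eps_lt]
  ext x
  simp only [mem_ofPred_eq]
  constructor
  · rintro ⟨u, hu, rfl⟩
    have hr := ergRadius_pos h u
    refine ⟨?_, ergRadius a ε u, _, hr, hJ ▸ ⟨u, hu, rfl⟩, (polar_eq_pt_sub hσ _ _).symm⟩
    rw [rho_pt hσ2, polRho_eq_zero_iff h hr.le]
  · rintro ⟨hx, r, θ, hr, hθ, rfl⟩
    rw [hJ] at hθ
    obtain ⟨u, hu, rfl⟩ := hθ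
    simp only at hx ⊢
    rw [polar_eq_pt_sub hσ] at hx ⊢
    rw [rho_pt hσ2, polRho_eq_zero_iff h hr.le] at hx
    exact ⟨u, hu, by rw [hx]⟩

end IsSeparatrix

end Acoustic

end

/-! ### Assembly of the theorem -/

open Acoustic in
theorem mainTheorem2 (A₀ ε : ℝ) (hA : A₀ < -1) (hε0 : 0 < ε) (hε1 : ε < 1) :
    -- the ergosphere is regular: `Δ` vanishes on it and `∇Δ` does not
    (∀ x ∈ ergosphere A₀ ε, x ≠ 0 ∧ delta A₀ ε x = 0 ∧ gradient (delta A₀ ε) x ≠ 0) ∧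
    -- exactly two tangential points, at `θ = π/2` and `θ = -π/2`
    tangentialPoints A₀ ε =
      {polar (-A₀ / (1 + ε)) (Real.pi / 2), polar (-A₀ / (1 - ε)) (-(Real.pi / 2))} ∧
    -- their types, for both families
    (∀ σ : ℝ, σ = 1 ∨ σ = -1 →
      IsSaddleAt A₀ ε σ (Real.pi / 2) ∧
      (ε < 1 / 9 → IsUnstableNodeAt A₀ ε σ (-(Real.pi / 2))) ∧
      (1 / 9 < ε → IsUnstableSpiralAt A₀ ε σ (-(Real.pi / 2)))) ∧
    -- the black hole in the saddle-spiral case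
    (1 / 9 < ε →
      IsBlackHole A₀ ε (blackHole A₀ ε) ∧
      ∃ (γp γm : ℝ → Plane) (rp θp rm θm sp sm : ℝ),
        -- `γp` is a (+) trajectory from the ergosphere to the saddle
        IsTrajectory A₀ ε 1 γp (Set.Ioi 0) ∧
        0 < rp ∧ θp ∈ Set.Ioo (-(Real.pi / 2)) (Real.pi / 2) ∧ polar rp θp ∈ ergosphere A₀ ε ∧
        Tendsto γp (𝓝[>] 0) (𝓝 (polar rp θp)) ∧
        Tendsto γp atTop (𝓝 (polar (-A₀ / (1 + ε)) (Real.pi / 2))) ∧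
        -- `γm` is a (-) trajectory from the ergosphere to the saddle
        IsTrajectory A₀ ε (-1) γm (Set.Ioi 0) ∧
        0 < rm ∧ θm ∈ Set.Ioo (Real.pi / 2) (3 * Real.pi / 2) ∧ polar rm θm ∈ ergosphere A₀ ε ∧
        Tendsto γm (𝓝[>] 0) (𝓝 (polar rm θm)) ∧
        Tendsto γm atTop (𝓝 (polar (-A₀ / (1 + ε)) (Real.pi / 2))) ∧
        -- they bound the sets of (+) and (-) trajectories ending at `O`
        frontier (insert 0 (basin A₀ ε 1)) = γp '' Set.Ioi 0 ∪
          {x | x ∈ ergosphere A₀ ε ∧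
            ∃ r θ : ℝ, 0 < r ∧ θ ∈ Set.Icc θp (Real.pi / 2) ∧ x = polar r θ} ∧
        frontier (insert 0 (basin A₀ ε (-1))) = γm '' Set.Ioi 0 ∪
          {x | x ∈ ergosphere A₀ ε ∧
            ∃ r θ : ℝ, 0 < r ∧ θ ∈ Set.Icc (Real.pi / 2) θm ∧ x = polar r θ} ∧
        -- the boundary of the black hole: two arcs from the corner to the saddle
        0 < sp ∧ 0 < sm ∧ γp sp = γm sm ∧
        frontier (blackHole A₀ ε) =
          γp '' Set.Ici sp ∪ γm '' Set.Ici sm ∪ {polar (-A₀ / (1 + ε)) (Real.pi / 2)} ∧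
        γp '' Set.Ici sp ∩ γm '' Set.Ici sm = {γp sp} ∧
        -- the arcs leave their common point in independent directions: a corner
        LinearIndependent ℝ ![deriv γp sp, deriv γm sm] ∧
        -- at the saddle both arcs are tangent to the ergosphere, and the boundary has no corner
        Tendsto (fun s => ‖deriv γp s‖⁻¹ • deriv γp s) atTop (𝓝 !₂[1, 0]) ∧
        Tendsto (fun s => ‖deriv γm s‖⁻¹ • deriv γm s) atTop (𝓝 !₂[-1, 0])) := by
  obtain ⟨a, rfl⟩ : ∃ a, A₀ = -a := ⟨-A₀, by ring⟩
  simp only [neg_neg]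
  have ha : 0 < a := by linarith
  have h : Params a ε := ⟨ha, hε0, hε1⟩
  have hπ := Real.pi_pos
  have hσ1 : (1 : ℝ) ^ 2 = 1 := by norm_num
  have hσ2 : (-1 : ℝ) ^ 2 = 1 := by norm_num
  refine ⟨fun x hx => ?_, tangentialPoints_eq ha hε0 hε1, fun σ hσ => ?_, fun hsp => ?_⟩
  · rw [ergosphere_eq ha hε0 hε1] at hx
    have hx0 := ne_zero_of_rho_eq_zero ha hx
    refine ⟨hx0, ?_, gradient_delta_ne_zero ha hε0 hε1 hx⟩
    rw [delta_eq a ε hx0, show rho a ε x = 0 from hx, zero_div, neg_zero]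
  · have hσ' : σ ^ 2 = 1 := by rcases hσ with rfl | rfl <;> norm_num
    exact ⟨isSaddleAt ha hε0 hε1 hσ', fun hn => isUnstableNodeAt ha hε0 hn hσ',
      fun hs => isUnstableSpiralAt ha hs hε1 hσ'⟩
  obtain ⟨R, up, hS⟩ := exists_isSeparatrix h hsp
  have hup := hS.up_mem
  have hup0 : 0 < up := hπ.trans hup.1
  obtain ⟨U, hU⟩ := hS.exists_boundaryTime h hσ1
  obtain ⟨V, hV⟩ := hS.exists_boundaryTime h hσ2
  obtain ⟨sp, hsp0, hUsp⟩ := hU.exists_time ⟨hπ, hup.1⟩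
  obtain ⟨sm, hsm0, hVsm⟩ := hV.exists_time ⟨hπ, hup.1⟩
  have hRc := hS.sol.continuous
  have hRup := hS.pos up ⟨hup0.le, hup.2.le⟩
  have hα : ∀ σ : ℝ, polar (a / (1 + ε)) (Real.pi / 2) = pt σ (R 0) 0 := fun σ => by
    rw [polar_pi_div_two, hS.zero]
    refine plane_ext ?_ ?_ <;> simp
  have hexit : ∀ σ : ℝ, σ ^ 2 = 1 → pt σ (R up) up ∈ ergosphere (-a) ε := fun σ hσ => by
    rw [ergosphere_eq ha hε0 hε1, mem_ofPred_eq, rho_pt hσ]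
    exact hS.exit
  -- The exit angle is read from `θ = π/2 + σ (u - 2π)`; subtracting the full turn places it in the
  -- required interval for either family.
  have hp : polar (R up) (up - 3 * Real.pi / 2) = pt 1 (R up) up := by
    rw [← polar_eq_pt_sub (Or.inl rfl)]
    congr 1
    ring
  have hm : polar (R up) (5 * Real.pi / 2 - up) = pt (-1) (R up) up := by
    rw [← polar_eq_pt_sub (Or.inr rfl)]
    congr 1
    ring
  have hP : pt 1 (R Real.pi) Real.pi = pt (-1) (R Real.pi) Real.pi := by simp [pt]
  refine ⟨hS.isBlackHole h, fun s => pt 1 (R (U s)) (U s), fun s => pt (-1) (R (V s)) (V s), R up,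
    up - 3 * Real.pi / 2, R up, 5 * Real.pi / 2 - up, sp, sm, hU.traj, hRup,
    ⟨by linarith [hup.1], by linarith [hup.2]⟩, by rw [hp]; exact hexit 1 hσ1, ?_, ?_, hV.traj, hRup,
    ⟨by linarith [hup.2], by linarith [hup.1]⟩, by rw [hm]; exact hexit (-1) hσ2, ?_, ?_, ?_, ?_,
    hsp0, hsm0, ?_, ?_, ?_, linearIndependent_corner h hS hU hV hsp0 hsm0 hUsp hVsm,
    hU.tendsto_unit_tangent hσ1 h hS, hV.tendsto_unit_tangent hσ2 h hS⟩
  · rw [hp]; exact IsBoundaryTime.tendsto_curve hRc (hU.tendsto_zero hup0) 1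
  · rw [hα 1]; exact IsBoundaryTime.tendsto_curve hRc (hU.tendsto_atTop hup0) 1
  · rw [hm]; exact IsBoundaryTime.tendsto_curve hRc (hV.tendsto_zero hup0) (-1)
  · rw [hα (-1)]; exact IsBoundaryTime.tendsto_curve hRc (hV.tendsto_atTop hup0) (-1)
  · rw [hS.frontier_basin h hσ1, hU.image_curve]
    congr 1
    refine IsSeparatrix.arc_eq h (Or.inl rfl) ?_
    have : (fun u => Real.pi / 2 + 1 * (u - 2 * Real.pi)) = fun u => u + -(3 * Real.pi / 2) := by
      funext u; ring
    rw [this, image_add_const_Icc]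
    congr 1; ring
  · rw [hS.frontier_basin h hσ2, hV.image_curve]
    congr 1
    refine IsSeparatrix.arc_eq h (Or.inr rfl) ?_
    have : (fun u => Real.pi / 2 + -1 * (u - 2 * Real.pi)) = fun u => 5 * Real.pi / 2 - u := by
      funext u; ring
    rw [this, image_const_sub_Icc]
    congr 1; ring
  · simp only [hUsp, hVsm]; exact hP
  · rw [hS.blackHole_eq h, hS.frontier_hole_eq_union, hU.image_Ici hsp0, hV.image_Ici hsm0, hUsp,
      hVsm, hα 1]
  · rw [hU.image_Ici hsp0, hV.image_Ici hsm0, hUsp, hVsm, hS.inter_arcs]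
    simp only [hUsp]
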